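/- **Setting.** Let $(G;A,B)$ be a double Lie group: $G$ is a (smooth, Hausdorff, second countable) Lie group and $A,B\subset G$ are closed Lie subgroups with $A\cap B=\{e\}$ and $G=AB$. Define $a_L,a_R:G\to A$, $b_L,b_R:G\to B$ by $g=a_L(g)b_R(g)=b_L(g)a_R(g)$. Let $G_A$ be the differential groupoid $G$ over $A$ with projections $a_L,a_R$, multiplication $m_A:(b_1a,ab_2)\mapsto b_1ab_2$ and inverse $s(g)=a_R(g)b_R(g)^{-1}$; its left and right fibres are $F_l(g)=gB$, $F_r(g)=Bg$. Let $\mathcal A(G_A)$ be the space of smooth compactly supported complex sections of $\Omega^{1/2}(TF_l)\otimes\Omega^{1/2}(TF_r)$ (bidensities), with $\omega^*(g)(v\otimes w)=\overline{\omega(s(g))(s(w)\otimes s(v))}$, and define $\mathcal A(G_A\times G_A)$ in the same way. Fix a real half-density $\mu_0\ne0$ on $T_eB$, put $\lambda_0(g)(v)=\mu_0(g^{-1}v)$, let $\rho_0$ be the image of $\lambda_0$ under $s$, and $\omega_0=\lambda_0\otimes\rho_0$; every bidensity is $f\omega_0$ (respectively $F(\omega_0\otimes\omega_0)$). The product of $\mathcal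 A(G_A)$ is $(f_1\omega_0)(f_2\omega_0)=(f_1*f_2)\omega_0$, $(f_1*f_2)(g)=\int_{F_l(g)}\lambda_0^2(y)f_1(y)f_2(s(y)g)$ (groupoid product $s(y)g$), and similarly for $G_A\times G_A$. **Comultiplication.** Let $m_B:(ab,ba')\mapsto aba'$ and $\delta=m_B^T$. For $z=(z_1,z_2)\in G\times G$, $a_i=a_L(z_i)$ and $x\in F_l(a_1a_2)$, let $\delta^L(x;a_1,a_2)$ be the pair $(u_1,u_2)$ with $m_B(u_1,u_2)=x$, $a_L(u_i)=a_i$, and let $y=(s(u_1)z_1,s(u_2)z_2)$ (groupoid products). The map $\mathfrak t:(x;y)\mapsto(x;z)$ is a diffeomorphism from $\{(x;y):a_R(x)=a_L(y_1)a_L(y_2)\}$ onto $\{(x;z):a_L(x)=a_L(z_1)a_L(z_2)\}$, with $y$ and $z$ in a fixed right fibre of $G_A\times G_A$. Using the projections to that right fibre, whose fibres are right, respectively left, fibres of $G_A$, one regards $\rho_0(x)\otimes(\rho_0\otimes\rho_0)(y)$ and $\lambda_0(x)\otimes(\rho_0\otimes\rho_0)(z)$ as half-densities on these two manifolds, and $t_\delta$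 is defined by $\mathfrak t\big(\rho_0(x)\otimes(\rho_0\otimes\rho_0)(y)\big)=t_\delta(x;y)\,\lambda_0(x)\otimes(\rho_0\otimes\rho_0)(z)$. For $\omega=f\omega_0$, the operator $\hat\delta(\omega)$ on $\mathcal A(G_A\times G_A)$ is $$\hat\delta(\omega)(F(\omega_0\otimes\omega_0))(z)=\Big(\int_{F_l(a_1a_2)}\lambda_0^2(x)\,f(x)\,t_\delta(x;y)\,F(y)\Big)(\omega_0\otimes\omega_0)(z).$$ A product of operators $\hat\delta(\omega)$, $\omega_1\otimes I$, $I\otimes\omega_2$ (the latter two acting by left multiplication in one variable) is said to be the element $X$ of $\mathcal A(G_A\times G_A)$ if its value on every $\Omega\in\mathcal A(G_A\times G_A)$ is $X\Omega$. **The maps $\tau_z$, $\kappa$, $h$, $\sigma_z$.** Let $\mathrm{Ad}(g)$ have diagonal blocks $g_1,g_4$ with respect to $T_eG=T_eA\oplus T_eB$, and $Q(g)=\det\mathrm{Ad}(g)/(\det g_1\det g_4)$. Put $\tau_z\omega=|Q|^{iz}\omega$, $(R\omega)(g)(v\otimes w)=\omega(g^{-1})(w^{-1}\otimes v^{-1})$,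 where $v^{-1},w^{-1}$ are the images under the group inverse, and $\kappa=R\,\tau_{i/2}$. Let $\tilde\rho_0(g)(w)=\mu_0(wg^{-1})$, let $\tilde\lambda_0$ be its image under $s$, and $\tilde\omega_0=\tilde\lambda_0\otimes\tilde\rho_0$. Fix a real half-density $\nu_0\neq0$ on $T_eA$ and let $\nu_r$ be the corresponding right-invariant half-density on $A$. Put $h(f\tilde\omega_0)=\int_A\nu_r^2 f$, and let $h\otimes\mathrm{id}:\mathcal A(G_A\times G_A)\to\mathcal A(G_A)$ be $h$ applied in the first variable. Let $\sigma$ be defined by $\sigma(g)(\tilde\rho_0\otimes\nu_r)(g)=(\tilde\lambda_0\otimes\nu_r)(g)$, an equality of half-densities on $T_gG$ in which $\nu_r$ is lifted by $a_R$ on the left and by $a_L$ on the right, and put $\sigma_z\omega=|\sigma|^{2iz}\omega$. **Proposition.** Let $\omega,\omega_1,\omega_2\in\mathcal A(G_A)$ and $z\in\mathbb C$. Then $\hat\delta(\omega_1)(I\otimes\omega_2)$, $\hat\delta(\omega_1^*)(\omega_2\otimes I)$ and $(\omega_1^*\otimes I)\hat\delta(\omega_2)$ are (unique) elements of $\mathcal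 A(G_A\times G_A)$, and $$(h\otimes\mathrm{id})\big(\hat\delta(\omega_1)(I\otimes\omega_2)\big)=h(\omega_1)\,\omega_2,$$ $$(h\otimes\mathrm{id})\big(\hat\delta(\omega_1^*)(\omega_2\otimes I)\big)=\kappa\Big((h\otimes\mathrm{id})\big((\omega_1^*\otimes I)\hat\delta(\omega_2)\big)\Big),$$ $$\hat\delta(\sigma_z\omega)(\omega_1\otimes\omega_2)=(\sigma_z\otimes\tau_z)\big(\hat\delta(\omega)(\sigma_{-z}\omega_1\otimes\tau_{-z}\omega_2)\big).$$ -/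

import Mathlib

open scoped Manifold

noncomputable section

/-! ### Half-densities and integration of densities -/

/-- An `n`-tuple of vectors of `V`, where `n = dim V`. -/
abbrev Frame (V : Type*) [AddCommGroup V] [Module ℝ V] : Type _ :=
  Fin (Module.finrank ℝ V) → V

/-- `v A`: the tuple whose `j`-th vector is `∑ i, A i j • v i`. -/
def Frame.mulMatrix {V : Type*} [AddCommGroup V] [Module ℝ V] (v : Frame V)
    (A : Matrix (Fin (Module.finrank ℝ V)) (Fin (Module.finrank ℝ V)) ℝ) : Frame V :=
  fun j => ∑ i, A i j • v i

/-- A fixed basis of `V`, seen as a tuple. It only serves to compute ratios of half-densities,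
which do not depend on it. -/
def stdFrame (V : Type*) [AddCommGroup V] [Module ℝ V] [Module.Finite ℝ V]
    [Module.Free ℝ V] : Frame V :=
  fun i => Module.finBasis ℝ V i

/-- Real half-densities on a finite-dimensional real vector space `V`:
`d (v A) = |det A|^(1/2) d v`. -/
structure HalfDensity (V : Type*) [AddCommGroup V] [Module ℝ V] where
  toFun : Frame V → ℝ
  map_mulMatrix : ∀ (v : Frame V)
    (A : Matrix (Fin (Module.finrank ℝ V)) (Fin (Module.finrank ℝ V)) ℝ),
    toFun (v.mulMatrix A) = Real.sqrt |A.det| * toFun v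

section Calculus

variable {E F : Type*} [NormedAddCommGroup E] [NormedSpace ℝ E]
  [NormedAddCommGroup F] [NormedSpace ℝ F]
  {M N : Type*} [TopologicalSpace M] [ChartedSpace E M] [TopologicalSpace N] [ChartedSpace F N]

/-- The tangent map `T_x M → T_(f x) N` of `f` at `x`. -/
def tangentAt (f : M → N) (x : M) : E →L[ℝ] F := mfderiv 𝓘(ℝ, E) 𝓘(ℝ, F) f x

/-- The measure defined on the domain of the chart at `p` by the density `D`: in coordinates it
is `D(∂₁, …, ∂ₙ) dx₁ ⋯ dxₙ`. -/
def chartMeasure [FiniteDimensional ℝ E] [MeasurableSpace E] [BorelSpace E] [MeasurableSpace M]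
    (D : M → Frame E → ℝ) (p : M) : MeasureTheory.Measure M :=
  (((Module.finBasis ℝ E).addHaar.restrict (chartAt E p).target).withDensity fun y =>
      ENNReal.ofReal (D ((chartAt E p).symm y)
        fun i => tangentAt (chartAt E p).symm y (stdFrame E i))).map (chartAt E p).symm

/-- The measure on the manifold `M` defined by the nonnegative density `D` (`D x v` is the value
of `D` on the tuple `v` of tangent vectors at `x`): it restricts to `chartMeasure D p` on the
domain of every chart, so it is the supremum of these restrictions. -/
def densityMeasure [FiniteDimensional ℝ E] [MeasurableSpace E] [BorelSpace E] [MeasurableSpace M]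
    (D : M → Frame E → ℝ) : MeasureTheory.Measure M :=
  ⨆ p : M, chartMeasure D p

/-- The measure of the left-invariant density `μ₀(g⁻¹ v)²` on a Lie group. -/
def leftMeasure [Group M] [FiniteDimensional ℝ E] [MeasurableSpace E] [BorelSpace E]
    [MeasurableSpace M] (μ₀ : HalfDensity E) : MeasureTheory.Measure M :=
  densityMeasure fun (g : M) v => μ₀.toFun (fun i => tangentAt (fun x : M => g⁻¹ * x) g (v i)) ^ 2

/-- The measure of the right-invariant density `μ₀(v g⁻¹)²` on a Lie group. -/
def rightMeasure [Group M] [FiniteDimensional ℝ E] [MeasurableSpace E] [BorelSpace E]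
    [MeasurableSpace M] (μ₀ : HalfDensity E) : MeasureTheory.Measure M :=
  densityMeasure fun (g : M) v => μ₀.toFun (fun i => tangentAt (fun x : M => x * g⁻¹) g (v i)) ^ 2

end Calculus

/-! ### Double Lie groups -/

/-- A double Lie group `(G; A, B)`: closed (embedded) Lie subgroups `A`, `B` of `G`, given with
their inclusions, such that `A ∩ B = {e}` and `G = A B`. -/
structure DoubleLieGroup (EG EA EB : Type*)
    [NormedAddCommGroup EG] [NormedSpace ℝ EG] [NormedAddCommGroup EA] [NormedSpace ℝ EA]
    [NormedAddCommGroup EB] [NormedSpace ℝ EB]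
    (G A B : Type*) [TopologicalSpace G] [ChartedSpace EG G] [Group G]
    [TopologicalSpace A] [ChartedSpace EA A] [Group A]
    [TopologicalSpace B] [ChartedSpace EB B] [Group B] where
  iA : A →* G
  iB : B →* G
  smooth_iA : ContMDiff 𝓘(ℝ, EA) 𝓘(ℝ, EG) ((⊤ : ℕ∞) : WithTop ℕ∞) iA
  smooth_iB : ContMDiff 𝓘(ℝ, EB) 𝓘(ℝ, EG) ((⊤ : ℕ∞) : WithTop ℕ∞) iB
  immersion_iA : ∀ a : A, Function.Injective (tangentAt (E := EA) (F := EG) iA a)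
  immersion_iB : ∀ b : B, Function.Injective (tangentAt (E := EB) (F := EG) iB b)
  closed_iA : Topology.IsClosedEmbedding iA
  closed_iB : Topology.IsClosedEmbedding iB
  inter_eq : ∀ (a : A) (b : B), iA a = iB b → iA a = 1
  exists_mul : ∀ g : G, ∃ p : A × B, g = iA p.1 * iB p.2

namespace DoubleLieGroup

variable {EG EA EB : Type*}
  [NormedAddCommGroup EG] [NormedSpace ℝ EG]
  [NormedAddCommGroup EA] [NormedSpace ℝ EA]
  [NormedAddCommGroup EB] [NormedSpace ℝ EB]
  {G A B : Type*} [TopologicalSpace G] [ChartedSpace EG G] [Group G]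
  [TopologicalSpace A] [ChartedSpace EA A] [Group A]
  [TopologicalSpace B] [ChartedSpace EB B] [Group B]
  (D : DoubleLieGroup EG EA EB G A B)

/-- The projections given by `g = a_L(g) b_R(g) = b_L(g) a_R(g)`. -/
def aL (g : G) : A := (D.exists_mul g).choose.1

/-- The projection `b_R`, see `aL`. -/
def bR (g : G) : B := (D.exists_mul g).choose.2

/-- The projection `a_R`, see `aL`. -/
def aR (g : G) : A := (D.aL g⁻¹)⁻¹

/-- The projection `b_L`, see `aL`. -/
def bL (g : G) : B := (D.bR g⁻¹)⁻¹

theorem aL_mul_bR (g : G) : D.iA (D.aL g) * D.iB (D.bR g) = g :=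
  (D.exists_mul g).choose_spec.symm

theorem bL_mul_aR (g : G) : D.iB (D.bL g) * D.iA (D.aR g) = g := by
  have h := D.aL_mul_bR g⁻¹
  have h2 := congrArg (·⁻¹) h
  simpa [aR, bL] using h2

/-! The groupoid `G_A` over `A`: the left and right projections are `a_L` and `a_R`, the left
fibre of `g` is `g B`, the right fibre is `B g`. -/

/-- The groupoid multiplication `(b₁ a, a b₂) ↦ b₁ a b₂` of `G_A` (for `a_R(x) = a_L(y)`). -/
def mulA (x y : G) : G := x * (D.iA (D.aR x))⁻¹ * y

/-- The groupoid inverse `g ↦ a_R(g) b_R(g)⁻¹` of `G_A`. -/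
def sA (g : G) : G := D.iA (D.aR g) * (D.iB (D.bR g))⁻¹

/-- For `a_L(x) = a₂ a₃`, the pair `(g₁, g₂)` with `m_B(g₁, g₂) = x`, `a_L(g₁) = a₂` and
`a_L(g₂) = a₃`, where `m_B : (a b, b a') ↦ a b a'` is the multiplication of `G_B`. -/
def deltaL (x : G) (a₂ a₃ : A) : G × G :=
  (D.iA a₂ * D.iB (D.bL (D.iA a₃ * D.iB (D.bR x))), D.iA a₃ * D.iB (D.bR x))

/-- For `a_R(x) = a₂ a₃`, the pair `(g₁, g₂)` with `m_B(g₁, g₂) = x`, `a_R(g₁) = a₂` and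
`a_R(g₂) = a₃`. -/
def deltaR (x : G) (a₂ a₃ : A) : G × G :=
  (D.iB (D.bL x) * D.iA a₂, D.iB (D.bR (D.iB (D.bL x) * D.iA a₂)) * D.iA a₃)

/-- `m_δ(x; y₁, y₂) = δ^R(x; a_L(y₁), a_L(y₂)) · (y₁, y₂)`, the product in `G_A × G_A`, for the
morphism `δ = m_Bᵀ` from `G_A` to `G_A × G_A`. -/
def mDelta (x y₁ y₂ : G) : G × G :=
  (D.mulA (D.deltaR x (D.aL y₁) (D.aL y₂)).1 y₁, D.mulA (D.deltaR x (D.aL y₁) (D.aL y₂)).2 y₂)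

/-! ### The function `Q` -/

/-- The adjoint representation on `T_e G`. -/
def Ad (g : G) : EG →L[ℝ] EG := tangentAt (fun x : G => g * x * g⁻¹) 1

/-- The projection `P_A` of `T_e G = T_e A ⊕ T_e B` onto `T_e A`: the tangent map of `a_L`. -/
def PA : EG →L[ℝ] EA := tangentAt D.aL 1

/-- The projection `P_B` of `T_e G = T_e A ⊕ T_e B` onto `T_e B`: the tangent map of `b_R`. -/
def PB : EG →L[ℝ] EB := tangentAt D.bR 1

/-- The inclusion `T_e A → T_e G`. -/
def jA : EA →L[ℝ] EG := tangentAt D.iA 1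

/-- The inclusion `T_e B → T_e G`. -/
def jB : EB →L[ℝ] EG := tangentAt D.iB 1

/-- `Q(g) = det Ad(g) / (det g₁ det g₄)`, with `g₁`, `g₄` the diagonal blocks of `Ad(g)`. -/
def Q (g : G) : ℝ :=
  (Ad (EG := EG) g).det /
    ((D.PA.comp ((Ad g).comp D.jA)).det * (D.PB.comp ((Ad g).comp D.jB)).det)

/-! ### Bidensities

The fibres of `G_A` through `g` have tangent spaces `g T_e B` and `(T_e B) g` at `g`. A section of
`Ω^{1/2}(e_L) ⊗ Ω^{1/2}(e_R)` is written as a function `ω` with `ω g v w` standing for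
`ω(g)(g v ⊗ w g)`, where `v`, `w` are tuples in `T_e B`. -/

/-- Sections, without any condition, over `G_A`. -/
abbrev Sec (EB G : Type*) [AddCommGroup EB] [Module ℝ EB] : Type _ :=
  G → Frame EB → Frame EB → ℂ

/-- Sections, without any condition, over `G_A × G_A`: `Ω p v₁ w₁ v₂ w₂` stands for
`Ω(g₁, g₂)((g₁ v₁ ⊗ w₁ g₁) ⊗ (g₂ v₂ ⊗ w₂ g₂))`, where `p = (g₁, g₂)`. -/
abbrev Sec₂ (EB G : Type*) [AddCommGroup EB] [Module ℝ EB] : Type _ :=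
  G × G → Frame EB → Frame EB → Frame EB → Frame EB → ℂ

/-- `𝒜(G_A)`: smooth compactly supported bidensities. (The left and right translates of tuples in
`T_e B` are smooth, so smoothness can be tested on them.) -/
structure IsBidensity (EG : Type*) [NormedAddCommGroup EG] [NormedSpace ℝ EG] [ChartedSpace EG G]
    (ω : Sec EB G) : Prop where
  map_left : ∀ g v w M, ω g (v.mulMatrix M) w = (Real.sqrt |M.det| : ℝ) * ω g v w
  map_right : ∀ g v w M, ω g v (w.mulMatrix M) = (Real.sqrt |M.det| : ℝ) * ω g v w
  smooth : ∀ v w, ContMDiff 𝓘(ℝ, EG) 𝓘(ℝ, ℂ) ((⊤ : ℕ∞) : WithTop ℕ∞) fun g => ω g v w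
  compact : HasCompactSupport ω

/-- `𝒜(G_A × G_A)`: smooth compactly supported bidensities on `G_A × G_A`. -/
structure IsBidensity₂ (EG : Type*) [NormedAddCommGroup EG] [NormedSpace ℝ EG]
    [ChartedSpace EG G] (Ω : Sec₂ EB G) : Prop where
  map_left₁ : ∀ p v₁ w₁ v₂ w₂ M,
    Ω p (v₁.mulMatrix M) w₁ v₂ w₂ = (Real.sqrt |M.det| : ℝ) * Ω p v₁ w₁ v₂ w₂
  map_right₁ : ∀ p v₁ w₁ v₂ w₂ M,
    Ω p v₁ (w₁.mulMatrix M) v₂ w₂ = (Real.sqrt |M.det| : ℝ) * Ω p v₁ w₁ v₂ w₂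
  map_left₂ : ∀ p v₁ w₁ v₂ w₂ M,
    Ω p v₁ w₁ (v₂.mulMatrix M) w₂ = (Real.sqrt |M.det| : ℝ) * Ω p v₁ w₁ v₂ w₂
  map_right₂ : ∀ p v₁ w₁ v₂ w₂ M,
    Ω p v₁ w₁ v₂ (w₂.mulMatrix M) = (Real.sqrt |M.det| : ℝ) * Ω p v₁ w₁ v₂ w₂
  smooth : ∀ v₁ w₁ v₂ w₂, ContMDiff (𝓘(ℝ, EG).prod 𝓘(ℝ, EG)) 𝓘(ℝ, ℂ) ((⊤ : ℕ∞) : WithTop ℕ∞)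
    fun p : G × G => Ω p v₁ w₁ v₂ w₂
  compact : HasCompactSupport Ω

/-- `ω₁ ⊗ ω₂`. -/
def tensor (ω₁ ω₂ : Sec EB G) : Sec₂ EB G :=
  fun p v₁ w₁ v₂ w₂ => ω₁ p.1 v₁ w₁ * ω₂ p.2 v₂ w₂

/-- For a diffeomorphism `φ` of `G` that maps the left fibre of `g` to the right fibre of `φ g`:
its tangent map `g T_e B → (T_e B) φ(g)`, as a map of `T_e B`. -/
def leftToRight (φ : G → G) (g : G) : EB →L[ℝ] EB :=
  tangentAt (fun b : B => D.bR (φ (g * D.iB b) * (φ g)⁻¹)) 1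

/-- For a diffeomorphism `φ` of `G` that maps the right fibre of `g` to the left fibre of `φ g`:
its tangent map `(T_e B) g → φ(g) T_e B`, as a map of `T_e B`. -/
def rightToLeft (φ : G → G) (g : G) : EB →L[ℝ] EB :=
  tangentAt (fun b : B => D.bR ((φ g)⁻¹ * φ (D.iB b * g))) 1

/-- The `*`-operation `ω*(g)(v ⊗ w) = conj (ω(s_A g)(s_A w ⊗ s_A v))`. -/
def star (ω : Sec EB G) : Sec EB G := fun g v w =>
  (starRingEnd ℂ) (ω (D.sA g) (fun i => D.rightToLeft D.sA g (w i))
    (fun i => D.leftToRight D.sA g (v i)))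

/-- `(R ω)(g)(v ⊗ w) = ω(g⁻¹)(w⁻¹ ⊗ v⁻¹)`, with `v⁻¹`, `w⁻¹` the images under the group
inverse. -/
def unitaryCoinverse (ω : Sec EB G) : Sec EB G := fun g v w =>
  ω g⁻¹ (fun i => D.rightToLeft (fun x : G => x⁻¹) g (w i))
    (fun i => D.leftToRight (fun x : G => x⁻¹) g (v i))

/-- `τ_z ω = |Q|^{iz} ω`. -/
def tau (z : ℂ) (ω : Sec EB G) : Sec EB G := fun g v w =>
  ((|D.Q g| : ℝ) : ℂ) ^ (Complex.I * z) * ω g v w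

/-- `κ = R τ_{i/2}`. -/
def kappa (ω : Sec EB G) : Sec EB G := D.unitaryCoinverse (D.tau (Complex.I / 2) ω)

/-! ### Products and the comultiplication

A real half-density `μ₀ ≠ 0` on `T_e B` gives the left-invariant half-density `λ₀`, its image `ρ₀`
under the groupoid inverse and `ω₀ = λ₀ ⊗ ρ₀`; sections are written as `f ω₀`. -/

variable [FiniteDimensional ℝ EB] (μ₀ : HalfDensity EB)

/-- `λ₀(g)(v) = μ₀(g⁻¹ v)` for `v` in `Λ^max T^l_g`, evaluated at the left translate by `g`. -/
def lam₀ (_g : G) (v : Frame EB) : ℝ := μ₀.toFun v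

/-- `ρ₀`, the image of `λ₀` under `s_A`, evaluated at the right translate of `w` by `g`. -/
def rho₀ (g : G) (w : Frame EB) : ℝ := lam₀ μ₀ (D.sA g) fun i => D.rightToLeft D.sA g (w i)

/-- `ω₀ = λ₀ ⊗ ρ₀`. -/
def omega₀ (g : G) (v w : Frame EB) : ℝ := lam₀ μ₀ g v * D.rho₀ μ₀ g w

/-- The function `f` with `ω = f ω₀`. -/
def coeff (ω : Sec EB G) (g : G) : ℂ :=
  ω g (stdFrame EB) (stdFrame EB) / (D.omega₀ μ₀ g (stdFrame EB) (stdFrame EB) : ℝ)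

/-- The section `f ω₀`. -/
def ofCoeff (f : G → ℂ) : Sec EB G := fun g v w => f g * (D.omega₀ μ₀ g v w : ℝ)

/-- The function `F` with `Ω = F (ω₀ ⊗ ω₀)`. -/
def coeff₂ (Ω : Sec₂ EB G) (p : G × G) : ℂ :=
  Ω p (stdFrame EB) (stdFrame EB) (stdFrame EB) (stdFrame EB) /
    ((D.omega₀ μ₀ p.1 (stdFrame EB) (stdFrame EB) *
      D.omega₀ μ₀ p.2 (stdFrame EB) (stdFrame EB) : ℝ) : ℂ)

/-- The section `F (ω₀ ⊗ ω₀)`. -/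
def ofCoeff₂ (F : G × G → ℂ) : Sec₂ EB G := fun p v₁ w₁ v₂ w₂ =>
  F p * ((D.omega₀ μ₀ p.1 v₁ w₁ * D.omega₀ μ₀ p.2 v₂ w₂ : ℝ) : ℂ)

/-- The map `t` of `tDelta` in the parameters described there. -/
def tDeltaMap (x y₁ y₂ : G) (β : B × B × B) : B × B × B :=
  let y₁' := D.iB β.2.1 * y₁
  let y₂' := D.iB β.2.2 * y₂
  let x' := D.iB β.1 * D.iB (D.bL x) * D.iA (D.aL y₁') * D.iA (D.aL y₂')
  let z := D.mDelta x y₁ y₂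
  let z' := D.mDelta x' y₁' y₂'
  ((D.bR x)⁻¹ * D.bR x', D.bR (z'.1 * z.1⁻¹), D.bR (z'.2 * z.2⁻¹))

/-- The function `t_δ` defined by `t_δ(x; y) i₂(λ₀(x) ⊗ ρ₀'(z)) = t i₁(ρ₀(x) ⊗ ρ₀'(y))`, where
`ρ₀' = ρ₀ ⊗ ρ₀`, `z = m_δ(x; y)` and `t` is the push-forward by the diffeomorphism
`t : (x; y) ↦ (x; m_δ(x; y))` from `{(x; y) : a_R(x) = a_L(y₁) a_L(y₂)}` to
`{(x; z) : a_L(x) = a_L(z₁) a_L(z₂)}`, both sets being restricted to one right fibre of `G_A × G_A`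
in the variables `y`, `z`. Here `i₁`, `i₂` are the isomorphisms `(ρ ⊗ ρ')(u ∧ v) = ρ(u) ρ'(π v)`
with `u` in the kernel of the projection `π` to the right fibre and `v` complementary.
The manifolds are parametrized by `B × B × B`, the first one by
`(β₁, β₂, β₃) ↦ (β₁ b_L(x) a_L(β₂ y₁) a_L(β₃ y₂); β₂ y₁, β₃ y₂)`, the second one by
`(γ₁, γ₂, γ₃) ↦ (a_L(γ₂ z₁) a_L(γ₃ z₂) b_R(x) γ₁; γ₂ z₁, γ₃ z₂)`, with `(e, e, e)` going to
`(x; y)` and to `(x; z)`: then `β₁`, `γ₁` parametrize the fibres of `π` through `(x; y)`, `(x; z)`,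
and the remaining variables parametrize the right fibre. -/
def tDelta (x y₁ y₂ : G) : ℝ :=
  let z := D.mDelta x y₁ y₂
  let J : (EB × EB × EB) →L[ℝ] (EB × EB × EB) :=
    mfderiv (𝓘(ℝ, EB).prod (𝓘(ℝ, EB).prod 𝓘(ℝ, EB))) (𝓘(ℝ, EB).prod (𝓘(ℝ, EB).prod 𝓘(ℝ, EB)))
      (D.tDeltaMap x y₁ y₂) (1, 1, 1)
  (D.rho₀ μ₀ x (stdFrame EB) * D.rho₀ μ₀ y₁ (stdFrame EB) * D.rho₀ μ₀ y₂ (stdFrame EB)) /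
    (Real.sqrt |J.det| *
      (lam₀ μ₀ x (stdFrame EB) * D.rho₀ μ₀ z.1 (stdFrame EB) * D.rho₀ μ₀ z.2 (stdFrame EB)))

section Integrals

variable [MeasurableSpace EB] [BorelSpace EB] [MeasurableSpace B]

/-- `∫_{F_l(a)} λ₀²(x) f(x)`; the left fibre `F_l(a)` is `a B`, and `b ↦ a b` identifies `λ₀²` with
the left-invariant density on `B` defined by `μ₀²`. -/
def leftFibreIntegral (a : A) (f : G → ℂ) : ℂ :=
  ∫ b : B, f (D.iA a * D.iB b) ∂(leftMeasure μ₀)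

/-- The product of `𝒜(G_A)`:
`(f₁ * f₂)(g) = ∫_{F_l(g)} λ₀²(y) f₁(y) f₂(s(y) g)`. -/
def mul (ω₁ ω₂ : Sec EB G) : Sec EB G := D.ofCoeff μ₀ fun g =>
  D.leftFibreIntegral μ₀ (D.aL g) fun y =>
    D.coeff μ₀ ω₁ y * D.coeff μ₀ ω₂ (D.mulA (D.sA y) g)

/-- The product of `𝒜(G_A × G_A)`. -/
def mul₂ (Ω₁ Ω₂ : Sec₂ EB G) : Sec₂ EB G := D.ofCoeff₂ μ₀ fun p =>
  ∫ b : B × B,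
    D.coeff₂ μ₀ Ω₁ (D.iA (D.aL p.1) * D.iB b.1, D.iA (D.aL p.2) * D.iB b.2) *
    D.coeff₂ μ₀ Ω₂ (D.mulA (D.sA (D.iA (D.aL p.1) * D.iB b.1)) p.1,
      D.mulA (D.sA (D.iA (D.aL p.2) * D.iB b.2)) p.2)
    ∂((leftMeasure μ₀).prod (leftMeasure μ₀))

/-- Left multiplication by `ω ⊗ I` on `𝒜(G_A × G_A)`, i.e. the product with `ω` in the first
variable. -/
def tensorOne (ω : Sec EB G) (Ω : Sec₂ EB G) : Sec₂ EB G := fun p v₁ w₁ v₂ w₂ =>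
  D.mul μ₀ ω (fun g v w => Ω (g, p.2) v w v₂ w₂) p.1 v₁ w₁

/-- Left multiplication by `I ⊗ ω` on `𝒜(G_A × G_A)`, i.e. the product with `ω` in the second
variable. -/
def oneTensor (ω : Sec EB G) (Ω : Sec₂ EB G) : Sec₂ EB G := fun p v₁ w₁ v₂ w₂ =>
  D.mul μ₀ ω (fun g v w => Ω (p.1, g) v₁ w₁ v w) p.2 v₂ w₂

/-- `δ̂(ω)`, as a map of `𝒜(G_A × G_A)`: for `ω = f ω₀` and `Ω = F (ω₀ ⊗ ω₀)`,
`(δ̂(ω) Ω)(z) = (∫_{F_l(a₁ a₂)} λ₀²(x) f(x) t_δ(x; y) F(y)) (ω₀ ⊗ ω₀)(z)`, where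
`a_i = a_L(z_i)` and `y = s(δ^L(x; a₁, a₂)) z`. -/
def comul (ω : Sec EB G) (Ω : Sec₂ EB G) : Sec₂ EB G := D.ofCoeff₂ μ₀ fun z =>
  D.leftFibreIntegral μ₀ (D.aL z.1 * D.aL z.2) fun x =>
    let u := D.deltaL x (D.aL z.1) (D.aL z.2)
    let y : G × G := (D.mulA (D.sA u.1) z.1, D.mulA (D.sA u.2) z.2)
    D.coeff μ₀ ω x * D.tDelta μ₀ x y.1 y.2 * D.coeff₂ μ₀ Ω y

/-- The multiplier `T` of `𝒜(G_A × G_A)` (a left multiplication operator) is the element `X` of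
`𝒜(G_A × G_A)`. -/
def IsElement (T : Sec₂ EB G → Sec₂ EB G) (X : Sec₂ EB G) : Prop :=
  IsBidensity₂ EG X ∧ ∀ Ω : Sec₂ EB G, IsBidensity₂ EG Ω → D.mul₂ μ₀ X Ω = T Ω


end Integrals

/-! ### The Haar functional and its modular group -/

/-- The right-invariant half-density `ρ̃₀(g)(w) = μ₀(w g⁻¹)`, evaluated at the right translate of
`w` by `g`. -/
def rhoTilde (_g : G) (w : Frame EB) : ℝ := μ₀.toFun w

/-- The left-invariant half-density `λ̃₀` corresponding to `ρ̃₀` (its image under `s_A`), evaluated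
at the left translate of `v` by `g`. -/
def lamTilde (g : G) (v : Frame EB) : ℝ :=
  rhoTilde μ₀ (D.sA g) fun i => D.leftToRight D.sA g (v i)

/-- The function `f` with `ω = f ω̃₀`, where `ω̃₀ = λ̃₀ ⊗ ρ̃₀`. -/
def coeffTilde (ω : Sec EB G) (g : G) : ℂ :=
  ω g (stdFrame EB) (stdFrame EB) /
    ((D.lamTilde μ₀ g (stdFrame EB) * rhoTilde μ₀ g (stdFrame EB) : ℝ) : ℂ)

variable [FiniteDimensional ℝ EA] (ν₀ : HalfDensity EA)

/-- The functional `h(f ω̃₀) = ∫_A ν_r² f`. -/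
def haar [MeasurableSpace EA] [BorelSpace EA] [MeasurableSpace A] (ω : Sec EB G) : ℂ :=
  ∫ a : A, D.coeffTilde μ₀ ω (D.iA a) ∂(rightMeasure ν₀)

/-- `h ⊗ id` from `𝒜(G_A × G_A)` to `𝒜(G_A)`: the functional `h` in the first variable. -/
def haarId [MeasurableSpace EA] [BorelSpace EA] [MeasurableSpace A] (Ω : Sec₂ EB G) : Sec EB G :=
  fun g v w => D.haar μ₀ ν₀ fun g' v' w' => Ω (g', g) v' w' v w

/-- The tuple `((T_e B) g, g T_e A)` in terms of the tuple `(g T_e B, g T_e A)` of `T_g G`: the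
tangent map at `(e, e)` of `(β, α) ↦ β g α`, where `T_g G` is identified with `T_e B ⊕ T_e A` by
means of `g · (α β)`. -/
def frameChange (g : G) : (EB × EA) →L[ℝ] (EB × EA) :=
  mfderiv (𝓘(ℝ, EB).prod 𝓘(ℝ, EA)) (𝓘(ℝ, EB).prod 𝓘(ℝ, EA))
    (fun p : B × A => (D.bR (g⁻¹ * (D.iB p.1 * g * D.iA p.2)),
      D.aL (g⁻¹ * (D.iB p.1 * g * D.iA p.2)))) (1, 1)

/-- The tangent map of `a_L` on `g T_e A`, with values in the right translate of `T_e A` by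
`a_L(g)`. -/
def daL (g : G) : EA →L[ℝ] EA := tangentAt (fun α : A => D.aL (g * D.iA α) * (D.aL g)⁻¹) 1

/-- The tangent map of `a_R` on `g T_e A`, with values in the right translate of `T_e A` by
`a_R(g)`. -/
def daR (g : G) : EA →L[ℝ] EA := tangentAt (fun α : A => D.aR (g * D.iA α) * (D.aR g)⁻¹) 1

/-- `(λ̃₀ ⊗ ν_r)(g)` on the basis `(g X, g Y)` of `T_g G`, with `X`, `Y` bases of `T_e B`, `T_e A`.
Here `g X` is tangent to the left fibre, and `a_L` maps `g Y` to a basis of `T_{a_L(g)} A`. -/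
def leftVal (g : G) : ℝ :=
  D.lamTilde μ₀ g (stdFrame EB) * ν₀.toFun fun i => D.daL g (stdFrame EA i)

/-- `(ρ̃₀ ⊗ ν_r)(g)` on the basis `(X g, g Y)` of `T_g G`. Here `X g` is tangent to the right fibre,
and `a_R` maps `g Y` to a basis of `T_{a_R(g)} A`. -/
def rightVal (g : G) : ℝ :=
  rhoTilde μ₀ g (stdFrame EB) * ν₀.toFun fun i => D.daR g (stdFrame EA i)

/-- The modular function, defined by `σ(g) (ρ̃₀ ⊗ ν_r)(g) = (λ̃₀ ⊗ ν_r)(g)` as half-densities on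
`T_g G`; both sides are evaluated on `(g X, g Y)`. -/
def modularFunction (g : G) : ℝ :=
  D.leftVal μ₀ ν₀ g / (D.rightVal μ₀ ν₀ g / Real.sqrt |(D.frameChange g).det|)

/-- `σ_z(ω) = |σ|^{2iz} ω`. -/
def sigma (z : ℂ) (ω : Sec EB G) : Sec EB G := fun g v w =>
  ((|D.modularFunction μ₀ ν₀ g| : ℝ) : ℂ) ^ (2 * Complex.I * z) * ω g v w

/-- `σ_z ⊗ τ_z` on `𝒜(G_A × G_A)`. -/
def sigmaTau (z : ℂ) (Ω : Sec₂ EB G) : Sec₂ EB G := fun p v₁ w₁ v₂ w₂ =>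
  ((|D.modularFunction μ₀ ν₀ p.1| : ℝ) : ℂ) ^ (2 * Complex.I * z) *
    (((|D.Q p.2| : ℝ) : ℂ) ^ (Complex.I * z) * Ω p v₁ w₁ v₂ w₂)

end DoubleLieGroup

end

/-! # Invariance of the Haar functional on the groupoid algebra of a double Lie group -/

/-! The factorization of elements of `G` makes `A` and `B` a matched pair: `a b = (act a b)(coact a
b)`. Once bidensities are replaced by their coefficients relative to `ω₀` and left fibres are
parametrized by `B`, every operator becomes an integral over `B` against left Haar measure. Its
integrand involves only these two actions and a few positive characters: `jacA` and `jacB`, the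
Jacobians at the identity of the actions of `A` on `B` and of `B` on `A`, and the moduli `|det Ad|`
of the groups.

The analytic input is the smoothness of the four projections. A vector tangent to both `A` and `B`
generates a curve in `A ∩ B`, so it vanishes; `A × B → G` is onto, so the dimensions add up; the
inverse function theorem at the identity and equivariance do the rest. Change of variables for
measures given by densities then yields the behaviour of Haar measure on `B` under translations and
under the action of `A` (`integral_act`).

The half-density computations reduce to Jacobians at fixed points. In particular `t_δ` is `|det
Ad|^(-1/2)` at a single element of `B` (`tDelta_eq`), and `|Q|` and `σ²` are quotients of the
characters (`abs_Q_eq`, `abs_Q_eq'`, `modularFunction_eq`).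

For the mixed products, substitutions in the double integral over `B × B` produce explicit
coefficients (`comulOneTensor`, `comulTensorOne`, `tensorOneComul`). They are compactly supported
because the underlying maps of `G × G` have continuous left inverses. An element is determined by
its left multiplication: testing the difference `e` of two candidates on its own adjoint gives the
integral of `|e|²` over the fibres (`isElement_unique`).

Applying `h ⊗ id` restricts the first variable to `A`. Both invariance identities then follow from
the substitution `a ↦ a a_L(g)` and the right invariance of `ν_r`. The last identity holds already
under the integral sign: `σ²` and `|Q|` are multiplicative on the groupoid (`modularSq_mulA`,
`abs_Q_mulA`), and the value of `σ²` on a product for `m_B` is `σ²` of the first factor times `|Q|`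
of the second (`modularSq_mul`). -/

noncomputable section InvarianceTheory

open scoped ContDiff Topology
open MeasureTheory Set

set_option linter.unusedSectionVars false

/-! ### Tangent maps and their smooth dependence on parameters. -/

section Calculus

variable {E F H : Type*} [NormedAddCommGroup E] [NormedSpace ℝ E]
  [NormedAddCommGroup F] [NormedSpace ℝ F] [NormedAddCommGroup H] [NormedSpace ℝ H]
  {M N P : Type*} [TopologicalSpace M] [ChartedSpace E M] [TopologicalSpace N] [ChartedSpace F N]
  [TopologicalSpace P] [ChartedSpace H P]

/-- The intermediate point is a separate variable, so that `g` can be differentiated at a normal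
form such as `1` when `f x` only simplifies to it. -/
theorem tangentAt_comp {f : M → N} {g : N → P} {x : M} {y : N} (h : f x = y)
    (hg : MDifferentiableAt 𝓘(ℝ, F) 𝓘(ℝ, H) g y) (hf : MDifferentiableAt 𝓘(ℝ, E) 𝓘(ℝ, F) f x) :
    (tangentAt (fun z => g (f z)) x : E →L[ℝ] H) =
      (tangentAt g y : F →L[ℝ] H).comp (tangentAt f x : E →L[ℝ] F) := by
  subst h
  exact mfderiv_comp (I' := 𝓘(ℝ, F)) x hg hf

theorem tangentAt_id (x : M) :
    (tangentAt (fun z : M => z) x : E →L[ℝ] E) = ContinuousLinearMap.id ℝ E :=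
  mfderiv_id

theorem tangentAt_const (x : M) (y : N) :
    (tangentAt (fun _ : M => y) x : E →L[ℝ] F) = 0 :=
  mfderiv_const

theorem tangentAt_congr {f g : M → N} {x : M} (h : f =ᶠ[𝓝 x] g) :
    (tangentAt f x : E →L[ℝ] F) = tangentAt g x :=
  h.mfderiv_eq

/-- Smooth dependence on a parameter of the tangent map at a fixed point with fixed value. -/
theorem contMDiff_tangentAt_param [IsManifold 𝓘(ℝ, H) ∞ P]
    [IsManifold 𝓘(ℝ, E) ∞ M] [IsManifold 𝓘(ℝ, F) ∞ N] (f : P → M → N) (x₀ : M) (y₀ : N)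
    (h : ∀ p, f p x₀ = y₀)
    (hf : ContMDiff (𝓘(ℝ, H).prod 𝓘(ℝ, E)) 𝓘(ℝ, F) ∞ fun q : P × M => f q.1 q.2) :
    ContMDiff 𝓘(ℝ, H) 𝓘(ℝ, E →L[ℝ] F) ∞ fun p => (tangentAt (f p) x₀ : E →L[ℝ] F) := by
  intro p₀
  have : IsManifold 𝓘(ℝ, H) 1 P := IsManifold.of_le (n := ∞) (by simp)
  have : IsManifold 𝓘(ℝ, E) 1 M := IsManifold.of_le (n := ∞) (by simp)
  have : IsManifold 𝓘(ℝ, F) 1 N := IsManifold.of_le (n := ∞) (by simp)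
  have key := ContMDiffAt.mfderiv (I := 𝓘(ℝ, E)) (I' := 𝓘(ℝ, F)) (J := 𝓘(ℝ, H)) (m := ∞) (n := ∞)
    (x₀ := p₀) f (fun _ => x₀) (hf _) contMDiffAt_const (by simp)
  -- The values `f p x₀` and `f p₀ x₀` are only propositionally equal. Since both are `y₀`, the
  -- coordinate change between their trivializations is trivial and the derivative in tangent
  -- coordinates is the plain one.
  have aux : ∀ y y' : N, y = y' → ∀ w : F,
      (tangentBundleCore 𝓘(ℝ, F) N).coordChange (achart F y) (achart F y') y w = w := by
    rintro y _ rfl w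
    exact (tangentBundleCore 𝓘(ℝ, F) N).coordChange_self _ _ (mem_chart_source F y) w
  have heq : inTangentCoordinates 𝓘(ℝ, E) 𝓘(ℝ, F) (fun _ : P => x₀) (fun x => f x x₀)
      (fun x => mfderiv 𝓘(ℝ, E) 𝓘(ℝ, F) (f x) x₀) p₀ =
      fun p => (tangentAt (f p) x₀ : E →L[ℝ] F) := by
    funext p
    refine (inTangentCoordinates_eq (I := 𝓘(ℝ, E)) (I' := 𝓘(ℝ, F)) (fun _ : P => x₀)
      (fun x => f x x₀) (fun x => (tangentAt (f x) x₀ : E →L[ℝ] F)) (x₀ := p₀) (x := p)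
      (mem_chart_source E x₀) (by rw [h p, h p₀]; exact mem_chart_source F y₀)).trans ?_
    refine ContinuousLinearMap.ext fun v => ?_
    refine (aux _ _ (by rw [h, h]) _).trans ?_
    exact congrArg (mfderiv 𝓘(ℝ, E) 𝓘(ℝ, F) (f p) x₀)
      ((tangentBundleCore 𝓘(ℝ, E) M).coordChange_self _ _ (mem_chart_source E x₀) v)
  exact heq ▸ key

end Calculus

/-! ### Determinants of block triangular maps; smoothness of the determinant. -/

section LinearAlgebra

variable {V W : Type*} [NormedAddCommGroup V] [NormedSpace ℝ V] [FiniteDimensional ℝ V]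
  [NormedAddCommGroup W] [NormedSpace ℝ W] [FiniteDimensional ℝ W]

theorem ContinuousLinearMap.det_comp' (S T : V →L[ℝ] V) : (S.comp T).det = S.det * T.det :=
  LinearMap.det_comp _ _

theorem ContinuousLinearMap.det_id' : (ContinuousLinearMap.id ℝ V).det = 1 :=
  LinearMap.det_id

/-- The determinant of a block triangular map. -/
theorem ContinuousLinearMap.det_block_lower (T : (V × W) →L[ℝ] (V × W)) (S : V →L[ℝ] V)
    (U : W →L[ℝ] W) (R : V →L[ℝ] W) (h : ∀ v w, T (v, w) = (S v, R v + U w)) :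
    T.det = S.det * U.det := by
  classical
  let b := Module.finBasis ℝ V
  let c := Module.finBasis ℝ W
  have hM : LinearMap.toMatrix (b.prod c) (b.prod c) (T : (V × W) →ₗ[ℝ] (V × W)) =
      Matrix.fromBlocks (LinearMap.toMatrix b b (S : V →ₗ[ℝ] V)) 0
        (LinearMap.toMatrix b c (R : V →ₗ[ℝ] W)) (LinearMap.toMatrix c c (U : W →ₗ[ℝ] W)) := by
    ext (i | i) (j | j) <;> simp [LinearMap.toMatrix_apply, h]
  show LinearMap.det _ = LinearMap.det _ * LinearMap.det _
  rw [← LinearMap.det_toMatrix (b.prod c), hM, Matrix.det_fromBlocks_zero₁₂,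
    LinearMap.det_toMatrix, LinearMap.det_toMatrix]

theorem ContinuousLinearMap.det_block_upper (T : (V × W) →L[ℝ] (V × W)) (S : V →L[ℝ] V)
    (U : W →L[ℝ] W) (R : W →L[ℝ] V) (h : ∀ v w, T (v, w) = (S v + R w, U w)) :
    T.det = S.det * U.det := by
  classical
  let b := Module.finBasis ℝ V
  let c := Module.finBasis ℝ W
  have hM : LinearMap.toMatrix (b.prod c) (b.prod c) (T : (V × W) →ₗ[ℝ] (V × W)) =
      Matrix.fromBlocks (LinearMap.toMatrix b b (S : V →ₗ[ℝ] V))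
        (LinearMap.toMatrix c b (R : W →ₗ[ℝ] V)) 0 (LinearMap.toMatrix c c (U : W →ₗ[ℝ] W)) := by
    ext (i | i) (j | j) <;> simp [LinearMap.toMatrix_apply, h]
  show LinearMap.det _ = LinearMap.det _ * LinearMap.det _
  rw [← LinearMap.det_toMatrix (b.prod c), hM, Matrix.det_fromBlocks_zero₂₁,
    LinearMap.det_toMatrix, LinearMap.det_toMatrix]

theorem ContinuousLinearMap.contDiff_det :
    ContDiff ℝ ∞ fun T : V →L[ℝ] V => T.det := by
  classical
  let b := Module.finBasis ℝ V
  -- The Leibniz formula exhibits the determinant as a polynomial in linear functionals of `T`.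
  have h : (fun T : V →L[ℝ] V => T.det) = fun T => ∑ σ : Equiv.Perm (Fin (Module.finrank ℝ V)),
      (Equiv.Perm.sign σ : ℝ) * ∏ i, b.repr (T (b i)) (σ i) := by
    funext T
    show LinearMap.det _ = _
    rw [← LinearMap.det_toMatrix b, Matrix.det_apply']
    simp [LinearMap.toMatrix_apply]
  rw [h]
  refine ContDiff.sum fun σ _ => contDiff_const.mul (contDiff_prod fun i _ => ?_)
  have : ContDiff ℝ ∞ (LinearMap.toContinuousLinearMap ((b.coord (σ i)))) :=
    ContinuousLinearMap.contDiff _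
  exact this.comp (contDiff_id.clm_apply contDiff_const)

end LinearAlgebra

/-! ### Half-densities evaluated on images of frames. -/

section HalfDensities

variable {V : Type*} [NormedAddCommGroup V] [NormedSpace ℝ V] [FiniteDimensional ℝ V]

theorem Frame.eq_stdFrame_mulMatrix (v : Frame V) :
    v = (stdFrame V).mulMatrix ((Module.finBasis ℝ V).toMatrix v) := by
  funext j
  simp [Frame.mulMatrix, stdFrame, Module.Basis.toMatrix_apply, Module.Basis.sum_repr]

theorem Frame.map_mulMatrix (T : V →L[ℝ] V) (v : Frame V)
    (A : Matrix (Fin (Module.finrank ℝ V)) (Fin (Module.finrank ℝ V)) ℝ) :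
    (fun i => T (v.mulMatrix A i)) = Frame.mulMatrix (fun i => T (v i)) A := by
  funext j
  simp [Frame.mulMatrix]

/-- Values of a function of frames that is homogeneous under matrices on images of frames. -/
theorem Frame.homogeneous_map {K : Type*} [CommRing K] (c : ℝ → K)
    (φ : Frame V → K)
    (hφ : ∀ (v : Frame V) (A : Matrix (Fin (Module.finrank ℝ V)) (Fin (Module.finrank ℝ V)) ℝ),
      φ (v.mulMatrix A) = c A.det * φ v)
    (T : V →L[ℝ] V) (v : Frame V) :
    φ (fun i => T (v i)) = c T.det * φ v := by
  -- Right multiplication by a matrix can express `T v` only for the standard frame. A general `v`,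
  -- possibly degenerate, is the standard frame times its coordinate matrix, and that scalar factor
  -- can be pulled out before and after applying `T`.
  have h1 : (fun i => T (stdFrame V i)) = (stdFrame V).mulMatrix
      (LinearMap.toMatrix (Module.finBasis ℝ V) (Module.finBasis ℝ V) (T : V →ₗ[ℝ] V)) := by
    funext j
    have := Module.Basis.sum_repr (Module.finBasis ℝ V) (T (Module.finBasis ℝ V j))
    simp only [Frame.mulMatrix, LinearMap.toMatrix_apply, stdFrame]
    exact this.symm
  have h2 : T.det = (LinearMap.toMatrix (Module.finBasis ℝ V) (Module.finBasis ℝ V)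
      (T : V →ₗ[ℝ] V)).det := (LinearMap.det_toMatrix _ _).symm
  have h3 : (fun i => T (v i)) = Frame.mulMatrix (fun i => T (stdFrame V i))
      ((Module.finBasis ℝ V).toMatrix v) := by
    rw [← Frame.map_mulMatrix, ← Frame.eq_stdFrame_mulMatrix]
  rw [h3, hφ, h1, hφ, ← h2]
  conv_rhs => rw [Frame.eq_stdFrame_mulMatrix v, hφ]
  ring

theorem HalfDensity.map_clm (μ : HalfDensity V) (T : V →L[ℝ] V) (v : Frame V) :
    μ.toFun (fun i => T (v i)) = Real.sqrt |T.det| * μ.toFun v :=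
  Frame.homogeneous_map (fun t => Real.sqrt |t|) μ.toFun μ.map_mulMatrix T v

theorem HalfDensity.stdFrame_ne_zero {μ : HalfDensity V} (h : ∃ v, μ.toFun v ≠ 0) :
    μ.toFun (stdFrame V) ≠ 0 := by
  obtain ⟨v, hv⟩ := h
  intro h0
  rw [Frame.eq_stdFrame_mulMatrix v, μ.map_mulMatrix, h0, mul_zero] at hv
  exact hv rfl

end HalfDensities

namespace DoubleLieGroup

/-! ### The matched pair of actions and the groupoid operations. -/

section Algebra

variable {EG EA EB : Type*}
  [NormedAddCommGroup EG] [NormedSpace ℝ EG]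
  [NormedAddCommGroup EA] [NormedSpace ℝ EA]
  [NormedAddCommGroup EB] [NormedSpace ℝ EB]
  {G A B : Type*} [TopologicalSpace G] [ChartedSpace EG G] [Group G]
  [TopologicalSpace A] [ChartedSpace EA A] [Group A]
  [TopologicalSpace B] [ChartedSpace EB B] [Group B]
  (D : DoubleLieGroup EG EA EB G A B)

/-- The quotient of two factorizations lies in `A ∩ B`. This uniqueness is what makes the
projections, defined by choice, computable. -/
theorem mul_inj {a a' : A} {b b' : B} (h : D.iA a * D.iB b = D.iA a' * D.iB b') :
    a = a' ∧ b = b' := by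
  have h1 : D.iA (a'⁻¹ * a) = D.iB (b' * b⁻¹) := by
    rw [map_mul, map_mul, map_inv, map_inv, eq_mul_inv_iff_mul_eq, mul_assoc, h]
    group
  have h2 := D.inter_eq _ _ h1
  have h3 : a'⁻¹ * a = 1 := D.closed_iA.injective (by rw [h2, map_one])
  have h4 : a = a' := by rw [inv_mul_eq_one] at h3; exact h3.symm
  subst h4
  exact ⟨rfl, D.closed_iB.injective (mul_left_cancel h)⟩

@[simp] theorem aL_iA_mul_iB (a : A) (b : B) : D.aL (D.iA a * D.iB b) = a :=
  (D.mul_inj (D.aL_mul_bR (D.iA a * D.iB b))).1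

@[simp] theorem bR_iA_mul_iB (a : A) (b : B) : D.bR (D.iA a * D.iB b) = b :=
  (D.mul_inj (D.aL_mul_bR (D.iA a * D.iB b))).2

@[simp] theorem aL_iA_mul (a : A) (g : G) : D.aL (D.iA a * g) = a * D.aL g := by
  conv_lhs => rw [← D.aL_mul_bR g, ← mul_assoc, ← map_mul]
  exact D.aL_iA_mul_iB _ _

@[simp] theorem bR_iA_mul (a : A) (g : G) : D.bR (D.iA a * g) = D.bR g := by
  conv_lhs => rw [← D.aL_mul_bR g, ← mul_assoc, ← map_mul]
  exact D.bR_iA_mul_iB _ _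

@[simp] theorem aL_mul_iB (g : G) (b : B) : D.aL (g * D.iB b) = D.aL g := by
  conv_lhs => rw [← D.aL_mul_bR g, mul_assoc, ← map_mul]
  exact D.aL_iA_mul_iB _ _

@[simp] theorem bR_mul_iB (g : G) (b : B) : D.bR (g * D.iB b) = D.bR g * b := by
  conv_lhs => rw [← D.aL_mul_bR g, mul_assoc, ← map_mul]
  exact D.bR_iA_mul_iB _ _

@[simp] theorem aL_one : D.aL 1 = 1 := by
  simpa using D.aL_iA_mul_iB 1 1

@[simp] theorem bR_one : D.bR 1 = 1 := by
  simpa using D.bR_iA_mul_iB 1 1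

@[simp] theorem aL_iA (a : A) : D.aL (D.iA a) = a := by
  simpa using D.aL_iA_mul_iB a 1

@[simp] theorem bR_iA (a : A) : D.bR (D.iA a) = 1 := by
  simpa using D.bR_iA_mul_iB a 1

@[simp] theorem aL_iB (b : B) : D.aL (D.iB b) = 1 := by
  simpa using D.aL_iA_mul_iB 1 b

@[simp] theorem bR_iB (b : B) : D.bR (D.iB b) = b := by
  simpa using D.bR_iA_mul_iB 1 b

@[simp] theorem aL_inv (g : G) : D.aL g⁻¹ = (D.aR g)⁻¹ := by simp [aR]

@[simp] theorem bR_inv (g : G) : D.bR g⁻¹ = (D.bL g)⁻¹ := by simp [bL]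

@[simp] theorem aR_inv (g : G) : D.aR g⁻¹ = (D.aL g)⁻¹ := by simp [aR]

@[simp] theorem bL_inv (g : G) : D.bL g⁻¹ = (D.bR g)⁻¹ := by simp [bL]

@[simp] theorem bL_iB_mul (b : B) (g : G) : D.bL (D.iB b * g) = b * D.bL g := by
  rw [bL, mul_inv_rev, ← map_inv, bR_mul_iB, bR_inv]
  group

@[simp] theorem aR_iB_mul (b : B) (g : G) : D.aR (D.iB b * g) = D.aR g := by
  rw [aR, mul_inv_rev, ← map_inv, aL_mul_iB, aL_inv]
  group

@[simp] theorem bL_mul_iA (g : G) (a : A) : D.bL (g * D.iA a) = D.bL g := by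
  rw [bL, mul_inv_rev, ← map_inv, bR_iA_mul, bR_inv]
  group

@[simp] theorem aR_mul_iA (g : G) (a : A) : D.aR (g * D.iA a) = D.aR g * a := by
  rw [aR, mul_inv_rev, ← map_inv, aL_iA_mul, aL_inv]
  group

@[simp] theorem bL_one : D.bL 1 = 1 := by simp [bL]

@[simp] theorem aR_one : D.aR 1 = 1 := by simp [aR]

@[simp] theorem bL_iA (a : A) : D.bL (D.iA a) = 1 := by
  simpa using D.bL_mul_iA 1 a

@[simp] theorem aR_iA (a : A) : D.aR (D.iA a) = a := by
  simpa using D.aR_mul_iA 1 a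

@[simp] theorem bL_iB (b : B) : D.bL (D.iB b) = b := by
  simpa using D.bL_iB_mul b 1

@[simp] theorem aR_iB (b : B) : D.aR (D.iB b) = 1 := by
  simpa using D.aR_iB_mul b 1

/-- The action of `A` on `B`: `a b = act a b · coact a b`. -/
def act (a : A) (b : B) : B := D.bL (D.iA a * D.iB b)

/-- The right action of `B` on `A`. -/
def coact (a : A) (b : B) : A := D.aR (D.iA a * D.iB b)

theorem act_mul_coact (a : A) (b : B) :
    D.iB (D.act a b) * D.iA (D.coact a b) = D.iA a * D.iB b :=
  D.bL_mul_aR _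

@[simp] theorem act_one_right (a : A) : D.act a 1 = 1 := by simp [act]

@[simp] theorem act_one_left (b : B) : D.act 1 b = b := by simp [act]

@[simp] theorem coact_one_left (b : B) : D.coact 1 b = 1 := by simp [coact]

/-- This and the next two are the matched pair relations, obtained by moving factors of `B` to the
left one at a time and reading off `b_L` or `a_R`. -/
theorem act_mul_left (a a' : A) (b : B) : D.act (a * a') b = D.act a (D.act a' b) := by
  have h : D.iA (a * a') * D.iB b = D.iA a * D.iB (D.act a' b) * D.iA (D.coact a' b) := by
    rw [map_mul, mul_assoc, ← D.act_mul_coact a' b, mul_assoc]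
  rw [act, h, bL_mul_iA]; rfl

theorem act_mul_right (a : A) (b b' : B) :
    D.act a (b * b') = D.act a b * D.act (D.coact a b) b' := by
  have h : D.iA a * D.iB (b * b') =
      D.iB (D.act a b) * (D.iA (D.coact a b) * D.iB b') := by
    rw [map_mul, ← mul_assoc, ← D.act_mul_coact a b, mul_assoc]
  rw [act, h, bL_iB_mul, act, act]

theorem coact_mul_left (a a' : A) (b : B) :
    D.coact (a * a') b = D.coact a (D.act a' b) * D.coact a' b := by
  have h : D.iA (a * a') * D.iB b = D.iA a * D.iB (D.act a' b) * D.iA (D.coact a' b) := by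
    rw [map_mul, mul_assoc, ← D.act_mul_coact a' b, mul_assoc]
  rw [coact, h, aR_mul_iA]; rfl

@[simp] theorem act_inv_act (a : A) (b : B) : D.act a⁻¹ (D.act a b) = b := by
  rw [← act_mul_left, inv_mul_cancel, act_one_left]

@[simp] theorem act_act_inv (a : A) (b : B) : D.act a (D.act a⁻¹ b) = b := by
  rw [← act_mul_left, mul_inv_cancel, act_one_left]

theorem sA_eq (g : G) : D.sA g = (D.iB (D.bL g))⁻¹ * D.iA (D.aL g) := by
  have h : D.iB (D.bL g) * D.iA (D.aR g) = D.iA (D.aL g) * D.iB (D.bR g) := by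
    rw [bL_mul_aR, aL_mul_bR]
  rw [sA, eq_inv_mul_iff_mul_eq, ← mul_assoc, h]
  group

/-- Groupoid multiplication by `x` is left translation by `b_L(x)`. This turns all convolutions into
integrals of translates. -/
theorem mulA_eq (x y : G) : D.mulA x y = D.iB (D.bL x) * y := by
  have h : x * (D.iA (D.aR x))⁻¹ = D.iB (D.bL x) := by
    rw [mul_inv_eq_iff_eq_mul, bL_mul_aR]
  rw [mulA, h]

@[simp] theorem bR_sA (g : G) : D.bR (D.sA g) = (D.bR g)⁻¹ := by
  rw [sA, ← map_inv, bR_iA_mul_iB]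

@[simp] theorem bL_sA (g : G) : D.bL (D.sA g) = (D.bL g)⁻¹ := by
  rw [sA_eq, ← map_inv, bL_iB_mul, bL_iA, mul_one]

@[simp] theorem aR_sA (g : G) : D.aR (D.sA g) = D.aL g := by
  rw [sA_eq, ← map_inv, aR_iB_mul, aR_iA]

@[simp] theorem sA_sA (g : G) : D.sA (D.sA g) = g := by
  conv_lhs => rw [sA]
  rw [aR_sA, bR_sA, map_inv, inv_inv, aL_mul_bR]

theorem mulA_sA (x y : G) : D.mulA (D.sA x) y = (D.iB (D.bL x))⁻¹ * y := by
  rw [mulA_eq, bL_sA, map_inv]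

end Algebra

end DoubleLieGroup

/-! ### Dimension of the image of a smooth map; smooth left inverses. -/

section Manifolds

variable {E F H : Type*} [NormedAddCommGroup E] [NormedSpace ℝ E] [FiniteDimensional ℝ E]
  [NormedAddCommGroup F] [NormedSpace ℝ F] [FiniteDimensional ℝ F] [TopologicalSpace H]
  {I : ModelWithCorners ℝ E H} [I.Boundaryless]
  {M N : Type*} [TopologicalSpace M] [ChartedSpace H M] [IsManifold I ∞ M]
  [TopologicalSpace N] [ChartedSpace F N] [IsManifold 𝓘(ℝ, F) ∞ N]

/-- A smooth map is locally Lipschitz, so it does not raise Hausdorff dimension. Countably many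
chart pieces of `M` cover a chart target of `N`, which is open and therefore has full dimension. -/
theorem finrank_le_of_contMDiff_surjective [SecondCountableTopology M] [Nonempty N] {f : M → N}
    (hf : ContMDiff I 𝓘(ℝ, F) ∞ f) (hs : Function.Surjective f) :
    Module.finrank ℝ F ≤ Module.finrank ℝ E := by
  obtain ⟨q⟩ := ‹Nonempty N›
  let S : M → Set E := fun p => {y | y ∈ (extChartAt I p).target ∧
    f ((extChartAt I p).symm y) ∈ (extChartAt 𝓘(ℝ, F) q).source}
  let g : M → E → F := fun p y => extChartAt 𝓘(ℝ, F) q (f ((extChartAt I p).symm y))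
  have hdim : ∀ p, dimH (g p '' S p) ≤ Module.finrank ℝ E := by
    intro p
    refine (dimH_image_le_of_locally_lipschitzOn ?_).trans
      ((dimH_mono (Set.subset_univ _)).trans (Real.dimH_univ_eq_finrank E).le)
    rintro y ⟨hy, hy'⟩
    have h1 : ContMDiffAt 𝓘(ℝ, E) I ∞ (extChartAt I p).symm y :=
      (contMDiffOn_extChartAt_symm p).contMDiffAt ((isOpen_extChartAt_target p).mem_nhds hy)
    have h2 : ContMDiffAt 𝓘(ℝ, F) 𝓘(ℝ, F) ∞ (extChartAt 𝓘(ℝ, F) q)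
        (f ((extChartAt I p).symm y)) :=
      contMDiffAt_extChartAt' (by simpa using hy')
    have h3 : ContMDiffAt 𝓘(ℝ, E) 𝓘(ℝ, F) ∞ (g p) y :=
      h2.comp y ((hf.contMDiffAt).comp y h1)
    obtain ⟨K, t, ht, hK⟩ :=
      ((contMDiffAt_iff_contDiffAt.1 h3).of_le (by simp)).exists_lipschitzOnWith
    exact ⟨K, t, mem_nhdsWithin_of_mem_nhds ht, hK⟩
  obtain ⟨s, hsc, hsU⟩ := TopologicalSpace.countable_cover_nhds
    (fun p : M => extChartAt_source_mem_nhds (I := I) p)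
  have hcov : (extChartAt 𝓘(ℝ, F) q).target ⊆ ⋃ p ∈ s, g p '' S p := by
    intro w hw
    obtain ⟨x, hx⟩ := hs ((extChartAt 𝓘(ℝ, F) q).symm w)
    obtain ⟨p, hp, hxp⟩ : ∃ p ∈ s, x ∈ (extChartAt I p).source := by
      have : x ∈ ⋃ p ∈ s, (extChartAt I p).source := by rw [hsU]; trivial
      simpa only [Set.mem_iUnion, exists_prop] using this
    simp only [Set.mem_iUnion, exists_prop]
    refine ⟨p, hp, extChartAt I p x, ⟨(extChartAt I p).map_source hxp, ?_⟩, ?_⟩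
    · rw [(extChartAt I p).left_inv hxp, hx]
      exact (extChartAt 𝓘(ℝ, F) q).map_target hw
    · show extChartAt 𝓘(ℝ, F) q (f ((extChartAt I p).symm (extChartAt I p x))) = w
      rw [(extChartAt I p).left_inv hxp, hx, (extChartAt 𝓘(ℝ, F) q).right_inv hw]
  have h1 : dimH (extChartAt 𝓘(ℝ, F) q).target = Module.finrank ℝ F :=
    Real.dimH_of_mem_nhds (extChartAt_target_mem_nhds q)
  have h2 : (Module.finrank ℝ F : ENNReal) ≤ Module.finrank ℝ E := by
    rw [← h1]
    refine (dimH_mono hcov).trans ?_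
    rw [dimH_bUnion hsc]
    exact iSup₂_le fun p _ => hdim p
  exact_mod_cast h2

/-- A left inverse of a smooth map is smooth at the image of every point where the tangent map is
bijective. -/
theorem contMDiffAt_leftInverse {f : M → N} {g : N → M} (hgf : ∀ x, g (f x) = x) {x : M}
    (hf : ContMDiffAt I 𝓘(ℝ, F) ∞ f x) (T : E ≃L[ℝ] F)
    (hT : ∀ v : E, mfderiv I 𝓘(ℝ, F) f x v = T v) : ContMDiffAt 𝓘(ℝ, F) I ∞ g (f x) := by
  set φ := extChartAt I x with hφ
  set ψ := extChartAt 𝓘(ℝ, F) (f x) with hψ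
  let w : E → F := fun y => ψ (f (φ.symm y))
  have h0 : φ.symm (φ x) = x := extChartAt_to_inv x
  have hw : ContDiffAt ℝ ∞ w (φ x) := by
    have h1 : ContMDiffAt 𝓘(ℝ, E) I ∞ φ.symm (φ x) :=
      (contMDiffOn_extChartAt_symm x).contMDiffAt (extChartAt_target_mem_nhds x)
    have h2 : ContMDiffAt 𝓘(ℝ, F) 𝓘(ℝ, F) ∞ ψ (f (φ.symm (φ x))) := by
      rw [h0]; exact contMDiffAt_extChartAt
    have h3 : ContMDiffAt I 𝓘(ℝ, F) ∞ f (φ.symm (φ x)) := by rw [h0]; exact hf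
    exact contMDiffAt_iff_contDiffAt.1 (ContMDiffAt.comp (f := fun y => f (φ.symm y)) (φ x) h2
      (ContMDiffAt.comp (f := φ.symm) (φ x) h3 h1))
  have hd : HasFDerivAt w (T : E →L[ℝ] F) (φ x) := by
    have h2 : (T : E →L[ℝ] F) = mfderiv I 𝓘(ℝ, F) f x :=
      ContinuousLinearMap.ext fun v => (hT v).symm
    have h1 : HasFDerivWithinAt w (T : E →L[ℝ] F) (Set.range I) (φ x) := by
      rw [h2]
      exact (hf.mdifferentiableAt (by simp)).hasMFDerivAt.2
    rwa [I.range_eq_univ, hasFDerivWithinAt_univ] at h1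
  have : CompleteSpace E := FiniteDimensional.complete ℝ E
  let σ := hw.localInverse hd (by simp)
  have hσ : ContDiffAt ℝ ∞ σ (w (φ x)) := hw.to_localInverse hd (by simp)
  have hσ0 : σ (w (φ x)) = φ x := hw.localInverse_apply_image hd (by simp)
  have hright : ∀ᶠ y in 𝓝 (w (φ x)), w (σ y) = y :=
    (hw.hasStrictFDerivAt' hd (by simp)).eventually_right_inverse
  have hwx : w (φ x) = ψ (f x) := by show ψ (f (φ.symm (φ x))) = _; rw [h0]
  rw [hwx] at hσ hright hσ0
  have hψc : ContinuousAt ψ (f x) := continuousAt_extChartAt (f x)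
  have hcand : ContMDiffAt 𝓘(ℝ, F) I ∞ (fun z => φ.symm (σ (ψ z))) (f x) := by
    have h1 : ContMDiffAt 𝓘(ℝ, E) I ∞ φ.symm (σ (ψ (f x))) := by
      rw [hσ0]
      exact (contMDiffOn_extChartAt_symm x).contMDiffAt (extChartAt_target_mem_nhds x)
    exact h1.comp (f x) ((contMDiffAt_iff_contDiffAt.2 hσ).comp (f x) contMDiffAt_extChartAt)
  -- Continuity of `g` is not assumed. The candidate built from the local inverse is a right inverse
  -- of `f` near `f x`, and applying `hgf` to its values shows that `g` coincides with it there.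
  refine hcand.congr_of_eventuallyEq ?_
  have hcont : ContinuousAt (fun z => f (φ.symm (σ (ψ z)))) (f x) := by
    have h2 : φ.symm (σ (ψ (f x))) = x := by rw [hσ0, h0]
    exact ContinuousAt.comp (g := f) (by rw [h2]; exact hf.continuousAt) hcand.continuousAt
  have hmem : ∀ᶠ z in 𝓝 (f x), f (φ.symm (σ (ψ z))) ∈ ψ.source := by
    refine hcont.eventually_mem ?_
    have h2 : f (φ.symm (σ (ψ (f x)))) = f x := by rw [hσ0, h0]
    rw [h2]
    exact extChartAt_source_mem_nhds (f x)
  filter_upwards [hmem, hψc.eventually hright, extChartAt_source_mem_nhds (I := 𝓘(ℝ, F)) (f x)]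
    with z h1 h2 h3
  have h4 : f (φ.symm (σ (ψ z))) = z := ψ.injOn h1 h3 h2
  rw [← hgf (φ.symm (σ (ψ z))), h4]

end Manifolds

namespace DoubleLieGroup

/-! ### Smoothness of the projections `a_L`, `b_R`, `a_R`, `b_L`. -/

section Smooth

variable {EG EA EB : Type*}
  [NormedAddCommGroup EG] [NormedSpace ℝ EG] [FiniteDimensional ℝ EG]
  [NormedAddCommGroup EA] [NormedSpace ℝ EA] [FiniteDimensional ℝ EA]
  [NormedAddCommGroup EB] [NormedSpace ℝ EB] [FiniteDimensional ℝ EB]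
  {G A B : Type*}
  [TopologicalSpace G] [ChartedSpace EG G] [Group G] [LieGroup 𝓘(ℝ, EG) ∞ G]
  [T2Space G] [SecondCountableTopology G]
  [TopologicalSpace A] [ChartedSpace EA A] [Group A] [LieGroup 𝓘(ℝ, EA) ∞ A]
  [TopologicalSpace B] [ChartedSpace EB B] [Group B] [LieGroup 𝓘(ℝ, EB) ∞ B]
  (D : DoubleLieGroup EG EA EB G A B)

theorem secondCountable_A (D : DoubleLieGroup EG EA EB G A B) : SecondCountableTopology A :=
  D.closed_iA.isEmbedding.secondCountableTopology

theorem secondCountable_B (D : DoubleLieGroup EG EA EB G A B) : SecondCountableTopology B :=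
  D.closed_iB.isEmbedding.secondCountableTopology

theorem t2Space_A (D : DoubleLieGroup EG EA EB G A B) : T2Space A := D.closed_iA.isEmbedding.t2Space

theorem t2Space_B (D : DoubleLieGroup EG EA EB G A B) : T2Space B := D.closed_iB.isEmbedding.t2Space

/-- A homomorphism intertwines left translations, so the left-invariant fields of `X` and of its
image under the tangent map of `i` are `i`-related. This is differentiated from `i (γ x) = i γ * i
x` in two ways. -/
theorem isMIntegralCurveAt_monoidHom {E' F' : Type*} [NormedAddCommGroup E'] [NormedSpace ℝ E']
    [NormedAddCommGroup F'] [NormedSpace ℝ F'] {M N : Type*}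
    [TopologicalSpace M] [ChartedSpace E' M] [Group M] [LieGroup 𝓘(ℝ, E') ∞ M]
    [TopologicalSpace N] [ChartedSpace F' N] [Group N] [LieGroup 𝓘(ℝ, F') ∞ N]
    (i : M →* N) (hi : ContMDiff 𝓘(ℝ, E') 𝓘(ℝ, F') ∞ i) (X : E') {γ : ℝ → M} {t₀ : ℝ}
    (hγ : IsMIntegralCurveAt (I := 𝓘(ℝ, E')) γ
      (fun m => mulInvariantVectorField (I := 𝓘(ℝ, E')) (G := M) X m) t₀) :
    IsMIntegralCurveAt (I := 𝓘(ℝ, F')) (fun t => i (γ t))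
      (fun n => mulInvariantVectorField (I := 𝓘(ℝ, F')) (G := N)
        ((tangentAt i (1 : M) : E' →L[ℝ] F') X) n) t₀ := by
  filter_upwards [hγ] with t ht
  have h1 := ((hi.mdifferentiable (by simp)) (γ t)).hasMFDerivAt.comp t ht
  refine h1.congr_mfderiv ?_
  refine ContinuousLinearMap.ext fun c : ℝ => ?_
  have h2 : (tangentAt (fun x : M => i (γ t * x)) (1 : M) : E' →L[ℝ] F') =
      (tangentAt i (γ t)).comp (tangentAt (fun x : M => γ t * x) (1 : M) : E' →L[ℝ] E') :=
    tangentAt_comp (mul_one _) (hi.mdifferentiable (by simp) _)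
      ((contMDiff_mul_left (n := ∞)).mdifferentiable (by simp) _)
  have h3 : (tangentAt (fun x : M => i (γ t) * i x) (1 : M) : E' →L[ℝ] F') =
      (tangentAt (fun y : N => i (γ t) * y) (1 : N) : F' →L[ℝ] F').comp (tangentAt i (1 : M)) :=
    tangentAt_comp (map_one i) ((contMDiff_mul_left (n := ∞)).mdifferentiable (by simp) _)
      (hi.mdifferentiable (by simp) _)
  have h4 := congrArg (fun T : E' →L[ℝ] F' => T X) (h3.symm.trans
    ((congrArg (fun f : M → N => (tangentAt f (1 : M) : E' →L[ℝ] F'))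
      (funext fun x => (map_mul i (γ t) x).symm)).trans h2))
  exact (map_smul (tangentAt i (γ t) : E' →L[ℝ] F') c _).trans
    (congrArg (fun w : F' => c • w) h4.symm)

/-- The integral curves of `X` in `A` and of `Y` in `B` have images in `G` that are integral curves
of the same field through the identity, so they agree near time `0`. They then lie in `A ∩ B`, so
the curve in `A` is constant and its velocity `X` is zero. -/
theorem jA_eq_jB {X : EA} {Y : EB} (h : D.jA X = D.jB Y) : X = 0 := by
  have : CompleteSpace EA := FiniteDimensional.complete ℝ EA
  have : CompleteSpace EB := FiniteDimensional.complete ℝ EB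
  have : CompleteSpace EG := FiniteDimensional.complete ℝ EG
  have := D.t2Space_A
  have hle : minSmoothness ℝ 3 ≤ ∞ := by
    rw [minSmoothness_of_isRCLikeNormedField]
    exact ENat.LEInfty.out
  have : LieGroup 𝓘(ℝ, EA) (minSmoothness ℝ 3) A := LieGroup.of_le hle
  have : LieGroup 𝓘(ℝ, EB) (minSmoothness ℝ 3) B := LieGroup.of_le hle
  have : LieGroup 𝓘(ℝ, EG) (minSmoothness ℝ 3) G := LieGroup.of_le hle
  obtain ⟨α, hα0, hα⟩ := exists_isMIntegralCurveAt_of_contMDiffAt_boundaryless (I := 𝓘(ℝ, EA)) 0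
    (((contMDiff_mulInvariantVectorField (I := 𝓘(ℝ, EA)) (G := A) X).of_le
      (by simp [Nat.one_le_ofNat])) (1 : A))
  obtain ⟨β, hβ0, hβ⟩ := exists_isMIntegralCurveAt_of_contMDiffAt_boundaryless (I := 𝓘(ℝ, EB)) 0
    (((contMDiff_mulInvariantVectorField (I := 𝓘(ℝ, EB)) (G := B) Y).of_le
      (by simp [Nat.one_le_ofNat])) (1 : B))
  have h1 := isMIntegralCurveAt_monoidHom D.iA D.smooth_iA X hα
  have h2 := isMIntegralCurveAt_monoidHom D.iB D.smooth_iB Y hβ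
  have h3 : (tangentAt D.iB (1 : B) : EB →L[ℝ] EG) Y = (tangentAt D.iA (1 : A) : EA →L[ℝ] EG) X :=
    h.symm
  rw [h3] at h2
  have heq := isMIntegralCurveAt_eventuallyEq_of_contMDiffAt_boundaryless (I := 𝓘(ℝ, EG))
    (((contMDiff_mulInvariantVectorField (I := 𝓘(ℝ, EG)) (G := G)
      ((tangentAt D.iA (1 : A) : EA →L[ℝ] EG) X)).of_le (by simp [Nat.one_le_ofNat])) _) h1 h2
      (by rw [hα0, hβ0, map_one, map_one])
  have hconst : α =ᶠ[𝓝 0] fun _ => 1 := by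
    filter_upwards [heq] with t ht
    exact D.closed_iA.injective ((D.inter_eq _ _ ht).trans (map_one D.iA).symm)
  have h4 : HasMFDerivAt 𝓘(ℝ, ℝ) 𝓘(ℝ, EA) α 0
      ((1 : ℝ →L[ℝ] ℝ).smulRight (mulInvariantVectorField (I := 𝓘(ℝ, EA)) (G := A) X (α 0))) :=
    hα.self_of_nhds
  have h5 : mfderiv 𝓘(ℝ, ℝ) 𝓘(ℝ, EA) α 0 = mfderiv 𝓘(ℝ, ℝ) 𝓘(ℝ, EA) (fun _ => (1 : A)) (0 : ℝ) :=
    hconst.mfderiv_eq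
  have h6 : ∀ y : A, y = 1 → (mulInvariantVectorField (I := 𝓘(ℝ, EA)) (G := A) X y : EA) = X := by
    rintro _ rfl
    have : (tangentAt (fun x : A => 1 * x) 1 : EA →L[ℝ] EA) = ContinuousLinearMap.id ℝ EA := by
      simp only [one_mul]
      exact tangentAt_id _
    exact congrArg (fun T : EA →L[ℝ] EA => T X) this
  have h7 := congrArg (fun T : ℝ →L[ℝ] EA => T 1) (h4.mfderiv.symm.trans h5)
  have h8 : (mfderiv 𝓘(ℝ, ℝ) 𝓘(ℝ, EA) (fun _ => (1 : A)) (0 : ℝ) : ℝ →L[ℝ] EA) = 0 := mfderiv_const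
  have h9 : (((1 : ℝ →L[ℝ] ℝ).smulRight
    (mulInvariantVectorField (I := 𝓘(ℝ, EA)) (G := A) X (α 0) : EA)) : ℝ →L[ℝ] EA) 1 = X := by
    rw [h6 _ hα0]; simp
  rw [← h9]
  refine h7.trans ?_
  exact congrArg (fun T : ℝ →L[ℝ] EA => T 1) h8

theorem contMDiff_mulMap : ContMDiff (𝓘(ℝ, EA).prod 𝓘(ℝ, EB)) 𝓘(ℝ, EG) ∞
    fun p : A × B => D.iA p.1 * D.iB p.2 :=
  (D.smooth_iA.comp contMDiff_fst).mul (D.smooth_iB.comp contMDiff_snd)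

theorem mfderiv_mulMap (X : EA) (Y : EB) :
    mfderiv (𝓘(ℝ, EA).prod 𝓘(ℝ, EB)) 𝓘(ℝ, EG) (fun p : A × B => D.iA p.1 * D.iB p.2) (1, 1) (X, Y)
      = D.jA X + D.jB Y := by
  refine (mfderiv_prod_eq_add_apply
    (D.contMDiff_mulMap.mdifferentiable (by simp) (1, 1))).trans ?_
  have h1 : (fun z : A => D.iA z * D.iB 1) = D.iA := by simp
  have h2 : (fun z : B => D.iA 1 * D.iB z) = D.iB := by simp
  dsimp only
  rw [h1, h2]
  rfl

theorem coprod_injective : Function.Injective (D.jA.coprod D.jB : (EA × EB) →ₗ[ℝ] EG) := by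
  rw [← LinearMap.ker_eq_bot, LinearMap.ker_eq_bot']
  rintro ⟨X, Y⟩ h
  have h' : D.jA X = D.jB (-Y) := by
    rw [map_neg, eq_neg_iff_add_eq_zero]
    exact h
  have hX := D.jA_eq_jB h'
  subst hX
  rw [map_zero] at h'
  have hY : D.jB (-Y) = D.jB 0 := by rw [← h', map_zero]
  have := D.immersion_iB 1 hY
  rw [neg_eq_zero] at this
  rw [this]
  rfl

/-- One inequality is the injectivity of `T_e A ⊕ T_e B → T_e G`, the other is the surjectivity of
`A × B → G`. -/
theorem finrank_eq (D : DoubleLieGroup EG EA EB G A B) :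
    Module.finrank ℝ (EA × EB) = Module.finrank ℝ EG := by
  have := D.secondCountable_A
  have := D.secondCountable_B
  refine le_antisymm ?_ ?_
  · exact LinearMap.finrank_le_finrank_of_injective D.coprod_injective
  · have : Nonempty G := ⟨1⟩
    exact finrank_le_of_contMDiff_surjective D.contMDiff_mulMap
      fun g => ⟨(D.aL g, D.bR g), D.aL_mul_bR g⟩

theorem contMDiffAt_factors_one :
    ContMDiffAt 𝓘(ℝ, EG) (𝓘(ℝ, EA).prod 𝓘(ℝ, EB)) ∞ (fun g => (D.aL g, D.bR g)) 1 := by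
  let T : (EA × EB) ≃L[ℝ] EG := (LinearMap.linearEquivOfInjective
    (D.jA.coprod D.jB : (EA × EB) →ₗ[ℝ] EG) D.coprod_injective D.finrank_eq).toContinuousLinearEquiv
  have h := contMDiffAt_leftInverse (I := 𝓘(ℝ, EA).prod 𝓘(ℝ, EB))
    (f := fun p : A × B => D.iA p.1 * D.iB p.2)
    (g := fun g => (D.aL g, D.bR g)) (x := (1, 1)) (fun x => by simp)
    D.contMDiff_mulMap.contMDiffAt T (fun v => D.mfderiv_mulMap v.1 v.2)
  simpa using h

/-- The inverse function theorem gives smoothness at the identity only. Equivariance under left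
translation by `A` and right translation by `B` carries it to every point, since each `g` is `a_L(g)
· 1 · b_R(g)`. -/
theorem contMDiff_aL : ContMDiff 𝓘(ℝ, EG) 𝓘(ℝ, EA) ∞ D.aL := by
  intro g
  have h0 : (D.iA (D.aL g))⁻¹ * g * (D.iB (D.bR g))⁻¹ = 1 := by
    conv_lhs => rw [← D.aL_mul_bR g]
    simp
  have h1 : ContMDiffAt 𝓘(ℝ, EG) 𝓘(ℝ, EG) ∞
      (fun x => (D.iA (D.aL g))⁻¹ * x * (D.iB (D.bR g))⁻¹) g :=
    (contMDiff_mul_right.comp contMDiff_mul_left).contMDiffAt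
  have h2 : ContMDiffAt 𝓘(ℝ, EG) 𝓘(ℝ, EA) ∞ D.aL ((D.iA (D.aL g))⁻¹ * g * (D.iB (D.bR g))⁻¹) := by
    rw [h0]
    exact contMDiffAt_fst.comp _ D.contMDiffAt_factors_one
  have h3 : D.aL = fun x => D.aL g * D.aL ((D.iA (D.aL g))⁻¹ * x * (D.iB (D.bR g))⁻¹) := by
    funext x
    rw [← map_inv, ← map_inv, aL_mul_iB, aL_iA_mul]
    group
  rw [h3]
  exact contMDiffAt_const.mul (ContMDiffAt.comp (g := D.aL)
    (f := fun x => (D.iA (D.aL g))⁻¹ * x * (D.iB (D.bR g))⁻¹) g h2 h1)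

theorem contMDiff_bR : ContMDiff 𝓘(ℝ, EG) 𝓘(ℝ, EB) ∞ D.bR := by
  intro g
  have h0 : (D.iA (D.aL g))⁻¹ * g * (D.iB (D.bR g))⁻¹ = 1 := by
    conv_lhs => rw [← D.aL_mul_bR g]
    simp
  have h1 : ContMDiffAt 𝓘(ℝ, EG) 𝓘(ℝ, EG) ∞
      (fun x => (D.iA (D.aL g))⁻¹ * x * (D.iB (D.bR g))⁻¹) g :=
    (contMDiff_mul_right.comp contMDiff_mul_left).contMDiffAt
  have h2 : ContMDiffAt 𝓘(ℝ, EG) 𝓘(ℝ, EB) ∞ D.bR ((D.iA (D.aL g))⁻¹ * g * (D.iB (D.bR g))⁻¹) := by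
    rw [h0]
    exact contMDiffAt_snd.comp _ D.contMDiffAt_factors_one
  have h3 : D.bR = fun x => D.bR ((D.iA (D.aL g))⁻¹ * x * (D.iB (D.bR g))⁻¹) * D.bR g := by
    funext x
    rw [← map_inv, ← map_inv, bR_mul_iB, bR_iA_mul]
    group
  rw [h3]
  exact (ContMDiffAt.comp (g := D.bR)
    (f := fun x => (D.iA (D.aL g))⁻¹ * x * (D.iB (D.bR g))⁻¹) g h2 h1).mul contMDiffAt_const

theorem contMDiff_aR : ContMDiff 𝓘(ℝ, EG) 𝓘(ℝ, EA) ∞ D.aR :=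
  (D.contMDiff_aL.comp (contMDiff_inv _ _)).inv

theorem contMDiff_bL : ContMDiff 𝓘(ℝ, EG) 𝓘(ℝ, EB) ∞ D.bL :=
  (D.contMDiff_bR.comp (contMDiff_inv _ _)).inv

end Smooth

end DoubleLieGroup

/-! ### Measures defined by positive densities and the change of variables formula. -/

section Densities

variable {E : Type*} [NormedAddCommGroup E] [NormedSpace ℝ E] [FiniteDimensional ℝ E]
  [MeasurableSpace E] [BorelSpace E]
  {M N : Type*} [TopologicalSpace M] [ChartedSpace E M] [MeasurableSpace M] [BorelSpace M]
  [TopologicalSpace N] [ChartedSpace E N] [MeasurableSpace N] [BorelSpace N]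

/-- The coefficient of a density in a chart. -/
def densityCoeff (ϱ : M → Frame E → ℝ) (p : M) (y : E) : ℝ :=
  ϱ ((chartAt E p).symm y) fun i => tangentAt (chartAt E p).symm y (stdFrame E i)

/-- Continuous positive densities. -/
structure IsDensity (ϱ : M → Frame E → ℝ) : Prop where
  map_mulMatrix : ∀ x (v : Frame E)
    (A : Matrix (Fin (Module.finrank ℝ E)) (Fin (Module.finrank ℝ E)) ℝ),
    ϱ x (v.mulMatrix A) = |A.det| * ϱ x v
  pos : ∀ p, ∀ y ∈ (chartAt E p).target, 0 < densityCoeff ϱ p y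
  cont : ∀ p, ContinuousOn (densityCoeff ϱ p) (chartAt E p).target

theorem measurableSet_chart_target (p : M) : MeasurableSet (chartAt E p).target :=
  (chartAt E p).open_target.measurableSet

theorem measurableSet_chart_preimage (p : M) {S : Set M} (hS : MeasurableSet S) :
    MeasurableSet ((chartAt E p).target ∩ (chartAt E p).symm ⁻¹' S) := by
  have h : Measurable ((chartAt E p).target.domRestrict (chartAt E p).symm) :=
    (continuousOn_iff_continuous_domRestrict.1 (chartAt E p).continuousOn_symm).measurable
  have h2 := (measurableSet_chart_target p).subtype_image (h hS)
  convert h2 using 1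
  ext y
  simp [Set.mem_image, Set.domRestrict, and_comm]

theorem aemeasurable_chart_symm (p : M) (μ : Measure E) :
    AEMeasurable (chartAt E p).symm (μ.restrict (chartAt E p).target) :=
  (chartAt E p).continuousOn_symm.aemeasurable (measurableSet_chart_target p)

theorem chartMeasure_apply (ϱ : M → Frame E → ℝ) (p : M) {S : Set M} (hS : MeasurableSet S) :
    chartMeasure ϱ p S = ∫⁻ y in (chartAt E p).target ∩ (chartAt E p).symm ⁻¹' S,
      ENNReal.ofReal (densityCoeff ϱ p y) ∂(Module.finBasis ℝ E).addHaar := by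
  have h1 : AEMeasurable (chartAt E p).symm
      ((((Module.finBasis ℝ E).addHaar.restrict (chartAt E p).target).withDensity fun y =>
        ENNReal.ofReal (densityCoeff ϱ p y))) :=
    (aemeasurable_chart_symm p _).mono_ac (withDensity_absolutelyContinuous _ _)
  have h2 : chartMeasure ϱ p S = ((((Module.finBasis ℝ E).addHaar.restrict
      (chartAt E p).target).withDensity fun y =>
        ENNReal.ofReal (densityCoeff ϱ p y))) ((chartAt E p).symm ⁻¹' S) :=
    Measure.map_apply_of_aemeasurable h1 hS
  rw [h2, ← restrict_withDensity (measurableSet_chart_target p),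
    Measure.restrict_apply' (measurableSet_chart_target p), inter_comm,
    withDensity_apply _ (measurableSet_chart_preimage p hS)]

theorem chartMeasure_apply_inter_source (ϱ : M → Frame E → ℝ) (p : M) {S : Set M}
    (hS : MeasurableSet S) :
    chartMeasure ϱ p (S ∩ (chartAt E p).source) = chartMeasure ϱ p S := by
  rw [chartMeasure_apply ϱ p hS,
    chartMeasure_apply ϱ p (hS.inter (chartAt E p).open_source.measurableSet)]
  congr 2
  ext y
  constructor
  · rintro ⟨h1, h2, -⟩
    exact ⟨h1, h2⟩
  · rintro ⟨h1, h2⟩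
    exact ⟨h1, h2, (chartAt E p).map_target h1⟩

variable [IsManifold 𝓘(ℝ, E) ∞ M] [IsManifold 𝓘(ℝ, E) ∞ N]

theorem mdifferentiableAt_chart_symm (p : M) {y : E} (hy : y ∈ (chartAt E p).target) :
    MDifferentiableAt 𝓘(ℝ, E) 𝓘(ℝ, E) (chartAt E p).symm y :=
  ((contMDiffOn_chart_symm (n := ∞)).contMDiffAt
    ((chartAt E p).open_target.mem_nhds hy)).mdifferentiableAt (by simp)

theorem mdifferentiableAt_chart (p : M) {x : M} (hx : x ∈ (chartAt E p).source) :
    MDifferentiableAt 𝓘(ℝ, E) 𝓘(ℝ, E) (chartAt E p) x :=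
  ((contMDiffOn_chart (n := ∞)).contMDiffAt
    ((chartAt E p).open_source.mem_nhds hx)).mdifferentiableAt (by simp)

/-- Change of variables between charts. -/
theorem chartMeasure_image {ϱM : M → Frame E → ℝ} {ϱN : N → Frame E → ℝ} (hϱN : IsDensity ϱN)
    {f : M → N} (hf : MDifferentiable 𝓘(ℝ, E) 𝓘(ℝ, E) f) (p : M) (q : N) {S : Set M}
    (hinj : InjOn f S)
    (hS : MeasurableSet S) (hfS : MeasurableSet (f '' S)) (hSp : S ⊆ (chartAt E p).source)
    (hfSq : f '' S ⊆ (chartAt E q).source)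
    (hϱ : ∀ x v, ϱN (f x) (fun i => tangentAt f x (v i)) = ϱM x v) :
    chartMeasure ϱN q (f '' S) = chartMeasure ϱM p S := by
  set φ := chartAt E p
  set χ := chartAt E q
  let ψ : E → E := fun y => χ (f (φ.symm y))
  set T := φ.target ∩ φ.symm ⁻¹' S with hT
  have hTm : MeasurableSet T := measurableSet_chart_preimage p hS
  have himg : χ.target ∩ χ.symm ⁻¹' (f '' S) = ψ '' T := by
    ext z
    constructor
    · rintro ⟨hz, x, hx, hxz⟩
      refine ⟨φ x, ⟨φ.map_source (hSp hx), ?_⟩, ?_⟩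
      · show φ.symm (φ x) ∈ S
        rwa [φ.left_inv (hSp hx)]
      · show χ (f (φ.symm (φ x))) = z
        rw [φ.left_inv (hSp hx), hxz, χ.right_inv hz]
    · rintro ⟨y, ⟨hy, hyS⟩, rfl⟩
      have h1 : f (φ.symm y) ∈ χ.source := hfSq ⟨_, hyS, rfl⟩
      refine ⟨χ.map_source h1, ?_⟩
      show χ.symm (χ (f (φ.symm y))) ∈ f '' S
      rw [χ.left_inv h1]
      exact ⟨_, hyS, rfl⟩
  have hψ : ∀ y ∈ T, MDifferentiableAt 𝓘(ℝ, E) 𝓘(ℝ, E) ψ y := fun y hy =>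
    (mdifferentiableAt_chart q (hfSq ⟨_, hy.2, rfl⟩)).comp y
      ((hf _).comp y (mdifferentiableAt_chart_symm p hy.1))
  have hψd : ∀ y ∈ T, HasFDerivWithinAt ψ (tangentAt ψ y : E →L[ℝ] E) T y := fun y hy => by
    have := (hψ y hy).differentiableAt.hasFDerivAt.hasFDerivWithinAt (s := T)
    rwa [← mfderiv_eq_fderiv] at this
  have hψinj : InjOn ψ T := by
    intro y hy y' hy' h
    have h1 : f (φ.symm y) = f (φ.symm y') :=
      χ.injOn (hfSq ⟨_, hy.2, rfl⟩) (hfSq ⟨_, hy'.2, rfl⟩) h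
    exact φ.symm.injOn hy.1 hy'.1 (hinj hy.2 hy'.2 h1)
  rw [chartMeasure_apply ϱN q hfS, chartMeasure_apply ϱM p hS]
  show ∫⁻ y in χ.target ∩ χ.symm ⁻¹' (f '' S), _ ∂_ = ∫⁻ y in T, _ ∂_
  rw [himg, lintegral_image_eq_lintegral_abs_det_fderiv_mul _ hTm hψd hψinj]
  refine setLIntegral_congr_fun hTm fun y hy => ?_
  have h1 : f (φ.symm y) ∈ χ.source := hfSq ⟨_, hy.2, rfl⟩
  have h2 : χ.symm (ψ y) = f (φ.symm y) := χ.left_inv h1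
  have h3 : ψ y ∈ χ.target := χ.map_source h1
  have hev : (fun z => χ.symm (ψ z)) =ᶠ[𝓝 y] fun z => f (φ.symm z) := by
    have hc : ContinuousAt (fun z => f (φ.symm z)) y :=
      ((hf _).comp y (mdifferentiableAt_chart_symm p hy.1)).continuousAt
    filter_upwards [hc.eventually_mem (χ.open_source.mem_nhds h1)] with z hz
    exact χ.left_inv hz
  have h4 : (tangentAt (fun z => χ.symm (ψ z)) y : E →L[ℝ] E) =
      (tangentAt χ.symm (ψ y) : E →L[ℝ] E).comp (tangentAt ψ y : E →L[ℝ] E) :=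
    tangentAt_comp rfl (mdifferentiableAt_chart_symm q h3) (hψ y hy)
  have h5 : (tangentAt (fun z => f (φ.symm z)) y : E →L[ℝ] E) =
      (tangentAt f (φ.symm y) : E →L[ℝ] E).comp (tangentAt φ.symm y : E →L[ℝ] E) :=
    tangentAt_comp rfl (hf _) (mdifferentiableAt_chart_symm p hy.1)
  have h6 := (tangentAt_congr (E := E) (F := E) hev)
  -- The chain rule for `f ∘ φ.symm = χ.symm ∘ ψ` moves the frame of the first chart to the image of
  -- the standard frame under the tangent map of `ψ`. Homogeneity of the density then supplies
  -- exactly the Jacobian of the change of variables.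
  have h7 : densityCoeff ϱM p y = |(tangentAt ψ y : E →L[ℝ] E).det| * densityCoeff ϱN q (ψ y) := by
    have := Frame.homogeneous_map (fun t => |t|)
      (fun v : Frame E => ϱN (χ.symm (ψ y)) fun i => tangentAt χ.symm (ψ y) (v i))
      (fun v A => by
        rw [Frame.map_mulMatrix, hϱN.map_mulMatrix]) (tangentAt ψ y : E →L[ℝ] E) (stdFrame E)
    refine Eq.trans ?_ this
    show ϱM (φ.symm y) _ = _
    rw [← hϱ, h2]
    congr 1
    funext i
    exact congrArg (fun L : E →L[ℝ] E => L (stdFrame E i)) (h5.symm.trans (h6.symm.trans h4))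
  rw [h7, ENNReal.ofReal_mul (abs_nonneg _)]

theorem chartMeasure_eq_of_subset {ϱ : M → Frame E → ℝ} (hϱ : IsDensity ϱ) (p q : M) {S : Set M}
    (hS : MeasurableSet S) (hp : S ⊆ (chartAt E p).source) (hq : S ⊆ (chartAt E q).source) :
    chartMeasure ϱ p S = chartMeasure ϱ q S := by
  have := chartMeasure_image (ϱM := ϱ) hϱ (f := fun x => x) mdifferentiable_id p q
    (Function.injective_id.injOn) hS (by simpa using hS) hp (by simpa using hq)
    (fun x v => by rw [tangentAt_id]; rfl)
  simpa using this.symm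

/-- A supremum of measures need not be the supremum of the values on a set, so the upper bound is
proved at the level of measures. Since chart measures agree on overlaps, each one is dominated by
`chartMeasure ϱ p` plus the part of `densityMeasure ϱ` living outside the chart at `p`, and that
part does not see `S`. -/
theorem densityMeasure_apply {ϱ : M → Frame E → ℝ} (hϱ : IsDensity ϱ) (p : M) {S : Set M}
    (hS : MeasurableSet S) (hp : S ⊆ (chartAt E p).source) :
    densityMeasure ϱ S = chartMeasure ϱ p S := by
  have hsrc : ∀ q : M, MeasurableSet (chartAt E q).source := fun q =>
    (chartAt E q).open_source.measurableSet
  refine le_antisymm ?_ ((le_iSup (fun q => chartMeasure ϱ q) p) S)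
  have hle : densityMeasure ϱ ≤ chartMeasure ϱ p +
      (densityMeasure ϱ).restrict (chartAt E p).sourceᶜ := by
    refine iSup_le fun q => Measure.le_iff.2 fun U hU => ?_
    rw [← measure_inter_add_sdiff U (hsrc p), Measure.add_apply,
      Measure.restrict_apply hU]
    refine add_le_add ?_ ((le_iSup (fun q => chartMeasure ϱ q) q) _)
    rw [← chartMeasure_apply_inter_source ϱ q (hU.inter (hsrc p)),
      ← chartMeasure_eq_of_subset hϱ p q ((hU.inter (hsrc p)).inter (hsrc q))
        (fun x hx => hx.1.2) (fun x hx => hx.2)]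
    exact measure_mono fun x hx => hx.1.1
  refine (hle S).trans ?_
  rw [Measure.add_apply, Measure.restrict_apply hS]
  have : S ∩ (chartAt E p).sourceᶜ = ∅ := by
    ext x
    simp only [mem_inter_iff, mem_compl_iff, mem_empty_iff_false, iff_false, not_and, not_not]
    exact fun hx => hp hx
  rw [this, measure_empty, add_zero]

theorem exists_countable_charts [SecondCountableTopology M] :
    ∃ s : Set M, s.Countable ∧ ⋃ p ∈ s, (chartAt E p).source = univ :=
  TopologicalSpace.countable_cover_nhds fun p => chart_source_mem_nhds E p

/-- Change of variables for the measures defined by densities. -/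
theorem map_densityMeasure [SecondCountableTopology M] [SecondCountableTopology N]
    {ϱM : M → Frame E → ℝ} {ϱN : N → Frame E → ℝ} (hϱM : IsDensity ϱM) (hϱN : IsDensity ϱN)
    (f : M ≃ₜ N) (hf : MDifferentiable 𝓘(ℝ, E) 𝓘(ℝ, E) f)
    (hϱ : ∀ x v, ϱN (f x) (fun i => tangentAt f x (v i)) = ϱM x v) :
    (densityMeasure ϱM).map f = densityMeasure ϱN := by
  obtain ⟨s, hs, hsU⟩ := exists_countable_charts (E := E) (M := M)
  obtain ⟨t, ht, htU⟩ := exists_countable_charts (E := E) (M := N)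
  have := hs.to_subtype
  have := ht.to_subtype
  -- On each of these countably many pieces a single chart of `M` and a single chart of `N` suffice.
  let W : s × t → Set N := fun k => f.symm ⁻¹' (chartAt E (k.1 : M)).source ∩
    (chartAt E (k.2 : N)).source
  have hWU : ⋃ k, W k = univ := by
    refine eq_univ_of_forall fun z => ?_
    have h1 : f.symm z ∈ ⋃ p ∈ s, (chartAt E p).source := by rw [hsU]; trivial
    have h2 : z ∈ ⋃ p ∈ t, (chartAt E p).source := by rw [htU]; trivial
    simp only [mem_iUnion, exists_prop] at h1 h2 ⊢
    obtain ⟨p, hp, hp'⟩ := h1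
    obtain ⟨q, hq, hq'⟩ := h2
    exact ⟨(⟨p, hp⟩, ⟨q, hq⟩), hp', hq'⟩
  rw [Measure.ext_iff_of_iUnion_eq_univ hWU]
  rintro ⟨⟨p, hp⟩, ⟨q, hq⟩⟩
  have hWm : MeasurableSet (W (⟨p, hp⟩, ⟨q, hq⟩)) :=
    (((chartAt E p).open_source.preimage f.symm.continuous).inter
      (chartAt E q).open_source).measurableSet
  ext U hU
  rw [Measure.restrict_apply hU, Measure.restrict_apply hU,
    Measure.map_apply f.continuous.measurable (hU.inter hWm)]
  set V := U ∩ W (⟨p, hp⟩, ⟨q, hq⟩) with hV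
  have hVm : MeasurableSet V := hU.inter hWm
  have h1 : f '' (f ⁻¹' V) = V := f.surjective.image_preimage V
  have h2 : f ⁻¹' V ⊆ (chartAt E p).source := fun x hx => by
    have := hx.2.1
    simpa using this
  have h3 : V ⊆ (chartAt E q).source := fun x hx => hx.2.2
  rw [densityMeasure_apply hϱM p (f.continuous.measurable hVm) h2,
    densityMeasure_apply hϱN q hVm h3,
    ← chartMeasure_image (ϱM := ϱM) hϱN hf p q f.injective.injOn (f.continuous.measurable hVm)
      (by rwa [h1]) h2 (by rwa [h1]) hϱ, h1]

theorem aemeasurable_densityCoeff {ϱ : M → Frame E → ℝ} (hϱ : IsDensity ϱ) (p : M) (μ : Measure E) :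
    AEMeasurable (fun y => ENNReal.ofReal (densityCoeff ϱ p y))
      (μ.restrict (chartAt E p).target) :=
  ((hϱ.cont p).aemeasurable (measurableSet_chart_target p)).ennreal_ofReal

theorem setLIntegral_chartMeasure {ϱ : M → Frame E → ℝ} (hϱ : IsDensity ϱ) (p : M)
    {g : M → ENNReal} (hg : Measurable g) {S : Set M} (hS : MeasurableSet S) :
    ∫⁻ x in S, g x ∂(chartMeasure ϱ p) =
      ∫⁻ y in (chartAt E p).target ∩ (chartAt E p).symm ⁻¹' S,
        ENNReal.ofReal (densityCoeff ϱ p y) * g ((chartAt E p).symm y)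
          ∂(Module.finBasis ℝ E).addHaar := by
  have h1 : AEMeasurable (chartAt E p).symm
      ((((Module.finBasis ℝ E).addHaar.restrict (chartAt E p).target).withDensity fun y =>
        ENNReal.ofReal (densityCoeff ϱ p y))) :=
    (aemeasurable_chart_symm p _).mono_ac (withDensity_absolutelyContinuous _ _)
  have h2 : chartMeasure ϱ p = ((((Module.finBasis ℝ E).addHaar.restrict
      (chartAt E p).target).withDensity fun y =>
        ENNReal.ofReal (densityCoeff ϱ p y))).map (chartAt E p).symm := rfl
  have h3 : Measurable (S.indicator g) := hg.indicator hS
  rw [← lintegral_indicator hS, h2, lintegral_map' h3.aemeasurable h1,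
    lintegral_withDensity_eq_lintegral_mul₀ (aemeasurable_densityCoeff hϱ p _)
      (g := fun y => S.indicator g ((chartAt E p).symm y))
      (h3.comp_aemeasurable (aemeasurable_chart_symm p _)),
    ← lintegral_indicator (measurableSet_chart_preimage p hS),
    ← lintegral_indicator (measurableSet_chart_target p)]
  refine lintegral_congr fun y => ?_
  by_cases hy : y ∈ (chartAt E p).target <;> by_cases hy' : (chartAt E p).symm y ∈ S <;>
    simp [hy, hy', Set.indicator]

theorem IsDensity.mul {ϱ : M → Frame E → ℝ} (hϱ : IsDensity ϱ)
    {h : M → ℝ} (hh : Continuous h) (hpos : ∀ x, 0 < h x) :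
    IsDensity fun x v => h x * ϱ x v where
  map_mulMatrix x v A := by rw [hϱ.map_mulMatrix]; ring
  pos p y hy := mul_pos (hpos _) (hϱ.pos p y hy)
  cont p := (hh.comp_continuousOn (chartAt E p).continuousOn_symm).mul (hϱ.cont p)

/-- Multiplying a density by a function. -/
theorem densityMeasure_mul [SecondCountableTopology M] {ϱ : M → Frame E → ℝ} (hϱ : IsDensity ϱ)
    {h : M → ℝ} (hh : Continuous h) (hpos : ∀ x, 0 < h x) :
    densityMeasure (fun x v => h x * ϱ x v) =
      (densityMeasure ϱ).withDensity fun x => ENNReal.ofReal (h x) := by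
  obtain ⟨s, hs, hsU⟩ := exists_countable_charts (E := E) (M := M)
  have := hs.to_subtype
  rw [Measure.ext_iff_of_iUnion_eq_univ (s := fun p : s => (chartAt E (p : M)).source)
    (by rw [← hsU, biUnion_eq_iUnion])]
  rintro ⟨p, hp⟩
  have hsrc : MeasurableSet (chartAt E p).source := (chartAt E p).open_source.measurableSet
  ext U hU
  have hV := hU.inter hsrc
  have hres : (densityMeasure ϱ).restrict (U ∩ (chartAt E p).source) =
      (chartMeasure ϱ p).restrict (U ∩ (chartAt E p).source) := by
    ext W hW
    rw [Measure.restrict_apply hW, Measure.restrict_apply hW,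
      densityMeasure_apply hϱ p (hW.inter hV) fun x hx => hx.2.2]
  rw [Measure.restrict_apply hU, Measure.restrict_apply hU, withDensity_apply _ hV, hres,
    densityMeasure_apply (hϱ.mul hh hpos) p hV inter_subset_right, chartMeasure_apply _ p hV,
    setLIntegral_chartMeasure hϱ p (by fun_prop) hV]
  refine lintegral_congr fun y => ?_
  rw [mul_comm, ← ENNReal.ofReal_mul (hpos _).le]
  rfl

theorem isLocallyFiniteMeasure_densityMeasure {ϱ : M → Frame E → ℝ} (hϱ : IsDensity ϱ) :
    IsLocallyFiniteMeasure (densityMeasure ϱ) := by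
  refine ⟨fun p => ?_⟩
  have h0 : (chartAt E p).target ∈ 𝓝 (chartAt E p p) := chart_target_mem_nhds E p
  obtain ⟨K, ⟨hK, hKc⟩, hKt⟩ := (compact_basis_nhds (chartAt E p p)).mem_iff.1 h0
  let S := (chartAt E p).source ∩ chartAt E p ⁻¹' interior K
  have hSo : IsOpen S := (chartAt E p).isOpen_inter_preimage isOpen_interior
  have hpS : p ∈ S := ⟨mem_chart_source E p, mem_interior_iff_mem_nhds.2 hK⟩
  refine ⟨S, hSo.mem_nhds hpS, ?_⟩
  rw [densityMeasure_apply hϱ p hSo.measurableSet inter_subset_left,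
    chartMeasure_apply ϱ p hSo.measurableSet]
  have hsub : (chartAt E p).target ∩ (chartAt E p).symm ⁻¹' S ⊆ K := by
    rintro y ⟨hy, hyS⟩
    have := hyS.2
    rw [mem_preimage, (chartAt E p).right_inv hy] at this
    exact interior_subset this
  refine (lintegral_mono_set hsub).trans_lt ?_
  have hint : IntegrableOn (densityCoeff ϱ p) K (Module.finBasis ℝ E).addHaar :=
    ((hϱ.cont p).mono hKt).integrableOn_compact hKc
  exact hint.lintegral_lt_top

theorem isOpenPosMeasure_densityMeasure {ϱ : M → Frame E → ℝ} (hϱ : IsDensity ϱ) :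
    (densityMeasure ϱ).IsOpenPosMeasure := by
  refine ⟨fun U hU hne h0 => ?_⟩
  obtain ⟨p, hp⟩ := hne
  have hV : IsOpen (U ∩ (chartAt E p).source) := hU.inter (chartAt E p).open_source
  have h1 : densityMeasure ϱ (U ∩ (chartAt E p).source) = 0 :=
    measure_mono_null inter_subset_left h0
  rw [densityMeasure_apply hϱ p hV.measurableSet inter_subset_right,
    chartMeasure_apply ϱ p hV.measurableSet] at h1
  have hm := measurableSet_chart_preimage (E := E) p hV.measurableSet
  have hW : IsOpen ((chartAt E p).target ∩ (chartAt E p).symm ⁻¹' (U ∩ (chartAt E p).source)) :=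
    (chartAt E p).isOpen_inter_preimage_symm hV
  have hWne : ((chartAt E p).target ∩
      (chartAt E p).symm ⁻¹' (U ∩ (chartAt E p).source)).Nonempty := by
    refine ⟨chartAt E p p, mem_chart_target E p, ?_⟩
    rw [mem_preimage, (chartAt E p).left_inv (mem_chart_source E p)]
    exact ⟨hp, mem_chart_source E p⟩
  rw [setLIntegral_eq_zero_iff' hm ((aemeasurable_densityCoeff hϱ p _).mono_measure
    (Measure.restrict_mono inter_subset_left le_rfl))] at h1
  have h2 : (Module.finBasis ℝ E).addHaar
      ((chartAt E p).target ∩ (chartAt E p).symm ⁻¹' (U ∩ (chartAt E p).source)) = 0 := by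
    refine measure_mono_null (fun y hy => ?_) h1
    simp only [mem_compl_iff, Set.mem_ofPred_eq]
    intro h
    have := h hy
    rw [ENNReal.ofReal_eq_zero] at this
    exact absurd (hϱ.pos p y hy.1) (not_lt.2 this)
  exact hW.measure_ne_zero _ hWne h2

end Densities

/-! ### Densities transported to one tangent space by a family of diffeomorphisms. -/

section GroupDensities

variable {E F H : Type*} [NormedAddCommGroup E] [NormedSpace ℝ E] [FiniteDimensional ℝ E]
  [NormedAddCommGroup F] [NormedSpace ℝ F] [NormedAddCommGroup H] [NormedSpace ℝ H]
  {M N P : Type*} [TopologicalSpace M] [ChartedSpace E M] [IsManifold 𝓘(ℝ, E) ∞ M]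
  [TopologicalSpace N] [ChartedSpace F N] [IsManifold 𝓘(ℝ, F) ∞ N]
  [TopologicalSpace P] [ChartedSpace H P] [IsManifold 𝓘(ℝ, H) ∞ P]

/-- Here the base point moves, but in a vector space, and the value stays at `y₀`. Both coordinate
changes are therefore trivial. -/
theorem contMDiffAt_tangentAt_model {f : P → E → N} {g : P → E} {p₀ : P} {y₀ : N}
    (hf : ContMDiffAt (𝓘(ℝ, H).prod 𝓘(ℝ, E)) 𝓘(ℝ, F) ∞ (fun q : P × E => f q.1 q.2) (p₀, g p₀))
    (hg : ContMDiffAt 𝓘(ℝ, H) 𝓘(ℝ, E) ∞ g p₀) (h : ∀ᶠ p in 𝓝 p₀, f p (g p) = y₀) :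
    ContMDiffAt 𝓘(ℝ, H) 𝓘(ℝ, E →L[ℝ] F) ∞
      (fun p => (tangentAt (f p) (g p) : E →L[ℝ] F)) p₀ := by
  have : IsManifold 𝓘(ℝ, H) 1 P := IsManifold.of_le (n := ∞) (by simp)
  have : IsManifold 𝓘(ℝ, F) 1 N := IsManifold.of_le (n := ∞) (by simp)
  have key := ContMDiffAt.mfderiv (I := 𝓘(ℝ, E)) (I' := 𝓘(ℝ, F)) (J := 𝓘(ℝ, H)) (m := ∞) (n := ∞)
    (x₀ := p₀) f g hf hg (by simp)
  have aux : ∀ y y' : N, y = y' → ∀ w : F,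
      (tangentBundleCore 𝓘(ℝ, F) N).coordChange (achart F y) (achart F y') y w = w := by
    rintro y _ rfl w
    exact (tangentBundleCore 𝓘(ℝ, F) N).coordChange_self _ _ (mem_chart_source F y) w
  refine key.congr_of_eventuallyEq ?_
  filter_upwards [h] with p hp
  symm
  have hsrc : g p ∈ (chartAt E (g p₀)).source := by
    rw [chartAt_self_eq]
    trivial
  refine (inTangentCoordinates_eq (I := 𝓘(ℝ, E)) (I' := 𝓘(ℝ, F)) g
      (fun x => f x (g x)) (fun x => (tangentAt (f x) (g x) : E →L[ℝ] F)) (x₀ := p₀) (x := p)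
      hsrc
      (by rw [hp, h.self_of_nhds]; exact mem_chart_source F y₀)).trans ?_
  refine ContinuousLinearMap.ext fun v => ?_
  refine (aux _ _ (by rw [hp, h.self_of_nhds]) _).trans ?_
  refine congrArg (mfderiv 𝓘(ℝ, E) 𝓘(ℝ, F) (f p) (g p)) ?_
  rw [tangentBundleCore_coordChange_model_space]
  rfl

variable [MeasurableSpace E] [BorelSpace E] [MeasurableSpace M] [BorelSpace M]

/-- A smooth family of diffeomorphisms `τ g` of `M` with `τ g g = e`, with inverses `σ g`. -/
structure MovingTrivialization (τ σ : M → M → M) (e : M) : Prop where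
  smooth : ContMDiff (𝓘(ℝ, E).prod 𝓘(ℝ, E)) 𝓘(ℝ, E) ∞ fun q : M × M => τ q.1 q.2
  smooth_inv : ∀ g, ContMDiff 𝓘(ℝ, E) 𝓘(ℝ, E) ∞ (σ g)
  base : ∀ g, τ g g = e
  left_inv : ∀ g x, σ g (τ g x) = x

namespace MovingTrivialization

variable {τ σ : M → M → M} {e : M}

/-- The density `μ₀(dτ_g v)²`. -/
def density (_t : MovingTrivialization (E := E) τ σ e) (μ₀ : HalfDensity E)
    (g : M) (v : Frame E) : ℝ :=
  μ₀.toFun (fun i => tangentAt (τ g) g (v i)) ^ 2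

theorem mdifferentiable (t : MovingTrivialization (E := E) τ σ e) (g : M) :
    MDifferentiable 𝓘(ℝ, E) 𝓘(ℝ, E) (τ g) :=
  (t.smooth.comp (contMDiff_const.prodMk contMDiff_id)).mdifferentiable (by simp)

theorem base_inv (t : MovingTrivialization (E := E) τ σ e) (g : M) : σ g e = g := by
  rw [← t.base g, t.left_inv]

theorem density_comp (t : MovingTrivialization (E := E) τ σ e) (μ₀ : HalfDensity E)
    (g : M) (T : E →L[ℝ] E) (v : Frame E) :
    t.density μ₀ g (fun i => T (v i)) =
      |((tangentAt (τ g) g : E →L[ℝ] E).comp T).det| * μ₀.toFun v ^ 2 := by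
  have h := μ₀.map_clm ((tangentAt (τ g) g : E →L[ℝ] E).comp T) v
  have h2 : t.density μ₀ g (fun i => T (v i)) =
    μ₀.toFun (fun i => ((tangentAt (τ g) g : E →L[ℝ] E).comp T) (v i)) ^ 2 := rfl
  rw [h2, h, mul_pow, Real.sq_sqrt (abs_nonneg _)]

/-- The determinant belongs to a map with the fixed value `e`, so its continuity in `y` can be read
off from `contMDiffAt_tangentAt_model`. -/
theorem densityCoeff_eq (t : MovingTrivialization (E := E) τ σ e) (μ₀ : HalfDensity E)
    (p : M) {y : E} (hy : y ∈ (chartAt E p).target) :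
    densityCoeff (t.density μ₀) p y =
      |(tangentAt (fun z => τ ((chartAt E p).symm y) ((chartAt E p).symm z)) y :
        E →L[ℝ] E).det| * μ₀.toFun (stdFrame E) ^ 2 := by
  have h : (tangentAt (fun z => τ ((chartAt E p).symm y) ((chartAt E p).symm z)) y : E →L[ℝ] E) =
      (tangentAt (τ ((chartAt E p).symm y)) ((chartAt E p).symm y) : E →L[ℝ] E).comp
        (tangentAt (chartAt E p).symm y : E →L[ℝ] E) :=
    tangentAt_comp rfl (t.mdifferentiable _ _) (mdifferentiableAt_chart_symm p hy)
  rw [h, ← t.density_comp μ₀]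
  rfl

theorem isDensity (t : MovingTrivialization (E := E) τ σ e) (μ₀ : HalfDensity E)
    (hμ₀ : ∃ v, μ₀.toFun v ≠ 0) : IsDensity (t.density μ₀) where
  map_mulMatrix x v A := by
    rw [density, Frame.map_mulMatrix, μ₀.map_mulMatrix, mul_pow, Real.sq_sqrt (abs_nonneg _)]
    rfl
  pos p y hy := by
    rw [t.densityCoeff_eq μ₀ p hy]
    -- The determinant cannot vanish because the map in question is inverted near `y` by the chart
    -- composed with `σ`.
    refine mul_pos (abs_pos.2 fun h0 => ?_) (sq_pos_of_ne_zero (HalfDensity.stdFrame_ne_zero hμ₀))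
    set φ := chartAt E p
    have h1 : (tangentAt (fun z => φ (σ (φ.symm y) (τ (φ.symm y) (φ.symm z)))) y : E →L[ℝ] E) =
        (tangentAt (fun w => φ (σ (φ.symm y) w)) e : E →L[ℝ] E).comp
          (tangentAt (fun z => τ (φ.symm y) (φ.symm z)) y : E →L[ℝ] E) := by
      refine tangentAt_comp (f := fun z => τ (φ.symm y) (φ.symm z))
        (g := fun w => φ (σ (φ.symm y) w)) (t.base _) ?_
        ((t.mdifferentiable _ _).comp y (mdifferentiableAt_chart_symm p hy))
      refine MDifferentiableAt.comp e (g := φ) ?_ ((t.smooth_inv _).mdifferentiable (by simp) _)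
      rw [t.base_inv]
      exact mdifferentiableAt_chart p (φ.map_target hy)
    have h2 : (fun z => φ (σ (φ.symm y) (τ (φ.symm y) (φ.symm z)))) =ᶠ[𝓝 y] fun z => z := by
      filter_upwards [φ.open_target.mem_nhds hy] with z hz
      rw [t.left_inv, φ.right_inv hz]
    rw [tangentAt_congr h2, tangentAt_id] at h1
    have h3 := congrArg ContinuousLinearMap.det h1
    rw [ContinuousLinearMap.det_id', ContinuousLinearMap.det_comp', h0, mul_zero] at h3
    exact one_ne_zero h3
  cont p := by
    set φ := chartAt E p
    intro y hy
    refine ContinuousAt.continuousWithinAt ?_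
    have h1 : ContMDiffAt 𝓘(ℝ, E) 𝓘(ℝ, E →L[ℝ] E) ∞
        (fun y => (tangentAt (fun z => τ (φ.symm y) (φ.symm z)) y : E →L[ℝ] E)) y := by
      have hφ : ContMDiffAt 𝓘(ℝ, E) 𝓘(ℝ, E) ∞ φ.symm y :=
        contMDiffOn_chart_symm.contMDiffAt (φ.open_target.mem_nhds hy)
      refine contMDiffAt_tangentAt_model (f := fun y z => τ (φ.symm y) (φ.symm z)) (y₀ := e)
        ?_ contMDiffAt_id (Filter.Eventually.of_forall fun q => t.base _)
      exact t.smooth.contMDiffAt.comp (y, y) (f := fun q : E × E => (φ.symm q.1, φ.symm q.2))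
        ((hφ.comp (y, y) contMDiffAt_fst).prodMk
          (ContMDiffAt.comp (g := φ.symm) (f := Prod.snd) (y, y) hφ contMDiffAt_snd))
    have h2 : ContinuousAt (fun y => |(tangentAt (fun z => τ (φ.symm y) (φ.symm z)) y :
        E →L[ℝ] E).det| * μ₀.toFun (stdFrame E) ^ 2) y :=
      ((continuous_abs.comp (ContinuousLinearMap.contDiff_det (V := E)).continuous).continuousAt.comp
        h1.continuousAt).mul continuousAt_const
    refine h2.congr ?_
    filter_upwards [φ.open_target.mem_nhds hy] with z hz
    exact (t.densityCoeff_eq μ₀ p hz).symm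

/-- The trivializations at `x` and `f x` turn the tangent map of `f` into an endomorphism of the
tangent space at `e`. The absolute value of its determinant is the factor between the density and
its pullback. -/
theorem map_withDensity [SecondCountableTopology M]
    (t : MovingTrivialization (E := E) τ σ e) (μ₀ : HalfDensity E)
    (hμ₀ : ∃ v, μ₀.toFun v ≠ 0) (f : M ≃ₜ M)
    (hf : ContMDiff 𝓘(ℝ, E) 𝓘(ℝ, E) ∞ f) {J : M → ℝ} (hJ : Continuous J) (hpos : ∀ x, 0 < J x)
    (hJf : ∀ x, |(tangentAt (fun β => τ (f x) (f (σ x β))) e : E →L[ℝ] E).det| = J x) :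
    ((densityMeasure (t.density μ₀)).withDensity fun x => ENNReal.ofReal (J x)).map f =
      densityMeasure (t.density μ₀) := by
  have ht := t.isDensity μ₀ hμ₀
  rw [← densityMeasure_mul ht hJ hpos]
  refine map_densityMeasure (ht.mul hJ hpos) ht f (hf.mdifferentiable (by simp)) fun x v => ?_
  have h1 : (tangentAt (fun z => τ (f x) (f (σ x (τ x z)))) x : E →L[ℝ] E) =
      (tangentAt (fun β => τ (f x) (f (σ x β))) e : E →L[ℝ] E).comp (tangentAt (τ x) x) :=
    tangentAt_comp (t.base x) ((t.mdifferentiable _ _).comp e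
      ((hf.mdifferentiable (by simp) _).comp e ((t.smooth_inv x).mdifferentiable (by simp) _)))
      (t.mdifferentiable _ _)
  simp only [t.left_inv] at h1
  have h2 : (tangentAt (fun z => τ (f x) (f z)) x : E →L[ℝ] E) =
      (tangentAt (τ (f x)) (f x) : E →L[ℝ] E).comp (tangentAt f x) :=
    tangentAt_comp rfl (t.mdifferentiable _ _) (hf.mdifferentiable (by simp) _)
  rw [t.density_comp, ← h2, h1, ContinuousLinearMap.det_comp', abs_mul, hJf, mul_assoc]
  congr 1
  have := t.density_comp μ₀ x (ContinuousLinearMap.id ℝ E) v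
  rw [ContinuousLinearMap.comp_id] at this
  exact this.symm

/-- A homeomorphism is a measurable equivalence, so the formula holds for arbitrary `φ`, integrable
or not. Later substitutions thus carry no side conditions. -/
theorem integral_comp_mul [SecondCountableTopology M]
    (t : MovingTrivialization (E := E) τ σ e) (μ₀ : HalfDensity E)
    (hμ₀ : ∃ v, μ₀.toFun v ≠ 0) (f : M ≃ₜ M)
    (hf : ContMDiff 𝓘(ℝ, E) 𝓘(ℝ, E) ∞ f) {J : M → ℝ} (hJ : Continuous J) (hpos : ∀ x, 0 < J x)
    (hJf : ∀ x, |(tangentAt (fun β => τ (f x) (f (σ x β))) e : E →L[ℝ] E).det| = J x)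
    (φ : M → ℂ) :
    ∫ x, J x * φ (f x) ∂(densityMeasure (t.density μ₀)) =
      ∫ x, φ x ∂(densityMeasure (t.density μ₀)) := by
  conv_rhs => rw [← t.map_withDensity μ₀ hμ₀ f hf hJ hpos hJf]
  have h1 : ((f : M → M)) = f.toMeasurableEquiv := rfl
  rw [h1, integral_map_equiv, integral_withDensity_eq_integral_toReal_smul (by fun_prop)
    (Filter.Eventually.of_forall fun x => ENNReal.ofReal_lt_top)]
  refine integral_congr_ae (Filter.Eventually.of_forall fun x => ?_)
  simp [ENNReal.toReal_ofReal (hpos x).le]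

end MovingTrivialization

end GroupDensities

/-! ### Jacobians of triangular maps and of actions at a fixed point. -/

section Jacobians

section Blocks

variable {E F H K : Type*} [NormedAddCommGroup E] [NormedSpace ℝ E] [FiniteDimensional ℝ E]
  [NormedAddCommGroup F] [NormedSpace ℝ F] [FiniteDimensional ℝ F]
  [TopologicalSpace H] [TopologicalSpace K]
  {I : ModelWithCorners ℝ E H} {J : ModelWithCorners ℝ F K}
  {M N : Type*} [TopologicalSpace M] [ChartedSpace H M] [TopologicalSpace N] [ChartedSpace K N]

theorem mfderiv_prod_apply {s : M × N → M} {r : M × N → N} {x : M} {y : N}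
    (hs : MDifferentiableAt (I.prod J) I s (x, y)) (hr : MDifferentiableAt (I.prod J) J r (x, y))
    (v : E) (w : F) :
    (mfderiv (I.prod J) (I.prod J) (fun p => (s p, r p)) (x, y) : (E × F) →L[ℝ] (E × F)) (v, w) =
      ((mfderiv I I (fun z => s (z, y)) x : E →L[ℝ] E) v +
        (mfderiv J I (fun z => s (x, z)) y : F →L[ℝ] E) w,
       (mfderiv I J (fun z => r (z, y)) x : E →L[ℝ] F) v +
        (mfderiv J J (fun z => r (x, z)) y : F →L[ℝ] F) w) := by
  rw [mfderiv_prodMk hs hr]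
  exact Prod.ext (mfderiv_prod_eq_add_apply (v := ((v, w) : E × F)) hs)
    (mfderiv_prod_eq_add_apply (v := ((v, w) : E × F)) hr)

theorem det_mfderiv_of_fst_const {s : M × N → M} {r : M × N → N} {x : M} {y : N}
    (hs : MDifferentiableAt (I.prod J) I s (x, y)) (hr : MDifferentiableAt (I.prod J) J r (x, y))
    (h : ∀ z, s (x, z) = s (x, y)) :
    (mfderiv (I.prod J) (I.prod J) (fun p => (s p, r p)) (x, y) : (E × F) →L[ℝ] (E × F)).det =
      (mfderiv I I (fun z => s (z, y)) x : E →L[ℝ] E).det *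
        (mfderiv J J (fun z => r (x, z)) y : F →L[ℝ] F).det := by
  refine ContinuousLinearMap.det_block_lower _ _ _
    (mfderiv I J (fun z => r (z, y)) x : E →L[ℝ] F) fun v w => ?_
  refine (mfderiv_prod_apply hs hr v w).trans ?_
  have h1 : (fun z => s (x, z)) = fun _ => s (x, y) := funext h
  have h2 : (mfderiv J I (fun z => s (x, z)) y : F →L[ℝ] E) = 0 := by
    rw [h1]
    exact mfderiv_const
  rw [h2]
  exact Prod.ext (add_zero _) rfl

theorem det_mfderiv_of_snd_const {s : M × N → M} {r : M × N → N} {x : M} {y : N}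
    (hs : MDifferentiableAt (I.prod J) I s (x, y)) (hr : MDifferentiableAt (I.prod J) J r (x, y))
    (h : ∀ z, r (z, y) = r (x, y)) :
    (mfderiv (I.prod J) (I.prod J) (fun p => (s p, r p)) (x, y) : (E × F) →L[ℝ] (E × F)).det =
      (mfderiv I I (fun z => s (z, y)) x : E →L[ℝ] E).det *
        (mfderiv J J (fun z => r (x, z)) y : F →L[ℝ] F).det := by
  refine ContinuousLinearMap.det_block_upper _ _ _
    (mfderiv J I (fun z => s (x, z)) y : F →L[ℝ] E) fun v w => ?_
  refine (mfderiv_prod_apply hs hr v w).trans ?_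
  have h1 : (fun z => r (z, y)) = fun _ => r (x, y) := funext h
  have h2 : (mfderiv I J (fun z => r (z, y)) x : E →L[ℝ] F) = 0 := by
    rw [h1]
    exact mfderiv_const
  rw [h2]
  exact Prod.ext rfl (zero_add _)

/-- The absolute value of the determinant of the derivative, for an arbitrary model. -/
def mjac (I : ModelWithCorners ℝ E H) (f : M → M) (x : M) : ℝ :=
  |(mfderiv I I f x : E →L[ℝ] E).det|

theorem mjac_id (x : M) : mjac I (fun z : M => z) x = 1 := by
  have h : (mfderiv I I (fun z : M => z) x : E →L[ℝ] E) = ContinuousLinearMap.id ℝ E := mfderiv_id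
  exact (congrArg (fun L : E →L[ℝ] E => |L.det|) h).trans
    ((congrArg abs ContinuousLinearMap.det_id').trans abs_one)

theorem mjac_comp {f g : M → M} {x y : M} (h : f x = y) (hg : MDifferentiableAt I I g y)
    (hf : MDifferentiableAt I I f x) :
    mjac I (fun z => g (f z)) x = mjac I g y * mjac I f x := by
  subst h
  have h : (mfderiv I I (fun z => g (f z)) x : E →L[ℝ] E) =
      (mfderiv I I g (f x) : E →L[ℝ] E).comp (mfderiv I I f x : E →L[ℝ] E) :=
    mfderiv_comp x hg hf
  exact (congrArg (fun L : E →L[ℝ] E => |L.det|) h).trans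
    ((congrArg abs (ContinuousLinearMap.det_comp' _ _)).trans (abs_mul _ _))

theorem mjac_of_fst_const {s : M × N → M} {r : M × N → N} {x : M} {y : N}
    (hs : MDifferentiableAt (I.prod J) I s (x, y)) (hr : MDifferentiableAt (I.prod J) J r (x, y))
    (h : ∀ z, s (x, z) = s (x, y)) :
    mjac (I.prod J) (fun p => (s p, r p)) (x, y) =
      mjac I (fun z => s (z, y)) x * mjac J (fun z => r (x, z)) y :=
  (congrArg abs (det_mfderiv_of_fst_const hs hr h)).trans (abs_mul _ _)

theorem mjac_of_snd_const {s : M × N → M} {r : M × N → N} {x : M} {y : N}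
    (hs : MDifferentiableAt (I.prod J) I s (x, y)) (hr : MDifferentiableAt (I.prod J) J r (x, y))
    (h : ∀ z, r (z, y) = r (x, y)) :
    mjac (I.prod J) (fun p => (s p, r p)) (x, y) =
      mjac I (fun z => s (z, y)) x * mjac J (fun z => r (x, z)) y :=
  (congrArg abs (det_mfderiv_of_snd_const hs hr h)).trans (abs_mul _ _)

end Blocks

variable {E F : Type*} [NormedAddCommGroup E] [NormedSpace ℝ E] [FiniteDimensional ℝ E]
  [NormedAddCommGroup F] [NormedSpace ℝ F]
  {M Γ : Type*} [TopologicalSpace M] [ChartedSpace E M]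
  [TopologicalSpace Γ] [ChartedSpace F Γ]

/-- The absolute value of the determinant of the tangent map. -/
def jac (f : M → M) (x : M) : ℝ := |(tangentAt f x : E →L[ℝ] E).det|

theorem jac_comp {f g : M → M} {x y : M} (h : f x = y)
    (hg : MDifferentiableAt 𝓘(ℝ, E) 𝓘(ℝ, E) g y) (hf : MDifferentiableAt 𝓘(ℝ, E) 𝓘(ℝ, E) f x) :
    jac (E := E) (fun z => g (f z)) x = jac (E := E) g y * jac (E := E) f x := by
  rw [jac, tangentAt_comp h hg hf, ContinuousLinearMap.det_comp', abs_mul, jac, jac]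

theorem jac_id (x : M) : jac (E := E) (fun z : M => z) x = 1 := by
  rw [jac, tangentAt_id, ContinuousLinearMap.det_id', abs_one]

theorem jac_nonneg (f : M → M) (x : M) : 0 ≤ jac (E := E) f x := abs_nonneg _

theorem HalfDensity.map_tangentAt (μ : HalfDensity E) (f : M → M) (x : M) (v : Frame E) :
    μ.toFun (fun i => tangentAt f x (v i)) = Real.sqrt (jac (E := E) f x) * μ.toFun v :=
  μ.map_clm _ v

/-- Inversion is an involution fixing the identity, so its Jacobian there is a nonnegative number
with square `1`. -/
theorem jac_inv [Group M] [LieGroup 𝓘(ℝ, E) ∞ M] : jac (E := E) (fun z : M => z⁻¹) 1 = 1 := by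
  have hd : MDifferentiable 𝓘(ℝ, E) 𝓘(ℝ, E) (fun z : M => z⁻¹) :=
    (contMDiff_inv _ ∞).mdifferentiable (by simp)
  have h := jac_comp (E := E) (f := fun z : M => z⁻¹) (g := fun z : M => z⁻¹) inv_one (hd 1) (hd 1)
  simp only [inv_inv] at h
  rw [jac_id] at h
  have h0 := jac_nonneg (E := E) (fun z : M => z⁻¹) 1
  nlinarith

/-- A smooth action of `Γ` on `M` with a fixed point `x₀`. -/
structure FixedPointAction (E F : Type*) [NormedAddCommGroup E] [NormedSpace ℝ E]
    [NormedAddCommGroup F] [NormedSpace ℝ F] [ChartedSpace E M] [ChartedSpace F Γ] [Group Γ]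
    (f : Γ → M → M) (x₀ : M) : Prop where
  smooth : ContMDiff (𝓘(ℝ, F).prod 𝓘(ℝ, E)) 𝓘(ℝ, E) ∞ fun q : Γ × M => f q.1 q.2
  fix : ∀ γ, f γ x₀ = x₀
  one : ∀ x, f 1 x = x
  mul : ∀ γ γ' x, f (γ * γ') x = f γ (f γ' x)

namespace FixedPointAction

variable [Group Γ] {f : Γ → M → M} {x₀ : M}

theorem mdifferentiable (h : FixedPointAction E F f x₀) (γ : Γ) :
    MDifferentiable 𝓘(ℝ, E) 𝓘(ℝ, E) (f γ) :=
  (h.smooth.comp (contMDiff_const.prodMk contMDiff_id)).mdifferentiable (by simp)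

/-- The chain rule at a fixed point makes the Jacobian a character of `Γ`. Positivity and the
formula for inverses follow formally; `jacA`, `jacB` and `absDetAd` are all of this kind. -/
theorem jac_mul (h : FixedPointAction E F f x₀) (γ γ' : Γ) :
    jac (E := E) (f (γ * γ')) x₀ = jac (E := E) (f γ) x₀ * jac (E := E) (f γ') x₀ := by
  have h1 : f (γ * γ') = fun x => f γ (f γ' x) := funext (h.mul γ γ')
  rw [h1]
  exact jac_comp (h.fix γ') (h.mdifferentiable γ _) (h.mdifferentiable γ' _)

theorem jac_one (h : FixedPointAction E F f x₀) : jac (E := E) (f 1) x₀ = 1 := by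
  have h1 : f 1 = fun x => x := funext h.one
  rw [h1, jac_id]

theorem jac_pos (h : FixedPointAction E F f x₀) (γ : Γ) : 0 < jac (E := E) (f γ) x₀ := by
  have h1 := h.jac_mul γ γ⁻¹
  rw [mul_inv_cancel, h.jac_one] at h1
  refine lt_of_le_of_ne (abs_nonneg _) fun h0 => ?_
  rw [← h0, zero_mul] at h1
  exact one_ne_zero h1

theorem jac_inv (h : FixedPointAction E F f x₀) (γ : Γ) :
    jac (E := E) (f γ⁻¹) x₀ = (jac (E := E) (f γ) x₀)⁻¹ := by
  have h1 := h.jac_mul γ γ⁻¹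
  rw [mul_inv_cancel, h.jac_one] at h1
  exact eq_inv_of_mul_eq_one_right h1.symm

theorem contMDiff_jac [IsManifold 𝓘(ℝ, E) ∞ M] [IsManifold 𝓘(ℝ, F) ∞ Γ]
    (h : FixedPointAction E F f x₀) :
    ContMDiff 𝓘(ℝ, F) 𝓘(ℝ, ℝ) ∞ fun γ => jac (E := E) (f γ) x₀ := by
  intro γ
  have h1 : ContMDiffAt 𝓘(ℝ, F) 𝓘(ℝ, ℝ) ∞
      (fun γ => (tangentAt (f γ) x₀ : E →L[ℝ] E).det) γ :=
    ContinuousLinearMap.contDiff_det.comp_contMDiffAt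
      ((contMDiff_tangentAt_param f x₀ x₀ h.fix h.smooth) γ)
  -- The absolute value is smooth away from zero.
  have h2 : (tangentAt (f γ) x₀ : E →L[ℝ] E).det ≠ 0 := abs_pos.1 (h.jac_pos γ)
  exact ContDiffAt.comp_contMDiffAt (g := fun t : ℝ => |t|) (contDiffAt_abs h2) h1

end FixedPointAction

/-- The modular function `|det Ad|`. -/
def absDetAd (E : Type*) [NormedAddCommGroup E] [NormedSpace ℝ E] {M : Type*} [TopologicalSpace M]
    [ChartedSpace E M] [Group M] (g : M) : ℝ := jac (E := E) (fun x => g * x * g⁻¹) 1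

theorem fixedPointAction_conj [Group M] [LieGroup 𝓘(ℝ, E) ∞ M] :
    FixedPointAction E E (fun (g x : M) => g * x * g⁻¹) 1 where
  smooth := (contMDiff_fst.mul contMDiff_snd).mul contMDiff_fst.inv
  fix γ := by simp
  one x := by simp
  mul γ γ' x := by group

end Jacobians

namespace DoubleLieGroup

/-! ### The half-densities and `t_δ` in terms of the modular characters. -/

section Formulas

variable {EG EA EB : Type*}
  [NormedAddCommGroup EG] [NormedSpace ℝ EG] [FiniteDimensional ℝ EG]
  [NormedAddCommGroup EA] [NormedSpace ℝ EA] [FiniteDimensional ℝ EA]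
  [NormedAddCommGroup EB] [NormedSpace ℝ EB] [FiniteDimensional ℝ EB]
  {G A B : Type*}
  [TopologicalSpace G] [ChartedSpace EG G] [Group G] [LieGroup 𝓘(ℝ, EG) ∞ G]
  [T2Space G] [SecondCountableTopology G]
  [TopologicalSpace A] [ChartedSpace EA A] [Group A] [LieGroup 𝓘(ℝ, EA) ∞ A]
  [TopologicalSpace B] [ChartedSpace EB B] [Group B] [LieGroup 𝓘(ℝ, EB) ∞ B]
  (D : DoubleLieGroup EG EA EB G A B) (μ₀ : HalfDensity EB) (ν₀ : HalfDensity EA)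

theorem smooth_act : ContMDiff (𝓘(ℝ, EA).prod 𝓘(ℝ, EB)) 𝓘(ℝ, EB) ∞
    fun q : A × B => D.act q.1 q.2 :=
  D.contMDiff_bL.comp D.contMDiff_mulMap

theorem smooth_coact : ContMDiff (𝓘(ℝ, EA).prod 𝓘(ℝ, EB)) 𝓘(ℝ, EA) ∞
    fun q : A × B => D.coact q.1 q.2 :=
  D.contMDiff_aR.comp D.contMDiff_mulMap

theorem fixedPointAction_act : FixedPointAction EB EA D.act 1 where
  smooth := D.smooth_act
  fix := D.act_one_right
  one := D.act_one_left
  mul := D.act_mul_left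

/-- The left action of `B` on `A`. -/
def dualAct (b : B) (α : A) : A := D.aL (D.iB b * D.iA α)

theorem fixedPointAction_dualAct : FixedPointAction EA EB D.dualAct 1 where
  smooth := D.contMDiff_aL.comp ((D.smooth_iB.comp contMDiff_fst).mul
    (D.smooth_iA.comp contMDiff_snd))
  fix b := by simp [dualAct]
  one a := by simp [dualAct]
  mul b b' a := by
    have h : D.iB (b * b') * D.iA a = D.iB b * D.iA (D.dualAct b' a) *
        D.iB (D.bR (D.iB b' * D.iA a)) := by
      rw [map_mul, mul_assoc, mul_assoc, dualAct, aL_mul_bR]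
    rw [dualAct, h, aL_mul_iB]
    rfl

/-- The Jacobian at the identity of the action of `A` on `B`. -/
def jacA (a : A) : ℝ := jac (E := EB) (D.act a) 1

/-- The Jacobian at the identity of the action of `B` on `A`. -/
def jacB (b : B) : ℝ := jac (E := EA) (D.dualAct b) 1

theorem jacA_pos (a : A) : 0 < D.jacA a := D.fixedPointAction_act.jac_pos a

theorem jacA_mul (a a' : A) : D.jacA (a * a') = D.jacA a * D.jacA a' :=
  D.fixedPointAction_act.jac_mul a a'

theorem jacA_inv (a : A) : D.jacA a⁻¹ = (D.jacA a)⁻¹ := D.fixedPointAction_act.jac_inv a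

theorem contMDiff_jacA : ContMDiff 𝓘(ℝ, EA) 𝓘(ℝ, ℝ) ∞ D.jacA :=
  D.fixedPointAction_act.contMDiff_jac

theorem jacB_pos (b : B) : 0 < D.jacB b := D.fixedPointAction_dualAct.jac_pos b

theorem jacB_mul (b b' : B) : D.jacB (b * b') = D.jacB b * D.jacB b' :=
  D.fixedPointAction_dualAct.jac_mul b b'

theorem absDetAd_pos {E M : Type*} [NormedAddCommGroup E] [NormedSpace ℝ E]
    [FiniteDimensional ℝ E] [TopologicalSpace M] [ChartedSpace E M] [Group M]
    [LieGroup 𝓘(ℝ, E) ∞ M] (g : M) : 0 < absDetAd E g := fixedPointAction_conj.jac_pos g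

theorem absDetAd_mul {E M : Type*} [NormedAddCommGroup E] [NormedSpace ℝ E]
    [FiniteDimensional ℝ E] [TopologicalSpace M] [ChartedSpace E M] [Group M]
    [LieGroup 𝓘(ℝ, E) ∞ M] (g h : M) : absDetAd E (g * h) = absDetAd E g * absDetAd E h :=
  fixedPointAction_conj.jac_mul g h

theorem absDetAd_inv {E M : Type*} [NormedAddCommGroup E] [NormedSpace ℝ E]
    [FiniteDimensional ℝ E] [TopologicalSpace M] [ChartedSpace E M] [Group M]
    [LieGroup 𝓘(ℝ, E) ∞ M] (g : M) : absDetAd E g⁻¹ = (absDetAd E g)⁻¹ :=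
  fixedPointAction_conj.jac_inv g

theorem contMDiff_absDetAd {E M : Type*} [NormedAddCommGroup E] [NormedSpace ℝ E]
    [FiniteDimensional ℝ E] [TopologicalSpace M] [ChartedSpace E M] [Group M]
    [LieGroup 𝓘(ℝ, E) ∞ M] : ContMDiff 𝓘(ℝ, E) 𝓘(ℝ, ℝ) ∞ (absDetAd E : M → ℝ) :=
  fixedPointAction_conj.contMDiff_jac

theorem mdifferentiable_inv {E M : Type*} [NormedAddCommGroup E] [NormedSpace ℝ E]
    [TopologicalSpace M] [ChartedSpace E M] [Group M]
    [LieGroup 𝓘(ℝ, E) ∞ M] : MDifferentiable 𝓘(ℝ, E) 𝓘(ℝ, E) (fun z : M => z⁻¹) :=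
  (contMDiff_inv _ ∞).mdifferentiable (by simp)

/-! ### Half-densities -/

/-- Along the left fibre, `s(g b)` is the right translate of `s(g)` by the inverse of `act (a_R g)
b`, and inversion has Jacobian `1`. -/
theorem abs_det_leftToRight_sA (g : G) : |(D.leftToRight D.sA g).det| = D.jacA (D.aR g) := by
  have h1 : (fun b : B => D.bR (D.sA (g * D.iB b) * (D.sA g)⁻¹)) =
      fun b => (D.act (D.aR g) b)⁻¹ := by
    funext b
    have h2 : D.bL (g * D.iB b) = D.bL g * D.act (D.aR g) b := by
      conv_lhs => rw [← D.bL_mul_aR g, mul_assoc, bL_iB_mul]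
      rfl
    have h3 : D.sA (g * D.iB b) * (D.sA g)⁻¹ = D.iB (D.act (D.aR g) b)⁻¹ := by
      rw [sA_eq, sA_eq, h2, aL_mul_iB, map_mul, map_inv]
      group
    rw [h3, bR_iB]
  have h4 : jac (E := EB) (fun b => (D.act (D.aR g) b)⁻¹) (1 : B) = D.jacA (D.aR g) := by
    rw [jac_comp (g := fun b : B => b⁻¹) (f := D.act (D.aR g)) (D.act_one_right _)
      (mdifferentiable_inv _) (D.fixedPointAction_act.mdifferentiable _ _), jac_inv, one_mul, jacA]
  rw [leftToRight, h1]
  exact h4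

theorem abs_det_rightToLeft_sA (g : G) :
    |(D.rightToLeft D.sA g).det| = (D.jacA (D.aL g))⁻¹ := by
  have h1 : (fun b : B => D.bR ((D.sA g)⁻¹ * D.sA (D.iB b * g))) =
      fun b => D.act (D.aL g)⁻¹ b⁻¹ := by
    funext b
    have h2 : D.bR (D.iB b * g) = (D.act (D.aL g)⁻¹ b⁻¹)⁻¹ * D.bR g := by
      conv_lhs => rw [← D.aL_mul_bR g, ← mul_assoc, bR_mul_iB]
      have h3 : D.iB b * D.iA (D.aL g) = (D.iA (D.aL g)⁻¹ * D.iB b⁻¹)⁻¹ := by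
        rw [map_inv, map_inv]
        group
      rw [h3, bR_inv]
      rfl
    have h3 : (D.sA g)⁻¹ * D.sA (D.iB b * g) = D.iB (D.act (D.aL g)⁻¹ b⁻¹) := by
      rw [sA, sA, h2, aR_iB_mul, map_mul, map_inv]
      group
    rw [h3, bR_iB]
  have h4 : jac (E := EB) (fun b => D.act (D.aL g)⁻¹ b⁻¹) (1 : B) = (D.jacA (D.aL g))⁻¹ := by
    rw [jac_comp (f := fun b : B => b⁻¹) (g := D.act (D.aL g)⁻¹) inv_one
      (D.fixedPointAction_act.mdifferentiable _ _) (mdifferentiable_inv _), jac_inv, mul_one,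
      ← jacA_inv, jacA]
  rw [rightToLeft, h1]
  exact h4

theorem lamTilde_eq (g : G) (v : Frame EB) :
    D.lamTilde μ₀ g v = Real.sqrt (D.jacA (D.aR g)) * μ₀.toFun v := by
  rw [lamTilde, rhoTilde, μ₀.map_clm, abs_det_leftToRight_sA]

theorem rho₀_eq (g : G) (w : Frame EB) :
    D.rho₀ μ₀ g w = Real.sqrt (D.jacA (D.aL g))⁻¹ * μ₀.toFun w := by
  rw [rho₀, lam₀, μ₀.map_clm, abs_det_rightToLeft_sA]

theorem omega₀_eq (g : G) (v w : Frame EB) :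
    D.omega₀ μ₀ g v w = Real.sqrt (D.jacA (D.aL g))⁻¹ * (μ₀.toFun v * μ₀.toFun w) := by
  rw [omega₀, rho₀_eq, lam₀]
  ring

theorem leftToRight_inv (g : G) :
    D.leftToRight (fun x : G => x⁻¹) g = (tangentAt (fun b : B => b⁻¹) (1 : B) : EB →L[ℝ] EB) := by
  have : (fun b : B => D.bR ((g * D.iB b)⁻¹ * (g⁻¹)⁻¹)) = fun b => b⁻¹ := by
    funext b
    rw [inv_inv, mul_inv_rev, mul_assoc, inv_mul_cancel, mul_one, ← map_inv, bR_iB]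
  rw [← this]
  rfl

theorem rightToLeft_inv (g : G) :
    D.rightToLeft (fun x : G => x⁻¹) g = (tangentAt (fun b : B => b⁻¹) (1 : B) : EB →L[ℝ] EB) := by
  have : (fun b : B => D.bR ((g⁻¹)⁻¹ * (D.iB b * g)⁻¹)) = fun b => b⁻¹ := by
    funext b
    rw [inv_inv, mul_inv_rev, ← mul_assoc, mul_inv_cancel, one_mul, ← map_inv, bR_iB]
  rw [← this]
  rfl

/-! ### The function `t_δ` -/

theorem tDeltaMap_eq (x y₁ y₂ : G) (β : B × B × B) :
    D.tDeltaMap x y₁ y₂ β =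
      ((D.bR x)⁻¹ * D.bR (D.iB (β.1 * D.bL x) * D.iA (D.aL (D.iB β.2.1 * y₁)) *
          D.iA (D.aL (D.iB β.2.2 * y₂))),
        β.1 * D.bL x * β.2.1 * (D.bL x)⁻¹,
        D.bR (D.iB (β.1 * D.bL x) * D.iA (D.aL (D.iB β.2.1 * y₁))) * β.2.2 *
          (D.bR (D.iB (D.bL x) * D.iA (D.aL y₁)))⁻¹) := by
  obtain ⟨β₁, β₂, β₃⟩ := β
  have hb : ∀ a a' : A, D.bL (D.iB β₁ * D.iB (D.bL x) * D.iA a * D.iA a') = β₁ * D.bL x := by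
    intro a a'
    rw [bL_mul_iA, bL_mul_iA, ← map_mul, bL_iB]
  simp only [tDeltaMap, mDelta, deltaR, mulA_eq, hb, bL_mul_iA, bL_iB_mul, bL_iB, map_mul]
  refine Prod.ext rfl (Prod.ext ?_ ?_)
  · have : D.iB β₁ * D.iB (D.bL x) * (D.iB β₂ * y₁) * (D.iB (D.bL x) * y₁)⁻¹ =
        D.iB (β₁ * D.bL x * β₂ * (D.bL x)⁻¹) := by
      simp only [map_mul, map_inv]
      group
    exact (congrArg D.bR this).trans (D.bR_iB _)
  · dsimp only
    generalize D.bR (D.iB β₁ * D.iB (D.bL x) * D.iA (D.aL (D.iB β₂ * y₁))) = u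
    generalize D.bR (D.iB (D.bL x) * D.iA (D.aL y₁)) = q
    have : D.iB u * (D.iB β₃ * y₂) * (D.iB q * y₂)⁻¹ = D.iB (u * β₃ * q⁻¹) := by
      simp only [map_mul, map_inv]
      group
    rw [this, bR_iB]

theorem contMDiff_tDeltaMap (x y₁ y₂ : G) :
    ContMDiff (𝓘(ℝ, EB).prod (𝓘(ℝ, EB).prod 𝓘(ℝ, EB)))
      (𝓘(ℝ, EB).prod (𝓘(ℝ, EB).prod 𝓘(ℝ, EB))) ∞ (D.tDeltaMap x y₁ y₂) := by
  rw [funext (D.tDeltaMap_eq x y₁ y₂)]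
  have h1 : ContMDiff (𝓘(ℝ, EB).prod (𝓘(ℝ, EB).prod 𝓘(ℝ, EB))) 𝓘(ℝ, EB) ∞
    fun β : B × B × B => β.1 := contMDiff_fst
  have h2 : ContMDiff (𝓘(ℝ, EB).prod (𝓘(ℝ, EB).prod 𝓘(ℝ, EB))) 𝓘(ℝ, EB) ∞
    fun β : B × B × B => β.2.1 := contMDiff_fst.comp contMDiff_snd
  have h3 : ContMDiff (𝓘(ℝ, EB).prod (𝓘(ℝ, EB).prod 𝓘(ℝ, EB))) 𝓘(ℝ, EB) ∞
    fun β : B × B × B => β.2.2 := contMDiff_snd.comp contMDiff_snd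
  have hp := D.smooth_iB.comp (h1.mul (contMDiff_const (c := D.bL x)))
  have ha := D.smooth_iA.comp (D.contMDiff_aL.comp ((D.smooth_iB.comp h2).mul
    (contMDiff_const (c := y₁))))
  have hc := D.smooth_iA.comp (D.contMDiff_aL.comp ((D.smooth_iB.comp h3).mul
    (contMDiff_const (c := y₂))))
  exact (contMDiff_const.mul (D.contMDiff_bR.comp ((hp.mul ha).mul hc))).prodMk
    ((((h1.mul contMDiff_const).mul h2).mul contMDiff_const).prodMk
      (((D.contMDiff_bR.comp (hp.mul ha)).mul h3).mul contMDiff_const))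

/-- For `u = β₁ b_L(x)` and `x' = u a₂ a₃`, the factorization of `x'` along the left fibres. -/
theorem iB_mul_iA_mul_iA (u : B) (a₂ a₃ : A) :
    D.iB u * D.iA a₂ * D.iA a₃ = D.iA (D.aL (D.iB u * D.iA a₂)) *
      D.iA (D.aL (D.iB (D.bR (D.iB u * D.iA a₂)) * D.iA a₃)) *
      D.iB (D.bR (D.iB u * D.iA a₂ * D.iA a₃)) := by
  have h1 := D.aL_mul_bR (D.iB u * D.iA a₂)
  have h2 := D.aL_mul_bR (D.iB (D.bR (D.iB u * D.iA a₂)) * D.iA a₃)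
  have h3 : D.iB u * D.iA a₂ * D.iA a₃ =
      D.iA (D.aL (D.iB u * D.iA a₂)) * (D.iB (D.bR (D.iB u * D.iA a₂)) * D.iA a₃) := by
    rw [← mul_assoc, h1]
  conv_lhs => rw [h3, ← h2, ← mul_assoc]
  congr 2
  conv_rhs => rw [h3, bR_iA_mul]

theorem aL_iB_mul_eq (b : B) (g : G) : D.aL (D.iB b * g) = D.aL (D.iB b * D.iA (D.aL g)) := by
  conv_lhs => rw [← D.aL_mul_bR g, ← mul_assoc, aL_mul_iB]

/-- The first component of `tDeltaMap` depends on all three variables, so its derivative is not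
visibly triangular. Composing with `K : γ ↦ (S γ, γ₂, γ₃)` restores the variable `β₁`, and both `K`
and the composite are triangular. With `p = b_L(x)`, their Jacobians are `|det Ad p| · jacA (a_R x)`
and `|det Ad p| · |det Ad q|`, and the factor at `p` cancels. -/
theorem mjac_tDeltaMap {x y₁ y₂ : G} (h : D.aR x = D.aL y₁ * D.aL y₂) :
    mjac (𝓘(ℝ, EB).prod (𝓘(ℝ, EB).prod 𝓘(ℝ, EB)))
      (D.tDeltaMap x y₁ y₂) (1, 1, 1) * D.jacA (D.aR x) =
      absDetAd EB (D.bR (D.iB (D.bL x) * D.iA (D.aL y₁))) := by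
  set p := D.bL x with hp
  set q := D.bR (D.iB p * D.iA (D.aL y₁)) with hq
  set z₁ := D.iB p * y₁ with hz₁
  set z₂ := D.iB q * y₂ with hz₂
  have hx : D.iB p * D.iA (D.aL y₁) * D.iA (D.aL y₂) = x := by
    rw [mul_assoc, ← map_mul, ← h, bL_mul_aR]
  -- The second parametrization recovers the point `x'`, and `b_L(x') = β₁ p`; hence the final
  -- factor `p⁻¹`.
  let S : B × B × B → B := fun γ => D.bL (D.iA (D.aL (D.iB γ.2.1 * z₁)) *
    D.iA (D.aL (D.iB γ.2.2 * z₂)) * D.iB (D.bR x * γ.1)) * p⁻¹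
  let R : B × B × B → B × B := fun β => (β.1 * p * β.2.1 * p⁻¹,
    D.bR (D.iB (β.1 * p) * D.iA (D.aL (D.iB β.2.1 * y₁))) * β.2.2 * q⁻¹)
  have h1 : ContMDiff (𝓘(ℝ, EB).prod (𝓘(ℝ, EB).prod 𝓘(ℝ, EB))) 𝓘(ℝ, EB) ∞
    fun β : B × B × B => β.1 := contMDiff_fst
  have h2 : ContMDiff (𝓘(ℝ, EB).prod (𝓘(ℝ, EB).prod 𝓘(ℝ, EB))) 𝓘(ℝ, EB) ∞
    fun β : B × B × B => β.2.1 := contMDiff_fst.comp contMDiff_snd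
  have h3 : ContMDiff (𝓘(ℝ, EB).prod (𝓘(ℝ, EB).prod 𝓘(ℝ, EB))) 𝓘(ℝ, EB) ∞
    fun β : B × B × B => β.2.2 := contMDiff_snd.comp contMDiff_snd
  have hS : ContMDiff (𝓘(ℝ, EB).prod (𝓘(ℝ, EB).prod 𝓘(ℝ, EB))) 𝓘(ℝ, EB) ∞ S := by
    have ha := D.smooth_iA.comp (D.contMDiff_aL.comp ((D.smooth_iB.comp h2).mul
      (contMDiff_const (c := z₁))))
    have hc := D.smooth_iA.comp (D.contMDiff_aL.comp ((D.smooth_iB.comp h3).mul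
      (contMDiff_const (c := z₂))))
    have hb := D.smooth_iB.comp ((contMDiff_const (c := D.bR x)).mul h1)
    exact (D.contMDiff_bL.comp ((ha.mul hc).mul hb)).mul contMDiff_const
  have hR : ContMDiff (𝓘(ℝ, EB).prod (𝓘(ℝ, EB).prod 𝓘(ℝ, EB))) (𝓘(ℝ, EB).prod 𝓘(ℝ, EB)) ∞ R := by
    have hp' := D.smooth_iB.comp (h1.mul (contMDiff_const (c := p)))
    have ha := D.smooth_iA.comp (D.contMDiff_aL.comp ((D.smooth_iB.comp h2).mul
      (contMDiff_const (c := y₁))))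
    exact (((h1.mul contMDiff_const).mul h2).mul contMDiff_const).prodMk
      (((D.contMDiff_bR.comp (hp'.mul ha)).mul h3).mul contMDiff_const)
  have hT := D.contMDiff_tDeltaMap x y₁ y₂
  have hone : D.tDeltaMap x y₁ y₂ (1, 1, 1) = (1, 1, 1) := by
    rw [tDeltaMap_eq]
    simp only [one_mul, map_one, mul_one]
    rw [← hp, hx, ← hq]
    simp
  have hST : ∀ β, (S (D.tDeltaMap x y₁ y₂ β), (D.tDeltaMap x y₁ y₂ β).2) = (β.1, R β) := by
    intro β
    rw [tDeltaMap_eq, ← hp, ← hq]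
    refine Prod.ext ?_ rfl
    simp only [S]
    set u := β.1 * p with hu
    have e1 : D.iB (u * β.2.1 * p⁻¹) * z₁ = D.iB u * (D.iB β.2.1 * y₁) := by
      rw [hz₁]
      simp only [map_mul, map_inv]
      group
    set v := D.bR (D.iB u * D.iA (D.aL (D.iB β.2.1 * y₁))) with hv
    have e2 : D.iB (v * β.2.2 * q⁻¹) * z₂ = D.iB v * (D.iB β.2.2 * y₂) := by
      rw [hz₂]
      simp only [map_mul, map_inv]
      group
    rw [e1, e2, aL_iB_mul_eq D u, aL_iB_mul_eq D v, mul_inv_cancel_left, hv,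
      ← iB_mul_iA_mul_iA, bL_mul_iA, bL_mul_iA, bL_iB, hu, mul_inv_cancel_right]
  -- the two sides of `K ∘ T = (β₁, R)`
  have hK : ContMDiff (𝓘(ℝ, EB).prod (𝓘(ℝ, EB).prod 𝓘(ℝ, EB)))
      (𝓘(ℝ, EB).prod (𝓘(ℝ, EB).prod 𝓘(ℝ, EB))) ∞ (fun γ : B × B × B => (S γ, γ.2)) :=
    hS.prodMk contMDiff_snd
  have hdK : mjac (𝓘(ℝ, EB).prod (𝓘(ℝ, EB).prod 𝓘(ℝ, EB)))
      (fun γ : B × B × B => (S γ, γ.2)) (1, 1, 1) =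
      absDetAd EB p * D.jacA (D.aR x) := by
    rw [mjac_of_snd_const (s := S) (r := Prod.snd) (x := (1 : B)) (y := ((1, 1) : B × B))
      (hS.mdifferentiable (by simp) _) (contMDiff_snd.mdifferentiable (n := ∞) (by simp) _)
      (fun z => rfl)]
    have e2 : (fun z => S (z, ((1, 1) : B × B))) = fun z => p * D.act (D.aR x) z * p⁻¹ := by
      funext z
      have e3 := D.iB_mul_iA_mul_iA p (D.aL y₁) (D.aL y₂)
      rw [hx, ← hq] at e3
      simp only [S, map_one, one_mul]
      rw [hz₁, hz₂, aL_iB_mul_eq D p, aL_iB_mul_eq D q, map_mul, ← mul_assoc, ← e3]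
      congr 1
      conv_lhs => rw [← D.bL_mul_aR x, mul_assoc, bL_iB_mul]
      rfl
    rw [mjac_id, mul_one, e2]
    exact jac_comp (E := EB) (f := D.act (D.aR x)) (g := fun z : B => p * z * p⁻¹)
      (D.act_one_right _) (fixedPointAction_conj.mdifferentiable _ _)
      (D.fixedPointAction_act.mdifferentiable _ _)
  have hdKT : mjac (𝓘(ℝ, EB).prod (𝓘(ℝ, EB).prod 𝓘(ℝ, EB)))
      (fun β : B × B × B => (β.1, R β)) (1, 1, 1) =
      absDetAd EB p * absDetAd EB q := by
    rw [mjac_of_fst_const (s := Prod.fst) (r := R) (x := (1 : B)) (y := ((1, 1) : B × B))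
      (contMDiff_fst.mdifferentiable (n := ∞) (by simp) _) (hR.mdifferentiable (by simp) _)
      (fun z => rfl), mjac_id, one_mul]
    have hR1 : ContMDiff (𝓘(ℝ, EB).prod 𝓘(ℝ, EB)) (𝓘(ℝ, EB).prod 𝓘(ℝ, EB)) ∞
        fun z : B × B => R (1, z) := hR.comp (contMDiff_const.prodMk contMDiff_id)
    have e4 := mjac_of_fst_const (I := 𝓘(ℝ, EB)) (J := 𝓘(ℝ, EB))
      (s := fun z : B × B => (R (1, z)).1)
      (r := fun z : B × B => (R (1, z)).2) (x := (1 : B)) (y := (1 : B))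
      ((contMDiff_fst.comp hR1).mdifferentiable (by simp) _)
      ((contMDiff_snd.comp hR1).mdifferentiable (by simp) _) (fun z => rfl)
    refine e4.trans ?_
    have e5 : (fun z : B => (R (1, (z, 1))).1) = fun z => p * z * p⁻¹ := by
      funext z
      simp [R]
    have e6 : (fun z : B => (R (1, (1, z))).2) = fun z => q * z * q⁻¹ := by
      funext z
      simp only [R, one_mul, map_one]
      rw [← hq]
    rw [e5, e6]
    rfl
  have hchain := mjac_comp (I := 𝓘(ℝ, EB).prod (𝓘(ℝ, EB).prod 𝓘(ℝ, EB)))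
    (g := fun γ : B × B × B => (S γ, γ.2)) hone
    (hK.mdifferentiable (by simp) _) (hT.mdifferentiable (by simp) (1, 1, 1))
  rw [funext hST, hdK, hdKT] at hchain
  have hpos := absDetAd_pos (E := EB) p
  refine mul_left_cancel₀ hpos.ne' (hchain.trans ?_).symm
  ring

/-- Because `jacA` is a character, the factors of `ρ₀` at `y₁`, `y₂` combine to one at `a_R(x)` and
cancel against the Jacobian, while those at `z₁`, `z₂` combine to one at `a_L(x)` and cancel against
`ρ₀(x)`. -/
theorem tDelta_eq (hμ₀ : ∃ v, μ₀.toFun v ≠ 0) {x y₁ y₂ : G} (h : D.aR x = D.aL y₁ * D.aL y₂) :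
    D.tDelta μ₀ x y₁ y₂ =
      (Real.sqrt (absDetAd EB (D.bR (D.iB (D.bL x) * D.iA (D.aL y₁)))))⁻¹ := by
  have hc := HalfDensity.stdFrame_ne_zero hμ₀
  have hJ := D.mjac_tDeltaMap h
  set q := D.bR (D.iB (D.bL x) * D.iA (D.aL y₁)) with hq
  have hz : D.aL (D.mDelta x y₁ y₂).1 * D.aL (D.mDelta x y₁ y₂).2 = D.aL x := by
    simp only [mDelta, deltaR, mulA_eq, bL_mul_iA, bL_iB]
    rw [← hq, aL_iB_mul_eq, aL_iB_mul_eq D q]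
    have h1 : D.iB (D.bL x) * D.iA (D.aL y₁) * D.iA (D.aL y₂) = x := by
      rw [mul_assoc, ← map_mul, ← h, bL_mul_aR]
    have h2 := D.iB_mul_iA_mul_iA (D.bL x) (D.aL y₁) (D.aL y₂)
    rw [← hq, h1, ← map_mul] at h2
    conv_rhs => rw [h2]
    rw [aL_iA_mul_iB]
  have hd : D.jacA (D.aL (D.mDelta x y₁ y₂).1) * D.jacA (D.aL (D.mDelta x y₁ y₂).2) =
      D.jacA (D.aL x) := by rw [← jacA_mul, hz]
  have hr : D.jacA (D.aL y₁) * D.jacA (D.aL y₂) = D.jacA (D.aR x) := by rw [← jacA_mul, ← h]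
  have hJ' := eq_div_of_mul_eq (D.jacA_pos (D.aR x)).ne' hJ
  change _ / (Real.sqrt (mjac (𝓘(ℝ, EB).prod (𝓘(ℝ, EB).prod 𝓘(ℝ, EB)))
    (D.tDeltaMap x y₁ y₂) (1, 1, 1)) * _) = _
  simp only [rho₀_eq, lam₀]
  rw [hJ']
  set c := μ₀.toFun (stdFrame EB)
  have p1 := D.jacA_pos (D.aL y₁)
  have p2 := D.jacA_pos (D.aL y₂)
  have p3 := D.jacA_pos (D.aL (D.mDelta x y₁ y₂).1)
  have p4 := D.jacA_pos (D.aL (D.mDelta x y₁ y₂).2)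
  have p5 := absDetAd_pos (E := EB) q
  rw [← hd, ← hr]
  simp only [Real.sqrt_inv, Real.sqrt_mul p1.le, Real.sqrt_mul p3.le, Real.sqrt_div p5.le]
  have q1 := (Real.sqrt_pos.2 p1).ne'
  have q2 := (Real.sqrt_pos.2 p2).ne'
  have q3 := (Real.sqrt_pos.2 p3).ne'
  have q4 := (Real.sqrt_pos.2 p4).ne'
  have q5 := (Real.sqrt_pos.2 p5).ne'
  field_simp

end Formulas

end DoubleLieGroup

namespace DoubleLieGroup

/-! ### The functions `Q` and `σ` in terms of the modular characters. -/

section Formulas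

variable {EG EA EB : Type*}
  [NormedAddCommGroup EG] [NormedSpace ℝ EG] [FiniteDimensional ℝ EG]
  [NormedAddCommGroup EA] [NormedSpace ℝ EA] [FiniteDimensional ℝ EA]
  [NormedAddCommGroup EB] [NormedSpace ℝ EB] [FiniteDimensional ℝ EB]
  {G A B : Type*}
  [TopologicalSpace G] [ChartedSpace EG G] [Group G] [LieGroup 𝓘(ℝ, EG) ∞ G]
  [T2Space G] [SecondCountableTopology G]
  [TopologicalSpace A] [ChartedSpace EA A] [Group A] [LieGroup 𝓘(ℝ, EA) ∞ A]
  [TopologicalSpace B] [ChartedSpace EB B] [Group B] [LieGroup 𝓘(ℝ, EB) ∞ B]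
  (D : DoubleLieGroup EG EA EB G A B) (μ₀ : HalfDensity EB) (ν₀ : HalfDensity EA)

/-! ### The function `Q` -/

/-- With `g = a b`, conjugation by `b` stays in `B`, and the rest is the action of `a` on `B` up to
inversions and a left factor in `A`, which `b_R` ignores. -/
theorem jac_bR_conj (g : G) : jac (E := EB) (fun β : B => D.bR (g * D.iB β * g⁻¹)) 1 =
    D.jacA (D.aL g) * absDetAd EB (D.bR g) := by
  have h1 : (fun β : B => D.bR (g * D.iB β * g⁻¹)) =
      fun β => (D.act (D.aL g) ((D.bR g * β * (D.bR g)⁻¹)⁻¹))⁻¹ := by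
    funext β
    have h2 : g * D.iB β * g⁻¹ = (D.iA (D.aL g) * (D.iA (D.aL g) *
        D.iB (D.bR g * β * (D.bR g)⁻¹)⁻¹)⁻¹) := by
      conv_lhs => rw [← D.aL_mul_bR g]
      simp only [map_mul, map_inv]
      group
    rw [h2, bR_iA_mul, bR_inv]
    rfl
  have h2 : jac (E := EB) (fun β : B => (D.bR g * β * (D.bR g)⁻¹)⁻¹) 1 =
      absDetAd EB (D.bR g) := by
    rw [jac_comp (f := fun β : B => D.bR g * β * (D.bR g)⁻¹) (g := fun β => β⁻¹) (y := 1) (by simp)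
      (mdifferentiable_inv _) (fixedPointAction_conj.mdifferentiable _ _), jac_inv, one_mul]
    rfl
  have hd : MDifferentiable 𝓘(ℝ, EB) 𝓘(ℝ, EB) (fun β : B => (D.bR g * β * (D.bR g)⁻¹)⁻¹) :=
    mdifferentiable_inv.comp (fixedPointAction_conj.mdifferentiable (D.bR g))
  have hd' : MDifferentiable 𝓘(ℝ, EB) 𝓘(ℝ, EB) (fun β : B => (D.act (D.aL g) β)⁻¹) :=
    mdifferentiable_inv.comp (D.fixedPointAction_act.mdifferentiable (D.aL g))
  rw [h1, jac_comp (f := fun β : B => (D.bR g * β * (D.bR g)⁻¹)⁻¹)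
    (g := fun β => (D.act (D.aL g) β)⁻¹) (y := 1) (by simp) (hd' _) (hd _), h2,
    jac_comp (f := D.act (D.aL g)) (g := fun β => β⁻¹) (D.act_one_right _)
      (mdifferentiable_inv _) (D.fixedPointAction_act.mdifferentiable _ _), jac_inv, one_mul, jacA]

theorem jac_aL_conj (g : G) : jac (E := EA) (fun α : A => D.aL (g * D.iA α * g⁻¹)) 1 =
    D.jacB (D.bL g) * absDetAd EA (D.aR g) := by
  have h1 : (fun α : A => D.aL (g * D.iA α * g⁻¹)) =
      fun α => D.dualAct (D.bL g) (D.aR g * α * (D.aR g)⁻¹) := by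
    funext α
    have h2 : g * D.iA α * g⁻¹ = D.iB (D.bL g) * D.iA (D.aR g * α * (D.aR g)⁻¹) *
        D.iB (D.bL g)⁻¹ := by
      conv_lhs => rw [← D.bL_mul_aR g]
      simp only [map_mul, map_inv]
      group
    rw [h2, aL_mul_iB]
    rfl
  rw [h1, jac_comp (f := fun α : A => D.aR g * α * (D.aR g)⁻¹) (g := D.dualAct (D.bL g)) (y := 1)
    (by simp) (D.fixedPointAction_dualAct.mdifferentiable _ _)
    (fixedPointAction_conj.mdifferentiable _ _)]
  rfl

theorem smooth_conj (g : G) : MDifferentiable 𝓘(ℝ, EG) 𝓘(ℝ, EG) (fun x : G => g * x * g⁻¹) :=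
  fixedPointAction_conj.mdifferentiable g

theorem PB_Ad_jB (g : G) : D.PB.comp ((Ad g).comp D.jB) =
    tangentAt (fun β : B => D.bR (g * D.iB β * g⁻¹)) 1 := by
  have hB : MDifferentiable 𝓘(ℝ, EB) 𝓘(ℝ, EG) D.iB := D.smooth_iB.mdifferentiable (by simp)
  have hR : MDifferentiable 𝓘(ℝ, EG) 𝓘(ℝ, EB) D.bR := D.contMDiff_bR.mdifferentiable (by simp)
  rw [tangentAt_comp (f := fun β : B => g * D.iB β * g⁻¹) (g := D.bR) (y := (1 : G)) (by simp)
    (hR _) ((smooth_conj g).comp hB _), tangentAt_comp (f := D.iB) (g := fun x => g * x * g⁻¹)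
    (map_one _) (smooth_conj g _) (hB _)]
  rfl

theorem PA_Ad_jA (g : G) : D.PA.comp ((Ad g).comp D.jA) =
    tangentAt (fun α : A => D.aL (g * D.iA α * g⁻¹)) 1 := by
  have hA : MDifferentiable 𝓘(ℝ, EA) 𝓘(ℝ, EG) D.iA := D.smooth_iA.mdifferentiable (by simp)
  have hL : MDifferentiable 𝓘(ℝ, EG) 𝓘(ℝ, EA) D.aL := D.contMDiff_aL.mdifferentiable (by simp)
  rw [tangentAt_comp (f := fun α : A => g * D.iA α * g⁻¹) (g := D.aL) (y := (1 : G)) (by simp)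
    (hL _) ((smooth_conj g).comp hA _), tangentAt_comp (f := D.iA) (g := fun x => g * x * g⁻¹)
    (map_one _) (smooth_conj g _) (hA _)]
  rfl

theorem PB_Ad_jA (g : G) : D.PB.comp ((Ad g).comp D.jA) =
    tangentAt (fun α : A => D.bR (g * D.iA α * g⁻¹)) 1 := by
  have hA : MDifferentiable 𝓘(ℝ, EA) 𝓘(ℝ, EG) D.iA := D.smooth_iA.mdifferentiable (by simp)
  have hR : MDifferentiable 𝓘(ℝ, EG) 𝓘(ℝ, EB) D.bR := D.contMDiff_bR.mdifferentiable (by simp)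
  rw [tangentAt_comp (f := fun α : A => g * D.iA α * g⁻¹) (g := D.bR) (y := (1 : G)) (by simp)
    (hR _) ((smooth_conj g).comp hA _), tangentAt_comp (f := D.iA) (g := fun x => g * x * g⁻¹)
    (map_one _) (smooth_conj g _) (hA _)]
  rfl

theorem PA_Ad_jB (g : G) : D.PA.comp ((Ad g).comp D.jB) =
    tangentAt (fun β : B => D.aL (g * D.iB β * g⁻¹)) 1 := by
  have hB : MDifferentiable 𝓘(ℝ, EB) 𝓘(ℝ, EG) D.iB := D.smooth_iB.mdifferentiable (by simp)
  have hL : MDifferentiable 𝓘(ℝ, EG) 𝓘(ℝ, EA) D.aL := D.contMDiff_aL.mdifferentiable (by simp)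
  rw [tangentAt_comp (f := fun β : B => g * D.iB β * g⁻¹) (g := D.aL) (y := (1 : G)) (by simp)
    (hL _) ((smooth_conj g).comp hB _), tangentAt_comp (f := D.iB) (g := fun x => g * x * g⁻¹)
    (map_one _) (smooth_conj g _) (hB _)]
  rfl

theorem Ad_one : (Ad (1 : G) : EG →L[ℝ] EG) = ContinuousLinearMap.id ℝ EG := by
  have h : (fun x : G => 1 * x * (1 : G)⁻¹) = fun x => x := by
    funext x
    simp
  rw [Ad, h, tangentAt_id]

theorem PA_jA : D.PA.comp D.jA = ContinuousLinearMap.id ℝ EA := by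
  have h := D.PA_Ad_jA 1
  simp only [one_mul, inv_one, mul_one, aL_iA, tangentAt_id] at h
  rw [← h, Ad_one]
  rfl

theorem PB_jB : D.PB.comp D.jB = ContinuousLinearMap.id ℝ EB := by
  have h := D.PB_Ad_jB 1
  simp only [one_mul, inv_one, mul_one, bR_iB, tangentAt_id] at h
  rw [← h, Ad_one]
  rfl

theorem PB_jA : D.PB.comp D.jA = 0 := by
  have h := D.PB_Ad_jA 1
  simp only [one_mul, inv_one, mul_one, bR_iA, tangentAt_const] at h
  rw [← h, Ad_one]
  rfl

theorem PA_jB : D.PA.comp D.jB = 0 := by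
  have h := D.PA_Ad_jB 1
  simp only [one_mul, inv_one, mul_one, aL_iB, tangentAt_const] at h
  rw [← h, Ad_one]
  rfl

/-- The decomposition `T_e A ⊕ T_e B = T_e G`. -/
def tangentSplitting : (EA × EB) ≃ₗ[ℝ] EG :=
  LinearMap.linearEquivOfInjective (D.jA.coprod D.jB : (EA × EB) →ₗ[ℝ] EG) D.coprod_injective
    D.finrank_eq

theorem tangentSplitting_apply (v : EA × EB) : D.tangentSplitting v = D.jA v.1 + D.jB v.2 := rfl

theorem tangentSplitting_symm_apply (x : EG) : D.tangentSplitting.symm x = (D.PA x, D.PB x) := by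
  rw [LinearEquiv.symm_apply_eq]
  obtain ⟨⟨v, w⟩, rfl⟩ := D.tangentSplitting.surjective x
  have h1 := fun v => congrArg (fun L => L v) D.PA_jA
  have h2 := fun v => congrArg (fun L => L v) D.PB_jB
  have h3 := fun v => congrArg (fun L => L v) D.PA_jB
  have h4 := fun v => congrArg (fun L => L v) D.PB_jA
  simp only [ContinuousLinearMap.comp_apply, ContinuousLinearMap.id_apply,
    zero_apply] at h1 h2 h3 h4
  rw [tangentSplitting_apply]
  simp only [map_add, h1, h2, h3, h4, add_zero, zero_add]
  rfl

theorem det_eq_splitting (T : EG →L[ℝ] EG) :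
    T.det = ((D.PA.prod D.PB).comp (T.comp (D.jA.coprod D.jB))).det := by
  have h := LinearMap.det_conj (T : EG →ₗ[ℝ] EG) D.tangentSplitting.symm
  refine h.symm.trans (congrArg LinearMap.det (LinearMap.ext fun v => ?_))
  exact D.tangentSplitting_symm_apply _

theorem det_of_PB_eq_zero (T : EG →L[ℝ] EG) (h : D.PB.comp (T.comp D.jA) = 0) :
    T.det = (D.PA.comp (T.comp D.jA)).det * (D.PB.comp (T.comp D.jB)).det := by
  rw [D.det_eq_splitting T]
  refine ContinuousLinearMap.det_block_upper _ _ _ (D.PA.comp (T.comp D.jB)) fun v w => ?_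
  have h1 : D.PB (T (D.jA v)) = 0 := congrArg (fun L => L v) h
  simp [h1]

theorem det_of_PA_eq_zero (T : EG →L[ℝ] EG) (h : D.PA.comp (T.comp D.jB) = 0) :
    T.det = (D.PA.comp (T.comp D.jA)).det * (D.PB.comp (T.comp D.jB)).det := by
  rw [D.det_eq_splitting T]
  refine ContinuousLinearMap.det_block_lower _ _ _ (D.PB.comp (T.comp D.jA)) fun v w => ?_
  have h1 : D.PA (T (D.jB w)) = 0 := congrArg (fun L => L w) h
  simp [h1]

theorem abs_det_block_A (g : G) : |(D.PA.comp ((Ad g).comp D.jA)).det| =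
    D.jacB (D.bL g) * absDetAd EA (D.aR g) := by
  rw [PA_Ad_jA]
  exact D.jac_aL_conj g

theorem abs_det_block_B (g : G) : |(D.PB.comp ((Ad g).comp D.jB)).det| =
    D.jacA (D.aL g) * absDetAd EB (D.bR g) := by
  rw [PB_Ad_jB]
  exact D.jac_bR_conj g

/-- `Ad(a)` preserves `T_e A`, so it is block triangular. Its diagonal blocks are the adjoint map of
`A` and, up to sign of the determinant, the linearized action on `B`. -/
theorem absDetAd_iA (a : A) : absDetAd EG (D.iA a) = absDetAd EA a * D.jacA a := by
  have h : D.PB.comp ((Ad (D.iA a)).comp D.jA) = 0 := by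
    rw [PB_Ad_jA]
    simp only [← map_mul, ← map_inv, bR_iA, tangentAt_const]
  have h1 := congrArg abs (D.det_of_PB_eq_zero _ h)
  rw [abs_mul, abs_det_block_A, abs_det_block_B, aL_iA, bR_iA, bL_iA, aR_iA] at h1
  refine (h1 : absDetAd EG (D.iA a) = _).trans ?_
  have e1 : D.jacB 1 = 1 := D.fixedPointAction_dualAct.jac_one
  have e2 : absDetAd EB (1 : B) = 1 := fixedPointAction_conj.jac_one
  rw [e1, e2, one_mul, mul_one]

theorem absDetAd_iB (b : B) : absDetAd EG (D.iB b) = D.jacB b * absDetAd EB b := by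
  have h : D.PA.comp ((Ad (D.iB b)).comp D.jB) = 0 := by
    rw [PA_Ad_jB]
    simp only [← map_mul, ← map_inv, aL_iB, tangentAt_const]
  have h1 := congrArg abs (D.det_of_PA_eq_zero _ h)
  rw [abs_mul, abs_det_block_A, abs_det_block_B, aL_iB, bR_iB, bL_iB, aR_iB] at h1
  refine (h1 : absDetAd EG (D.iB b) = _).trans ?_
  have e1 : D.jacA 1 = 1 := D.fixedPointAction_act.jac_one
  have e2 : absDetAd EA (1 : A) = 1 := fixedPointAction_conj.jac_one
  rw [e1, e2, one_mul, mul_one]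

theorem abs_Q (g : G) : |D.Q g| = absDetAd EG g /
    (D.jacB (D.bL g) * absDetAd EA (D.aR g) * (D.jacA (D.aL g) * absDetAd EB (D.bR g))) := by
  rw [Q, abs_div, abs_mul, abs_det_block_A, abs_det_block_B]
  rfl

/-- The factorizations `g = a_L b_R` and `g = b_L a_R` give two expressions for `|det Ad(g)|`, hence
two for `|Q|`. This one matches the shape of `σ²`; the next one serves the computation of `κ`. -/
theorem abs_Q_eq (g : G) : |D.Q g| = absDetAd EA (D.aL g) * D.jacB (D.bR g) /
    (D.jacB (D.bL g) * absDetAd EA (D.aR g)) := by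
  have h : absDetAd EG g = absDetAd EG (D.iA (D.aL g)) * absDetAd EG (D.iB (D.bR g)) := by
    rw [← absDetAd_mul, aL_mul_bR]
  rw [abs_Q, h, absDetAd_iA, absDetAd_iB]
  have := (D.jacA_pos (D.aL g)).ne'
  have := (D.jacB_pos (D.bL g)).ne'
  have := (absDetAd_pos (E := EB) (D.bR g)).ne'
  have := (absDetAd_pos (E := EA) (D.aR g)).ne'
  field_simp

theorem abs_Q_eq' (g : G) : |D.Q g| = absDetAd EB (D.bL g) * D.jacA (D.aR g) /
    (D.jacA (D.aL g) * absDetAd EB (D.bR g)) := by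
  have h : absDetAd EG g = absDetAd EG (D.iB (D.bL g)) * absDetAd EG (D.iA (D.aR g)) := by
    rw [← absDetAd_mul, bL_mul_aR]
  rw [abs_Q, h, absDetAd_iA, absDetAd_iB]
  have := (D.jacA_pos (D.aL g)).ne'
  have := (D.jacB_pos (D.bL g)).ne'
  have := (absDetAd_pos (E := EB) (D.bR g)).ne'
  have := (absDetAd_pos (E := EA) (D.aR g)).ne'
  field_simp

/-! ### The modular function -/

theorem leftVal_eq (g : G) : D.leftVal μ₀ ν₀ g = Real.sqrt (D.jacA (D.aR g)) *
    μ₀.toFun (stdFrame EB) * (Real.sqrt (absDetAd EA (D.aL g) * D.jacB (D.bR g)) *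
      ν₀.toFun (stdFrame EA)) := by
  have h1 : (fun α : A => D.aL (g * D.iA α) * (D.aL g)⁻¹) =
      fun α => D.aL g * D.dualAct (D.bR g) α * (D.aL g)⁻¹ := by
    funext α
    conv_lhs => rw [← D.aL_mul_bR g, mul_assoc, aL_iA_mul, aL_iA_mul_iB]
    rfl
  have h2 : jac (E := EA) (fun α : A => D.aL g * D.dualAct (D.bR g) α * (D.aL g)⁻¹) 1 =
      absDetAd EA (D.aL g) * D.jacB (D.bR g) :=
    jac_comp (f := D.dualAct (D.bR g)) (g := fun α : A => D.aL g * α * (D.aL g)⁻¹)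
      (D.fixedPointAction_dualAct.fix _) (fixedPointAction_conj.mdifferentiable _ _)
      (D.fixedPointAction_dualAct.mdifferentiable _ _)
  have h3 := ν₀.map_tangentAt (fun α : A => D.aL (g * D.iA α) * (D.aL g)⁻¹) 1 (stdFrame EA)
  rw [h1, h2, ← h1] at h3
  rw [leftVal, lamTilde_eq, ← h3]
  rfl

theorem rightVal_eq (g : G) : D.rightVal μ₀ ν₀ g = μ₀.toFun (stdFrame EB) *
    (Real.sqrt (absDetAd EA (D.aR g)) * ν₀.toFun (stdFrame EA)) := by
  have h1 : (fun α : A => D.aR (g * D.iA α) * (D.aR g)⁻¹) =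
      fun α => D.aR g * α * (D.aR g)⁻¹ := by
    funext α
    rw [aR_mul_iA]
  have h3 := ν₀.map_tangentAt (fun α : A => D.aR g * α * (D.aR g)⁻¹) 1 (stdFrame EA)
  rw [rightVal, rhoTilde, absDetAd, ← h3, ← h1]
  rfl

/-- At `β = e` the map is `α ↦ (e, α)`, so the derivative is triangular with one block the identity.
The other block is the `B`-block of conjugation by `g⁻¹`. -/
theorem abs_det_frameChange (g : G) : |(D.frameChange g).det| =
    (D.jacA (D.aR g) * absDetAd EB (D.bL g))⁻¹ := by
  have hm : ContMDiff (𝓘(ℝ, EB).prod 𝓘(ℝ, EA)) 𝓘(ℝ, EG) ∞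
      fun p : B × A => g⁻¹ * (D.iB p.1 * g * D.iA p.2) :=
    contMDiff_const.mul (((D.smooth_iB.comp contMDiff_fst).mul contMDiff_const).mul
      (D.smooth_iA.comp contMDiff_snd))
  have h := mjac_of_fst_const (I := 𝓘(ℝ, EB)) (J := 𝓘(ℝ, EA)) (x := (1 : B)) (y := (1 : A))
    ((D.contMDiff_bR.comp hm).mdifferentiable (by simp) _)
    ((D.contMDiff_aL.comp hm).mdifferentiable (by simp) _) (by intro z; simp)
  refine (h : |(D.frameChange g).det| = _).trans ?_
  have h1 : (fun α : A => D.aL (g⁻¹ * (D.iB (1 : B) * g * D.iA α))) = fun α => α := by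
    funext α
    simp
  have h2 : (fun β : B => D.bR (g⁻¹ * (D.iB β * g * D.iA (1 : A)))) =
      fun β => D.bR (g⁻¹ * D.iB β * (g⁻¹)⁻¹) := by
    funext β
    rw [map_one, mul_one, inv_inv, mul_assoc]
  have h3 : mjac 𝓘(ℝ, EB) (fun β : B => D.bR (g⁻¹ * D.iB β * (g⁻¹)⁻¹)) 1 = _ := D.jac_bR_conj g⁻¹
  simp only [Function.comp_def]
  rw [h1, h2, mjac_id, mul_one, h3, aL_inv, bR_inv, jacA_inv, absDetAd_inv, mul_inv]

theorem modularFunction_eq (hμ₀ : ∃ v, μ₀.toFun v ≠ 0) (hν₀ : ∃ v, ν₀.toFun v ≠ 0) (g : G) :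
    D.modularFunction μ₀ ν₀ g = Real.sqrt (absDetAd EA (D.aL g) * D.jacB (D.bR g) /
      (absDetAd EA (D.aR g) * absDetAd EB (D.bL g))) := by
  have hc := HalfDensity.stdFrame_ne_zero hμ₀
  have hn := HalfDensity.stdFrame_ne_zero hν₀
  rw [modularFunction, leftVal_eq, rightVal_eq, abs_det_frameChange]
  have p1 := D.jacA_pos (D.aR g)
  have p2 := absDetAd_pos (E := EA) (D.aL g)
  have p3 := D.jacB_pos (D.bR g)
  have p4 := absDetAd_pos (E := EA) (D.aR g)
  have p5 := absDetAd_pos (E := EB) (D.bL g)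
  rw [Real.sqrt_inv, Real.sqrt_div (by positivity), Real.sqrt_mul p1.le, Real.sqrt_mul p4.le]
  have q1 := (Real.sqrt_pos.2 p1).ne'
  have q4 := (Real.sqrt_pos.2 p4).ne'
  have q5 := (Real.sqrt_pos.2 p5).ne'
  field_simp

end Formulas

end DoubleLieGroup

/-! ### Translations of invariant measures. -/

section GroupMeasures

variable {E M : Type*} [NormedAddCommGroup E] [NormedSpace ℝ E] [FiniteDimensional ℝ E]
  [MeasurableSpace E] [BorelSpace E]
  [TopologicalSpace M] [ChartedSpace E M] [Group M] [LieGroup 𝓘(ℝ, E) ∞ M]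
  [MeasurableSpace M] [BorelSpace M]

theorem movingTrivialization_left :
    MovingTrivialization (E := E) (fun g x : M => g⁻¹ * x) (fun g β => g * β) 1 where
  smooth := contMDiff_fst.inv.mul contMDiff_snd
  smooth_inv _ := contMDiff_const.mul contMDiff_id
  base _ := inv_mul_cancel _
  left_inv _ _ := mul_inv_cancel_left _ _

theorem movingTrivialization_right :
    MovingTrivialization (E := E) (fun g x : M => x * g⁻¹) (fun g β => β * g) 1 where
  smooth := contMDiff_snd.mul contMDiff_fst.inv
  smooth_inv _ := contMDiff_id.mul contMDiff_const
  base _ := mul_inv_cancel _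
  left_inv _ _ := inv_mul_cancel_right _ _

variable {μ₀ : HalfDensity E}

theorem isLocallyFiniteMeasure_leftMeasure (hμ₀ : ∃ v, μ₀.toFun v ≠ 0) :
    IsLocallyFiniteMeasure (leftMeasure μ₀ : Measure M) :=
  isLocallyFiniteMeasure_densityMeasure (movingTrivialization_left.isDensity μ₀ hμ₀)

theorem isOpenPosMeasure_leftMeasure (hμ₀ : ∃ v, μ₀.toFun v ≠ 0) :
    (leftMeasure μ₀ : Measure M).IsOpenPosMeasure :=
  isOpenPosMeasure_densityMeasure (movingTrivialization_left.isDensity μ₀ hμ₀)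

theorem integral_leftMeasure_mul_left [SecondCountableTopology M]
    (hμ₀ : ∃ v, μ₀.toFun v ≠ 0) (g : M) (φ : M → ℂ) :
    ∫ x, φ (g * x) ∂(leftMeasure μ₀) = ∫ x, φ x ∂(leftMeasure μ₀) := by
  have : IsTopologicalGroup M := topologicalGroup_of_lieGroup 𝓘(ℝ, E) ∞
  have h := movingTrivialization_left.integral_comp_mul μ₀ hμ₀ (Homeomorph.mulLeft g)
    (contMDiff_const.mul contMDiff_id) (J := fun _ => 1) continuous_const (fun _ => one_pos)
    (fun x => ?_) φ
  · simp only [Complex.ofReal_one, one_mul] at h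
    exact h
  · have h1 : (fun β => ((Homeomorph.mulLeft g x)⁻¹ * Homeomorph.mulLeft g (x * β))) =
        fun β : M => β := by
      funext β
      simp only [Homeomorph.coe_mulLeft]
      group
    rw [h1]
    exact jac_id 1

/-- In left trivializations the tangent map of right translation by `g` is `Ad(g⁻¹)` at every point,
so the Jacobian is constant. -/
theorem integral_leftMeasure_mul_right [SecondCountableTopology M]
    (hμ₀ : ∃ v, μ₀.toFun v ≠ 0) (g : M) (φ : M → ℂ) :
    ∫ x, φ (x * g) ∂(leftMeasure μ₀) = absDetAd E g * ∫ x, φ x ∂(leftMeasure μ₀) := by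
  have : IsTopologicalGroup M := topologicalGroup_of_lieGroup 𝓘(ℝ, E) ∞
  have h := movingTrivialization_left.integral_comp_mul μ₀ hμ₀ (Homeomorph.mulRight g)
    (contMDiff_id.mul contMDiff_const) (J := fun _ => (absDetAd E g)⁻¹) continuous_const
    (fun _ => inv_pos.2 (DoubleLieGroup.absDetAd_pos g)) (fun x => ?_) φ
  · refine Eq.trans ?_ (congrArg (fun t => (absDetAd E g : ℂ) * t) h)
    rw [integral_const_mul, ← mul_assoc,
      ← Complex.ofReal_mul, mul_inv_cancel₀ (DoubleLieGroup.absDetAd_pos g).ne',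
      Complex.ofReal_one, one_mul]
    rfl
  · have h1 : (fun β => ((Homeomorph.mulRight g x)⁻¹ * Homeomorph.mulRight g (x * β))) =
        fun β : M => g⁻¹ * β * (g⁻¹)⁻¹ := by
      funext β
      simp only [Homeomorph.coe_mulRight]
      group
    rw [h1, ← DoubleLieGroup.absDetAd_inv]
    rfl

theorem integral_rightMeasure_mul_right [SecondCountableTopology M]
    (hμ₀ : ∃ v, μ₀.toFun v ≠ 0) (g : M) (φ : M → ℂ) :
    ∫ x, φ (x * g) ∂(rightMeasure μ₀) = ∫ x, φ x ∂(rightMeasure μ₀) := by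
  have : IsTopologicalGroup M := topologicalGroup_of_lieGroup 𝓘(ℝ, E) ∞
  have h := movingTrivialization_right.integral_comp_mul μ₀ hμ₀ (Homeomorph.mulRight g)
    (contMDiff_id.mul contMDiff_const) (J := fun _ => 1) continuous_const (fun _ => one_pos)
    (fun x => ?_) φ
  · simp only [Complex.ofReal_one, one_mul] at h
    exact h
  · have h1 : (fun β => (Homeomorph.mulRight g (β * x) * (Homeomorph.mulRight g x)⁻¹)) =
        fun β : M => β := by
      funext β
      simp only [Homeomorph.coe_mulRight]
      group
    rw [h1]
    exact jac_id 1

end GroupMeasures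

namespace DoubleLieGroup

/-! ### The action of `A` on `B` and Haar measure on `B`. -/

section Action

variable {EG EA EB : Type*}
  [NormedAddCommGroup EG] [NormedSpace ℝ EG] [FiniteDimensional ℝ EG]
  [NormedAddCommGroup EA] [NormedSpace ℝ EA] [FiniteDimensional ℝ EA]
  [NormedAddCommGroup EB] [NormedSpace ℝ EB] [FiniteDimensional ℝ EB]
  [MeasurableSpace EB] [BorelSpace EB]
  {G A B : Type*}
  [TopologicalSpace G] [ChartedSpace EG G] [Group G] [LieGroup 𝓘(ℝ, EG) ∞ G]
  [T2Space G] [SecondCountableTopology G]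
  [TopologicalSpace A] [ChartedSpace EA A] [Group A] [LieGroup 𝓘(ℝ, EA) ∞ A]
  [TopologicalSpace B] [ChartedSpace EB B] [Group B] [LieGroup 𝓘(ℝ, EB) ∞ B]
  [MeasurableSpace B] [BorelSpace B]
  (D : DoubleLieGroup EG EA EB G A B) {μ₀ : HalfDensity EB}

theorem smooth_act_left (a : A) : ContMDiff 𝓘(ℝ, EB) 𝓘(ℝ, EB) ∞ (D.act a) :=
  D.smooth_act.comp (contMDiff_const.prodMk contMDiff_id)

/-- The action of an element of `A` as a homeomorphism of `B`. -/
def actHomeomorph (a : A) : B ≃ₜ B where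
  toFun := D.act a
  invFun := D.act a⁻¹
  left_inv b := D.act_inv_act a b
  right_inv b := D.act_act_inv a b
  continuous_toFun := (D.smooth_act_left a).continuous
  continuous_invFun := (D.smooth_act_left a⁻¹).continuous

/-- The action of `a` is not by automorphisms, but `act a (x β) = act a x · act (coact a x) β`. In
left trivializations its derivative at `x` is thus the derivative at the identity of the action of
`coact a x`. -/
theorem integral_act (hμ₀ : ∃ v, μ₀.toFun v ≠ 0) (a : A) (φ : B → ℂ) :
    ∫ b, (D.jacA (D.coact a b) : ℂ) * φ (D.act a b) ∂(leftMeasure μ₀) =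
      ∫ b, φ b ∂(leftMeasure μ₀) := by
  have := D.secondCountable_B
  refine movingTrivialization_left.integral_comp_mul μ₀ hμ₀ (D.actHomeomorph a)
    (D.smooth_act_left a) (J := fun b => D.jacA (D.coact a b)) ?_ (fun _ => D.jacA_pos _)
    (fun x => ?_) φ
  · exact D.contMDiff_jacA.continuous.comp
      (D.smooth_coact.comp (contMDiff_const.prodMk contMDiff_id)).continuous
  · have h1 : (fun β => (D.actHomeomorph a x)⁻¹ * D.actHomeomorph a (x * β)) =
        D.act (D.coact a x) := by
      funext β
      change (D.act a x)⁻¹ * D.act a (x * β) = _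
      rw [act_mul_right, inv_mul_cancel_left]
    rw [h1]
    rfl

end Action

end DoubleLieGroup

/-! ### Smooth compactly supported functions. -/

section TestFunctions

variable {E H : Type*} [NormedAddCommGroup E] [NormedSpace ℝ E] [TopologicalSpace H]
  {I : ModelWithCorners ℝ E H} {M : Type*} [TopologicalSpace M] [ChartedSpace H M]

theorem ContMDiff.complex_mul {f g : M → ℂ} (hf : ContMDiff I 𝓘(ℝ, ℂ) ∞ f)
    (hg : ContMDiff I 𝓘(ℝ, ℂ) ∞ g) : ContMDiff I 𝓘(ℝ, ℂ) ∞ fun x => f x * g x :=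
  (contDiff_mul (𝕜 := ℝ) (𝔸 := ℂ)).comp_contMDiff (hf.prodMk_space hg)

theorem ContMDiff.complex_ofReal {f : M → ℝ} (hf : ContMDiff I 𝓘(ℝ, ℝ) ∞ f) :
    ContMDiff I 𝓘(ℝ, ℂ) ∞ fun x => (f x : ℂ) :=
  Complex.ofRealCLM.contDiff.comp_contMDiff hf

theorem ContMDiff.complex_conj {f : M → ℂ} (hf : ContMDiff I 𝓘(ℝ, ℂ) ∞ f) :
    ContMDiff I 𝓘(ℝ, ℂ) ∞ fun x => (starRingEnd ℂ) (f x) :=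
  Complex.conjCLE.contDiff.comp_contMDiff hf

theorem ContMDiff.sqrt_of_pos {f : M → ℝ} (hf : ContMDiff I 𝓘(ℝ, ℝ) ∞ f) (h : ∀ x, 0 < f x) :
    ContMDiff I 𝓘(ℝ, ℝ) ∞ fun x => Real.sqrt (f x) := fun x =>
  (Real.contDiffAt_sqrt (h x).ne').comp_contMDiffAt (hf x)

theorem ContMDiff.inv_of_pos {f : M → ℝ} (hf : ContMDiff I 𝓘(ℝ, ℝ) ∞ f) (h : ∀ x, 0 < f x) :
    ContMDiff I 𝓘(ℝ, ℝ) ∞ fun x => (f x)⁻¹ := fun x =>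
  (contDiffAt_inv ℝ (h x).ne').comp_contMDiffAt (hf x)

/-- Smooth compactly supported complex functions. -/
def IsTestFunction (I : ModelWithCorners ℝ E H) (f : M → ℂ) : Prop :=
  ContMDiff I 𝓘(ℝ, ℂ) ∞ f ∧ HasCompactSupport f

theorem IsTestFunction.mul_left {f g : M → ℂ} (hf : IsTestFunction I f)
    (hg : ContMDiff I 𝓘(ℝ, ℂ) ∞ g) : IsTestFunction I fun x => g x * f x :=
  ⟨hg.complex_mul hf.1, hf.2.mul_left⟩

end TestFunctions

namespace DoubleLieGroup

/-! ### Bidensities and their coefficients relative to `ω₀`; the involution. -/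

section Coefficients

variable {EG EA EB : Type*}
  [NormedAddCommGroup EG] [NormedSpace ℝ EG] [FiniteDimensional ℝ EG]
  [NormedAddCommGroup EA] [NormedSpace ℝ EA] [FiniteDimensional ℝ EA]
  [NormedAddCommGroup EB] [NormedSpace ℝ EB] [FiniteDimensional ℝ EB]
  {G A B : Type*}
  [TopologicalSpace G] [ChartedSpace EG G] [Group G] [LieGroup 𝓘(ℝ, EG) ∞ G]
  [T2Space G] [SecondCountableTopology G]
  [TopologicalSpace A] [ChartedSpace EA A] [Group A] [LieGroup 𝓘(ℝ, EA) ∞ A]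
  [TopologicalSpace B] [ChartedSpace EB B] [Group B] [LieGroup 𝓘(ℝ, EB) ∞ B]
  (D : DoubleLieGroup EG EA EB G A B) (μ₀ : HalfDensity EB)

/-! ### Coefficients of bidensities -/

/-- The factor of `ρ₀` relative to the right-invariant half-density. -/
def rhoFactor (g : G) : ℝ := Real.sqrt (D.jacA (D.aL g))⁻¹

theorem rhoFactor_pos (g : G) : 0 < D.rhoFactor g :=
  Real.sqrt_pos.2 (inv_pos.2 (D.jacA_pos _))

theorem contMDiff_rhoFactor : ContMDiff 𝓘(ℝ, EG) 𝓘(ℝ, ℝ) ∞ D.rhoFactor :=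
  ((D.contMDiff_jacA.comp D.contMDiff_aL).inv_of_pos fun _ => D.jacA_pos _).sqrt_of_pos
    fun _ => inv_pos.2 (D.jacA_pos _)

theorem omega₀_eq_rhoFactor (g : G) (v w : Frame EB) :
    D.omega₀ μ₀ g v w = D.rhoFactor g * (μ₀.toFun v * μ₀.toFun w) := D.omega₀_eq μ₀ g v w

theorem omega₀_ne_zero (hμ₀ : ∃ v, μ₀.toFun v ≠ 0) (g : G) :
    D.omega₀ μ₀ g (stdFrame EB) (stdFrame EB) ≠ 0 := by
  have hc := HalfDensity.stdFrame_ne_zero hμ₀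
  rw [omega₀_eq_rhoFactor]
  exact mul_ne_zero (D.rhoFactor_pos g).ne' (mul_ne_zero hc hc)

variable {μ₀}

theorem coeff_ofCoeff (hμ₀ : ∃ v, μ₀.toFun v ≠ 0) (f : G → ℂ) :
    D.coeff μ₀ (D.ofCoeff μ₀ f) = f := by
  funext g
  exact mul_div_cancel_right₀ _ (Complex.ofReal_ne_zero.2 (D.omega₀_ne_zero μ₀ hμ₀ g))

theorem coeff₂_ofCoeff₂ (hμ₀ : ∃ v, μ₀.toFun v ≠ 0) (F : G × G → ℂ) :
    D.coeff₂ μ₀ (D.ofCoeff₂ μ₀ F) = F := by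
  funext p
  exact mul_div_cancel_right₀ _ (Complex.ofReal_ne_zero.2
    (mul_ne_zero (D.omega₀_ne_zero μ₀ hμ₀ p.1) (D.omega₀_ne_zero μ₀ hμ₀ p.2)))

theorem omega₀_mulMatrix_left (g : G) (v w : Frame EB)
    (M : Matrix (Fin (Module.finrank ℝ EB)) (Fin (Module.finrank ℝ EB)) ℝ) :
    D.omega₀ μ₀ g (v.mulMatrix M) w = Real.sqrt |M.det| * D.omega₀ μ₀ g v w := by
  rw [omega₀_eq, omega₀_eq, μ₀.map_mulMatrix]
  ring

theorem omega₀_mulMatrix_right (g : G) (v w : Frame EB)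
    (M : Matrix (Fin (Module.finrank ℝ EB)) (Fin (Module.finrank ℝ EB)) ℝ) :
    D.omega₀ μ₀ g v (w.mulMatrix M) = Real.sqrt |M.det| * D.omega₀ μ₀ g v w := by
  rw [omega₀_eq, omega₀_eq, μ₀.map_mulMatrix]
  ring

theorem ofCoeff_coeff (hμ₀ : ∃ v, μ₀.toFun v ≠ 0) {η : Sec EB G} (hη : IsBidensity EG η) :
    D.ofCoeff μ₀ (D.coeff μ₀ η) = η := by
  funext g v w
  have h0 := Complex.ofReal_ne_zero.2 (D.omega₀_ne_zero μ₀ hμ₀ g)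
  rw [Frame.eq_stdFrame_mulMatrix v, Frame.eq_stdFrame_mulMatrix w, hη.map_left, hη.map_right,
    ofCoeff, coeff, omega₀_mulMatrix_left, omega₀_mulMatrix_right]
  push_cast
  field_simp

theorem ofCoeff₂_coeff₂ (hμ₀ : ∃ v, μ₀.toFun v ≠ 0) {Ω : Sec₂ EB G} (hΩ : IsBidensity₂ EG Ω) :
    D.ofCoeff₂ μ₀ (D.coeff₂ μ₀ Ω) = Ω := by
  funext p v₁ w₁ v₂ w₂
  have h1 := Complex.ofReal_ne_zero.2 (D.omega₀_ne_zero μ₀ hμ₀ p.1)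
  have h2 := Complex.ofReal_ne_zero.2 (D.omega₀_ne_zero μ₀ hμ₀ p.2)
  rw [Frame.eq_stdFrame_mulMatrix v₁, Frame.eq_stdFrame_mulMatrix w₁,
    Frame.eq_stdFrame_mulMatrix v₂, Frame.eq_stdFrame_mulMatrix w₂, hΩ.map_left₁, hΩ.map_right₁,
    hΩ.map_left₂, hΩ.map_right₂, ofCoeff₂, coeff₂, omega₀_mulMatrix_left, omega₀_mulMatrix_right,
    omega₀_mulMatrix_left, omega₀_mulMatrix_right]
  push_cast
  field_simp

theorem contMDiff_omega₀ (v w : Frame EB) :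
    ContMDiff 𝓘(ℝ, EG) 𝓘(ℝ, ℂ) ∞ fun g => (D.omega₀ μ₀ g v w : ℂ) := by
  simp only [omega₀_eq_rhoFactor]
  push_cast
  exact D.contMDiff_rhoFactor.complex_ofReal.complex_mul contMDiff_const

theorem contMDiff_omega₀_inv : ContMDiff 𝓘(ℝ, EG) 𝓘(ℝ, ℂ) ∞
    fun g => ((D.omega₀ μ₀ g (stdFrame EB) (stdFrame EB) : ℂ))⁻¹ := by
  simp only [omega₀_eq_rhoFactor, ← Complex.ofReal_inv, mul_inv]
  push_cast
  simp only [← Complex.ofReal_inv]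
  exact (D.contMDiff_rhoFactor.inv_of_pos D.rhoFactor_pos).complex_ofReal.complex_mul
    contMDiff_const

theorem isTestFunction_coeff {η : Sec EB G} (hη : IsBidensity EG η) :
    IsTestFunction 𝓘(ℝ, EG) (D.coeff μ₀ η) := by
  have h : D.coeff μ₀ η = fun g => ((D.omega₀ μ₀ g (stdFrame EB) (stdFrame EB) : ℂ))⁻¹ *
      η g (stdFrame EB) (stdFrame EB) := by
    funext g
    rw [coeff, div_eq_inv_mul]
  rw [h]
  refine IsTestFunction.mul_left ⟨hη.smooth _ _, ?_⟩ (D.contMDiff_omega₀_inv (μ₀ := μ₀))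
  exact hη.compact.comp_left (g := fun u : Frame EB → Frame EB → ℂ => u (stdFrame EB) (stdFrame EB))
    rfl

theorem isTestFunction_coeff₂ {Ω : Sec₂ EB G}
    (hΩ : IsBidensity₂ EG Ω) :
    IsTestFunction (𝓘(ℝ, EG).prod 𝓘(ℝ, EG)) (D.coeff₂ μ₀ Ω) := by
  have h : D.coeff₂ μ₀ Ω = fun p => (((D.omega₀ μ₀ p.1 (stdFrame EB) (stdFrame EB) : ℂ))⁻¹ *
      ((D.omega₀ μ₀ p.2 (stdFrame EB) (stdFrame EB) : ℂ))⁻¹) *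
      Ω p (stdFrame EB) (stdFrame EB) (stdFrame EB) (stdFrame EB) := by
    funext p
    rw [coeff₂, div_eq_inv_mul, Complex.ofReal_mul, mul_inv]
  rw [h]
  refine IsTestFunction.mul_left ⟨hΩ.smooth _ _ _ _, ?_⟩
    (((D.contMDiff_omega₀_inv (μ₀ := μ₀)).comp contMDiff_fst).complex_mul
      ((D.contMDiff_omega₀_inv (μ₀ := μ₀)).comp contMDiff_snd))
  exact hΩ.compact.comp_left (g := fun u : Frame EB → Frame EB → Frame EB → Frame EB → ℂ =>
    u (stdFrame EB) (stdFrame EB) (stdFrame EB) (stdFrame EB)) rfl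

theorem isBidensity₂_ofCoeff₂ {F : G × G → ℂ}
    (hF : IsTestFunction (𝓘(ℝ, EG).prod 𝓘(ℝ, EG)) F) : IsBidensity₂ EG (D.ofCoeff₂ μ₀ F) where
  map_left₁ p v₁ w₁ v₂ w₂ M := by
    simp only [ofCoeff₂, omega₀_mulMatrix_left]
    push_cast
    ring
  map_right₁ p v₁ w₁ v₂ w₂ M := by
    simp only [ofCoeff₂, omega₀_mulMatrix_right]
    push_cast
    ring
  map_left₂ p v₁ w₁ v₂ w₂ M := by
    simp only [ofCoeff₂, omega₀_mulMatrix_left]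
    push_cast
    ring
  map_right₂ p v₁ w₁ v₂ w₂ M := by
    simp only [ofCoeff₂, omega₀_mulMatrix_right]
    push_cast
    ring
  smooth v₁ w₁ v₂ w₂ := by
    simp only [ofCoeff₂, Complex.ofReal_mul]
    exact hF.1.complex_mul (((D.contMDiff_omega₀ v₁ w₁).comp contMDiff_fst).complex_mul
      ((D.contMDiff_omega₀ v₂ w₂).comp contMDiff_snd))
  compact := hF.2.mono fun p hp hF0 => hp (by
    funext v₁ w₁ v₂ w₂
    simp only [ofCoeff₂, hF0, zero_mul]
    rfl)

/-! ### The involution -/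

theorem contMDiff_sA : ContMDiff 𝓘(ℝ, EG) 𝓘(ℝ, EG) ∞ D.sA :=
  (D.smooth_iA.comp D.contMDiff_aR).mul (D.smooth_iB.comp D.contMDiff_bR).inv

theorem continuous_sA : Continuous D.sA := D.contMDiff_sA.continuous

/-- The tangent map of `s` exchanges the two legs, and homogeneity replaces it by the square roots
of its two Jacobians. In this form smoothness in `g` is visible. -/
theorem star_apply {η : Sec EB G} (hη : IsBidensity EG η) (g : G) (v w : Frame EB) :
    D.star η g v w = (D.rhoFactor g : ℂ) * Real.sqrt (D.jacA (D.aR g)) *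
      (starRingEnd ℂ) (η (D.sA g) w v) := by
  have h1 := Frame.homogeneous_map (fun t => ((Real.sqrt |t| : ℝ) : ℂ))
    (fun v' => η (D.sA g) v' (fun i => D.leftToRight D.sA g (v i)))
    (fun v' M => hη.map_left _ v' _ M) (D.rightToLeft D.sA g) w
  have h2 := Frame.homogeneous_map (fun t => ((Real.sqrt |t| : ℝ) : ℂ))
    (fun v' => η (D.sA g) w v') (fun v' M => hη.map_right _ _ v' M) (D.leftToRight D.sA g) v
  simp only [abs_det_rightToLeft_sA, abs_det_leftToRight_sA] at h1 h2
  rw [star, h1, h2]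
  simp only [map_mul, Complex.conj_ofReal, rhoFactor]
  ring

theorem isBidensity_star {η : Sec EB G} (hη : IsBidensity EG η) : IsBidensity EG (D.star η) where
  map_left g v w M := by
    rw [D.star_apply hη, D.star_apply hη, hη.map_right, map_mul, Complex.conj_ofReal]
    ring
  map_right g v w M := by
    rw [D.star_apply hη, D.star_apply hη, hη.map_left, map_mul, Complex.conj_ofReal]
    ring
  smooth v w := by
    simp only [D.star_apply hη]
    exact (D.contMDiff_rhoFactor.complex_ofReal.complex_mul
      ((D.contMDiff_jacA.comp D.contMDiff_aR).sqrt_of_pos fun _ => D.jacA_pos _).complex_ofReal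
      ).complex_mul (((hη.smooth w v).comp D.contMDiff_sA).complex_conj)
  compact := by
    refine HasCompactSupport.intro (hη.compact.isCompact.image D.continuous_sA) fun g hg => ?_
    have h0 : η (D.sA g) = 0 := by
      by_contra h
      exact hg ⟨D.sA g, subset_tsupport _ h, D.sA_sA g⟩
    funext v w
    rw [D.star_apply hη, h0]
    simp

end Coefficients

end DoubleLieGroup

namespace DoubleLieGroup

/-! ### Multiplicativity of `σ²` and `|Q|`; the operators as integrals over `B`. -/

section Products

variable {EG EA EB : Type*}
  [NormedAddCommGroup EG] [NormedSpace ℝ EG] [FiniteDimensional ℝ EG]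
  [NormedAddCommGroup EA] [NormedSpace ℝ EA] [FiniteDimensional ℝ EA]
  [NormedAddCommGroup EB] [NormedSpace ℝ EB] [FiniteDimensional ℝ EB]
  [MeasurableSpace EB] [BorelSpace EB]
  {G A B : Type*}
  [TopologicalSpace G] [ChartedSpace EG G] [Group G] [LieGroup 𝓘(ℝ, EG) ∞ G]
  [T2Space G] [SecondCountableTopology G]
  [TopologicalSpace A] [ChartedSpace EA A] [Group A] [LieGroup 𝓘(ℝ, EA) ∞ A]
  [TopologicalSpace B] [ChartedSpace EB B] [Group B] [LieGroup 𝓘(ℝ, EB) ∞ B]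
  [MeasurableSpace B] [BorelSpace B]
  (D : DoubleLieGroup EG EA EB G A B) {μ₀ : HalfDensity EB} {ν₀ : HalfDensity EA}

/-! ### The groupoid structure -/

theorem aL_mulA {x y : G} (h : D.aR x = D.aL y) : D.aL (D.mulA x y) = D.aL x := by
  have h1 : D.mulA x y = x * D.iB (D.bR y) := by
    conv_lhs => rw [mulA, h, ← D.aL_mul_bR y]
    rw [aL_mul_bR]
    conv_lhs => rw [← D.aL_mul_bR y, aL_iA_mul_iB]
    group
  rw [h1, aL_mul_iB]

theorem bR_mulA {x y : G} (h : D.aR x = D.aL y) : D.bR (D.mulA x y) = D.bR x * D.bR y := by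
  have h1 : D.mulA x y = x * D.iB (D.bR y) := by
    conv_lhs => rw [mulA, h, ← D.aL_mul_bR y]
    rw [aL_mul_bR]
    conv_lhs => rw [← D.aL_mul_bR y, aL_iA_mul_iB]
    group
  rw [h1, bR_mul_iB]

theorem bL_mulA (x y : G) : D.bL (D.mulA x y) = D.bL x * D.bL y := by
  rw [mulA_eq, bL_iB_mul]

theorem aR_mulA (x y : G) : D.aR (D.mulA x y) = D.aR y := by
  rw [mulA_eq, aR_iB_mul]

/-- The element on the left is `s(u) z` for `u = a_L(z) b`, and its left projection is `a_R(u)`.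
Together with `mulA_act_inv_mul` this is the groupoid factorization `z = u · (s(u) z)`. -/
theorem aL_act_inv_mul (b : B) (z : G) :
    D.aL ((D.iB (D.act (D.aL z) b))⁻¹ * z) = D.coact (D.aL z) b := by
  have h : (D.iB (D.act (D.aL z) b))⁻¹ * z =
      D.iA (D.coact (D.aL z) b) * D.iB (b⁻¹ * D.bR z) := by
    have h1 := D.act_mul_coact (D.aL z) b
    rw [inv_mul_eq_iff_eq_mul, ← mul_assoc, h1, map_mul, map_inv, mul_assoc,
      mul_inv_cancel_left, aL_mul_bR]
  rw [h, aL_iA_mul_iB]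

theorem mulA_sA_mul (b : B) (z : G) :
    D.mulA (D.sA (D.iA (D.aL z) * D.iB b)) z = (D.iB (D.act (D.aL z) b))⁻¹ * z :=
  D.mulA_sA _ _

theorem mulA_act_inv_mul (b : B) (z : G) :
    D.mulA (D.iA (D.aL z) * D.iB b) ((D.iB (D.act (D.aL z) b))⁻¹ * z) = z := by
  rw [mulA_eq]
  exact mul_inv_cancel_left _ _

/-! ### The modular function and the scaling group -/

/-- The square of the modular function. -/
def modularSq (g : G) : ℝ := absDetAd EA (D.aL g) * D.jacB (D.bR g) /
  (absDetAd EA (D.aR g) * absDetAd EB (D.bL g))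

theorem modularSq_pos (g : G) : 0 < D.modularSq g :=
  div_pos (mul_pos (absDetAd_pos _) (D.jacB_pos _)) (mul_pos (absDetAd_pos _) (absDetAd_pos _))

theorem abs_Q_pos (g : G) : 0 < |D.Q g| := by
  rw [abs_Q_eq]
  exact div_pos (mul_pos (absDetAd_pos _) (D.jacB_pos _))
    (mul_pos (D.jacB_pos _) (absDetAd_pos _))

/-- Both `b_L` and `b_R` are multiplicative on composable pairs, so characters of `B` evaluated on
them are too. The remaining factors are a quotient of the values of one function at the two ends of
the arrow and telescope. -/
theorem modularSq_mulA {x y : G} (h : D.aR x = D.aL y) :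
    D.modularSq (D.mulA x y) = D.modularSq x * D.modularSq y := by
  simp only [modularSq, D.aL_mulA h, D.bR_mulA h, bL_mulA, aR_mulA, h, jacB_mul, absDetAd_mul]
  have := (absDetAd_pos (E := EA) (D.aL y)).ne'
  have := (absDetAd_pos (E := EA) (D.aR y)).ne'
  have := (absDetAd_pos (E := EB) (D.bL x)).ne'
  have := (absDetAd_pos (E := EB) (D.bL y)).ne'
  field_simp

theorem abs_Q_mulA {x y : G} (h : D.aR x = D.aL y) :
    |D.Q (D.mulA x y)| = |D.Q x| * |D.Q y| := by
  simp only [abs_Q_eq, D.aL_mulA h, D.bR_mulA h, bL_mulA, aR_mulA, h, jacB_mul]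
  have := (absDetAd_pos (E := EA) (D.aL y)).ne'
  have := (absDetAd_pos (E := EA) (D.aR y)).ne'
  have := (D.jacB_pos (D.bL x)).ne'
  have := (D.jacB_pos (D.bL y)).ne'
  field_simp

/-- The two factors on the right are taken at the components `u₁`, `u₂` of the decomposition of `a₁
a₂ b` for `m_B`. Infinitesimally, this is how `δ̂` relates the modular group to `σ_z ⊗ τ_z`. -/
theorem modularSq_mul (a₁ a₂ : A) (b : B) : D.modularSq (D.iA (a₁ * a₂) * D.iB b) =
    D.modularSq (D.iA a₁ * D.iB (D.act a₂ b)) * |D.Q (D.iA a₂ * D.iB b)| := by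
  have h1 : D.bL (D.iA a₂ * D.iB b) = D.act a₂ b := rfl
  have h2 : D.bL (D.iA a₁ * D.iB (D.act a₂ b)) = D.act a₁ (D.act a₂ b) := rfl
  have h3 : D.bL (D.iA (a₁ * a₂) * D.iB b) = D.act a₁ (D.act a₂ b) := D.act_mul_left a₁ a₂ b
  have h4 : D.aR (D.iA a₂ * D.iB b) = D.coact a₂ b := rfl
  have h5 : D.aR (D.iA a₁ * D.iB (D.act a₂ b)) = D.coact a₁ (D.act a₂ b) := rfl
  have h6 : D.aR (D.iA (a₁ * a₂) * D.iB b) = D.coact a₁ (D.act a₂ b) * D.coact a₂ b :=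
    D.coact_mul_left a₁ a₂ b
  simp only [modularSq, abs_Q_eq, aL_iA_mul_iB, bR_iA_mul_iB, h1, h2, h3, h4, h5, h6, absDetAd_mul]
  have := (absDetAd_pos (E := EA) (D.coact a₁ (D.act a₂ b))).ne'
  have := (absDetAd_pos (E := EA) (D.coact a₂ b)).ne'
  have := (absDetAd_pos (E := EB) (D.act a₁ (D.act a₂ b))).ne'
  have := (D.jacB_pos (D.act a₂ b)).ne'
  field_simp

theorem modularFunction_cpow (hμ₀ : ∃ v, μ₀.toFun v ≠ 0) (hν₀ : ∃ v, ν₀.toFun v ≠ 0) (z : ℂ)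
    (g : G) : ((|D.modularFunction μ₀ ν₀ g| : ℝ) : ℂ) ^ (2 * Complex.I * z) =
      ((D.modularSq g : ℝ) : ℂ) ^ (Complex.I * z) := by
  have h1 : D.modularFunction μ₀ ν₀ g = Real.sqrt (D.modularSq g) :=
    D.modularFunction_eq μ₀ ν₀ hμ₀ hν₀ g
  have h2 := Real.sqrt_pos.2 (D.modularSq_pos g)
  have h3 : D.modularSq g = Real.sqrt (D.modularSq g) * Real.sqrt (D.modularSq g) :=
    (Real.mul_self_sqrt (D.modularSq_pos g).le).symm
  rw [h1, abs_of_pos h2]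
  conv_rhs => rw [h3, Complex.ofReal_mul, Complex.mul_cpow_ofReal_nonneg h2.le h2.le,
    ← Complex.cpow_add _ _ (Complex.ofReal_ne_zero.2 h2.ne')]
  congr 1
  ring

/-- With `p_i = u_i y_i` in the groupoid, `modularSq_mul` gives `σ²(x) = σ²(u₁) |Q(u₂)|`, and
multiplicativity gives `σ²(u₁) = σ²(p₁)/σ²(y₁)` and `|Q(u₂)| = |Q(p₂)|/|Q(y₂)|`. All bases are
positive, so complex powers respect these products. -/
theorem cpow_modularSq_mul (z : ℂ) (p : G × G) (b : B) :
    ((D.modularSq (D.iA (D.aL p.1 * D.aL p.2) * D.iB b) : ℝ) : ℂ) ^ (Complex.I * z) =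
      ((D.modularSq p.1 : ℝ) : ℂ) ^ (Complex.I * z) * ((|D.Q p.2| : ℝ) : ℂ) ^ (Complex.I * z) *
      (((D.modularSq ((D.iB (D.act (D.aL p.1) (D.act (D.aL p.2) b)))⁻¹ * p.1) : ℝ) : ℂ) ^
          (Complex.I * -z) *
        ((|D.Q ((D.iB (D.act (D.aL p.2) b))⁻¹ * p.2)| : ℝ) : ℂ) ^ (Complex.I * -z)) := by
  set c := D.act (D.aL p.2) b with hc
  set y₁ := (D.iB (D.act (D.aL p.1) c))⁻¹ * p.1 with hy₁
  set y₂ := (D.iB c)⁻¹ * p.2 with hy₂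
  have e1 : D.modularSq p.1 = D.modularSq (D.iA (D.aL p.1) * D.iB c) * D.modularSq y₁ := by
    rw [← D.modularSq_mulA (D.aL_act_inv_mul c p.1).symm, mulA_act_inv_mul]
  have e2 : |D.Q p.2| = |D.Q (D.iA (D.aL p.2) * D.iB b)| * |D.Q y₂| := by
    rw [hy₂, hc, ← D.abs_Q_mulA (D.aL_act_inv_mul b p.2).symm, mulA_act_inv_mul]
  have mulpow : ∀ {r s : ℝ}, 0 < r → 0 < s → ((r * s : ℝ) : ℂ) ^ (Complex.I * z) =
      (r : ℂ) ^ (Complex.I * z) * (s : ℂ) ^ (Complex.I * z) := fun hr hs => by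
    rw [Complex.ofReal_mul, Complex.mul_cpow_ofReal_nonneg hr.le hs.le]
  have nz : ∀ {r : ℝ}, 0 < r → (r : ℂ) ^ (Complex.I * z) ≠ 0 := fun hr => by
    rw [Ne, Complex.cpow_eq_zero_iff, not_and_or]
    exact Or.inl (Complex.ofReal_ne_zero.2 hr.ne')
  rw [D.modularSq_mul, ← hc, e1, e2, mulpow (D.modularSq_pos _) (D.abs_Q_pos _),
    mulpow (D.modularSq_pos _) (D.modularSq_pos _), mulpow (D.abs_Q_pos _) (D.abs_Q_pos _),
    mul_neg, Complex.cpow_neg, Complex.cpow_neg]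
  have n1 := nz (D.modularSq_pos y₁)
  have n2 := nz (D.abs_Q_pos y₂)
  field_simp

theorem coeff_sigma (hμ₀ : ∃ v, μ₀.toFun v ≠ 0) (hν₀ : ∃ v, ν₀.toFun v ≠ 0) (z : ℂ)
    (η : Sec EB G) (g : G) : D.coeff μ₀ (D.sigma μ₀ ν₀ z η) g =
      ((D.modularSq g : ℝ) : ℂ) ^ (Complex.I * z) * D.coeff μ₀ η g := by
  rw [coeff, sigma, D.modularFunction_cpow hμ₀ hν₀, mul_div_assoc]
  rfl

theorem coeff_tau (z : ℂ) (η : Sec EB G) (g : G) : D.coeff μ₀ (D.tau z η) g =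
    ((|D.Q g| : ℝ) : ℂ) ^ (Complex.I * z) * D.coeff μ₀ η g := by
  rw [coeff, tau, mul_div_assoc]
  rfl

theorem coeff₂_tensor (η₁ η₂ : Sec EB G) (p : G × G) :
    D.coeff₂ μ₀ (tensor η₁ η₂) p = D.coeff μ₀ η₁ p.1 * D.coeff μ₀ η₂ p.2 := by
  rw [coeff₂, tensor, Complex.ofReal_mul, mul_div_mul_comm]
  rfl

theorem comul_sigma (hμ₀ : ∃ v, μ₀.toFun v ≠ 0) (hν₀ : ∃ v, ν₀.toFun v ≠ 0) (z : ℂ)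
    (η η₁ η₂ : Sec EB G) :
    D.comul μ₀ (D.sigma μ₀ ν₀ z η) (tensor η₁ η₂) =
      D.sigmaTau μ₀ ν₀ z (D.comul μ₀ η
        (tensor (D.sigma μ₀ ν₀ (-z) η₁) (D.tau (-z) η₂))) := by
  funext p v₁ w₁ v₂ w₂
  rw [sigmaTau, D.modularFunction_cpow hμ₀ hν₀, comul, comul, ofCoeff₂, ofCoeff₂,
    ← mul_assoc, ← mul_assoc]
  congr 1
  rw [leftFibreIntegral, leftFibreIntegral, ← integral_const_mul]
  refine integral_congr_ae (Filter.Eventually.of_forall fun b => ?_)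
  simp only [D.coeff_sigma hμ₀ hν₀, coeff_tau, coeff₂_tensor, deltaL, bR_iA_mul_iB]
  have hc' : D.bL (D.iA (D.aL p.2) * D.iB b) = D.act (D.aL p.2) b := rfl
  rw [hc', mulA_sA_mul, mulA_sA_mul, cpow_modularSq_mul]
  ring

/-! ### The products in terms of coefficients -/

theorem comul_eq (hμ₀ : ∃ v, μ₀.toFun v ≠ 0) (η : Sec EB G) (F : G × G → ℂ) :
    D.comul μ₀ η (D.ofCoeff₂ μ₀ F) = D.ofCoeff₂ μ₀ fun z =>
      ∫ b : B, D.coeff μ₀ η (D.iA (D.aL z.1 * D.aL z.2) * D.iB b) *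
        ((Real.sqrt (absDetAd EB (D.act (D.aL z.2) b)))⁻¹ : ℝ) *
        F ((D.iB (D.act (D.aL z.1) (D.act (D.aL z.2) b)))⁻¹ * z.1,
          (D.iB (D.act (D.aL z.2) b))⁻¹ * z.2) ∂(leftMeasure μ₀) := by
  rw [comul]
  congr 1
  funext z
  rw [leftFibreIntegral]
  refine integral_congr_ae (Filter.Eventually.of_forall fun b => ?_)
  simp only [deltaL, bR_iA_mul_iB, D.coeff₂_ofCoeff₂ hμ₀]
  set c := D.act (D.aL z.2) b with hc
  have hc' : D.bL (D.iA (D.aL z.2) * D.iB b) = c := rfl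
  rw [hc', mulA_sA_mul, mulA_sA_mul, ← hc, D.tDelta_eq μ₀ hμ₀]
  -- The element of `B` entering `t_δ` is the right factor of `b_L(x) a_L(y₁) = a₁ c`, which is `c`.
  · have h1 : D.bL (D.iA (D.aL z.1 * D.aL z.2) * D.iB b) = D.act (D.aL z.1) c :=
      D.act_mul_left _ _ _
    rw [h1, aL_act_inv_mul, act_mul_coact, bR_iA_mul_iB]
  · rw [aL_act_inv_mul, hc, aL_act_inv_mul]
    exact D.coact_mul_left _ _ _

theorem mul₂_eq (hμ₀ : ∃ v, μ₀.toFun v ≠ 0) (X F : G × G → ℂ) :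
    D.mul₂ μ₀ (D.ofCoeff₂ μ₀ X) (D.ofCoeff₂ μ₀ F) = D.ofCoeff₂ μ₀ fun z =>
      ∫ b : B × B, X (D.iA (D.aL z.1) * D.iB b.1, D.iA (D.aL z.2) * D.iB b.2) *
        F ((D.iB (D.act (D.aL z.1) b.1))⁻¹ * z.1, (D.iB (D.act (D.aL z.2) b.2))⁻¹ * z.2)
        ∂((leftMeasure μ₀).prod (leftMeasure μ₀)) := by
  rw [mul₂]
  simp only [D.coeff₂_ofCoeff₂ hμ₀, mulA_sA_mul]

theorem oneTensor_eq (hμ₀ : ∃ v, μ₀.toFun v ≠ 0) (η : Sec EB G) (F : G × G → ℂ) :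
    D.oneTensor μ₀ η (D.ofCoeff₂ μ₀ F) = D.ofCoeff₂ μ₀ fun z =>
      ∫ b : B, D.coeff μ₀ η (D.iA (D.aL z.2) * D.iB b) *
        F (z.1, (D.iB (D.act (D.aL z.2) b))⁻¹ * z.2) ∂(leftMeasure μ₀) := by
  funext z v₁ w₁ v₂ w₂
  have h : (fun (g : G) (v w : Frame EB) => D.ofCoeff₂ μ₀ F (z.1, g) v₁ w₁ v w) =
      D.ofCoeff μ₀ fun g => F (z.1, g) * (D.omega₀ μ₀ z.1 v₁ w₁ : ℂ) := by
    funext g v w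
    simp only [ofCoeff₂, ofCoeff]
    push_cast
    ring
  rw [oneTensor, h, mul, D.coeff_ofCoeff hμ₀]
  simp only [ofCoeff, ofCoeff₂, leftFibreIntegral, mulA_sA_mul, ← mul_assoc]
  rw [integral_mul_const]
  push_cast
  ring

theorem tensorOne_eq (hμ₀ : ∃ v, μ₀.toFun v ≠ 0) (η : Sec EB G) (F : G × G → ℂ) :
    D.tensorOne μ₀ η (D.ofCoeff₂ μ₀ F) = D.ofCoeff₂ μ₀ fun z =>
      ∫ b : B, D.coeff μ₀ η (D.iA (D.aL z.1) * D.iB b) *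
        F ((D.iB (D.act (D.aL z.1) b))⁻¹ * z.1, z.2) ∂(leftMeasure μ₀) := by
  funext z v₁ w₁ v₂ w₂
  have h : (fun (g : G) (v w : Frame EB) => D.ofCoeff₂ μ₀ F (g, z.2) v w v₂ w₂) =
      D.ofCoeff μ₀ fun g => F (g, z.2) * (D.omega₀ μ₀ z.2 v₂ w₂ : ℂ) := by
    funext g v w
    simp only [ofCoeff₂, ofCoeff]
    push_cast
    ring
  rw [tensorOne, h, mul, D.coeff_ofCoeff hμ₀]
  simp only [ofCoeff, ofCoeff₂, leftFibreIntegral, mulA_sA_mul, ← mul_assoc]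
  rw [integral_mul_const]
  push_cast
  ring

end Products

end DoubleLieGroup

namespace DoubleLieGroup

/-! ### Explicit coefficients of the three mixed products. -/

section Elements

variable {EG EA EB : Type*}
  [NormedAddCommGroup EG] [NormedSpace ℝ EG] [FiniteDimensional ℝ EG]
  [NormedAddCommGroup EA] [NormedSpace ℝ EA] [FiniteDimensional ℝ EA]
  [NormedAddCommGroup EB] [NormedSpace ℝ EB] [FiniteDimensional ℝ EB]
  [MeasurableSpace EB] [BorelSpace EB]
  {G A B : Type*}
  [TopologicalSpace G] [ChartedSpace EG G] [Group G] [LieGroup 𝓘(ℝ, EG) ∞ G]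
  [T2Space G] [SecondCountableTopology G]
  [TopologicalSpace A] [ChartedSpace EA A] [Group A] [LieGroup 𝓘(ℝ, EA) ∞ A]
  [TopologicalSpace B] [ChartedSpace EB B] [Group B] [LieGroup 𝓘(ℝ, EB) ∞ B]
  [MeasurableSpace B] [BorelSpace B]
  (D : DoubleLieGroup EG EA EB G A B) {μ₀ : HalfDensity EB}

theorem iB_act_inv_mul (a : A) (b b' : B) :
    (D.iB (D.act a b))⁻¹ * (D.iA a * D.iB b') = D.iA (D.coact a b) * D.iB (b⁻¹ * b') := by
  rw [inv_mul_eq_iff_eq_mul, ← mul_assoc, act_mul_coact, map_mul, map_inv, mul_assoc,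
    mul_inv_cancel_left]

theorem iB_act_mul_inv (a : A) (b b' : B) (g : G) :
    (D.iB (D.act (D.coact a b) b'))⁻¹ * ((D.iB (D.act a b))⁻¹ * g) =
      (D.iB (D.act a (b * b')))⁻¹ * g := by
  rw [act_mul_right, map_mul, mul_inv_rev, mul_assoc]

/-! ### Candidates for the elements -/

/-- The coefficient of `δ̂(f₁ ω₀) (I ⊗ f₂ ω₀)`. -/
def comulOneTensor (f₁ f₂ : G → ℂ) (w : G × G) : ℂ :=
  (((D.jacA (D.aL ((D.iB (D.bR w.1))⁻¹ * w.2)))⁻¹ *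
      (Real.sqrt (absDetAd EB (D.bR w.1)))⁻¹ : ℝ) : ℂ) *
    (f₁ (w.1 * D.iA (D.aL ((D.iB (D.bR w.1))⁻¹ * w.2))) * f₂ ((D.iB (D.bR w.1))⁻¹ * w.2))

/-- The coefficient of `δ̂(f₁ ω₀) (f₂ ω₀ ⊗ I)`. -/
def comulTensorOne (f₁ f₂ : G → ℂ) (w : G × G) : ℂ :=
  (((Real.sqrt (absDetAd EB (D.bL w.2)))⁻¹ : ℝ) : ℂ) *
    (f₁ (D.iA (D.aL w.1) * w.2) * f₂ ((D.iB (D.bL (D.iA (D.aL w.1) * w.2)))⁻¹ * w.1))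

/-- The coefficient of `(f₁ ω₀ ⊗ I) δ̂(f₂ ω₀)`. -/
def tensorOneComul (f₁ f₂ : G → ℂ) (w : G × G) : ℂ :=
  ((Real.sqrt (absDetAd EB (D.bL w.2)) : ℝ) : ℂ) *
    (f₁ (w.1 * (D.iB (D.bL w.2))⁻¹) * f₂ (D.iA (D.aR (w.1 * (D.iB (D.bL w.2))⁻¹)) * w.2))

/-- The continuous left inverse `Ψ` of `(P, R)` confines the support to the image of a compact set;
it replaces a proof that `(P, R)` is proper. -/
theorem isTestFunction_pullback {f₁ f₂ : G → ℂ} (hf₁ : IsTestFunction 𝓘(ℝ, EG) f₁)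
    (hf₂ : IsTestFunction 𝓘(ℝ, EG) f₂) {φ : G × G → ℝ}
    (hφ : ContMDiff (𝓘(ℝ, EG).prod 𝓘(ℝ, EG)) 𝓘(ℝ, ℝ) ∞ φ) {P R : G × G → G}
    (hP : ContMDiff (𝓘(ℝ, EG).prod 𝓘(ℝ, EG)) 𝓘(ℝ, EG) ∞ P)
    (hR : ContMDiff (𝓘(ℝ, EG).prod 𝓘(ℝ, EG)) 𝓘(ℝ, EG) ∞ R) {Ψ : G × G → G × G}
    (hΨ : Continuous Ψ) (h : ∀ w, Ψ (P w, R w) = w) :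
    IsTestFunction (𝓘(ℝ, EG).prod 𝓘(ℝ, EG)) fun w => (φ w : ℂ) * (f₁ (P w) * f₂ (R w)) := by
  refine ⟨hφ.complex_ofReal.complex_mul ((hf₁.1.comp hP).complex_mul (hf₂.1.comp hR)), ?_⟩
  refine HasCompactSupport.intro ((hf₁.2.isCompact.prod hf₂.2.isCompact).image hΨ) fun w hw => ?_
  by_contra h0
  refine hw ⟨(P w, R w), ⟨subset_tsupport _ fun h1 => h0 ?_, subset_tsupport _ fun h1 => h0 ?_⟩,
    h w⟩ <;> simp [h1]

theorem isTestFunction_comulOneTensor {f₁ f₂ : G → ℂ} (hf₁ : IsTestFunction 𝓘(ℝ, EG) f₁)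
    (hf₂ : IsTestFunction 𝓘(ℝ, EG) f₂) :
    IsTestFunction (𝓘(ℝ, EG).prod 𝓘(ℝ, EG)) (D.comulOneTensor f₁ f₂) := by
  have : IsTopologicalGroup G := topologicalGroup_of_lieGroup 𝓘(ℝ, EG) ∞
  have h1 : ContMDiff (𝓘(ℝ, EG).prod 𝓘(ℝ, EG)) 𝓘(ℝ, EB) ∞ fun w : G × G => D.bR w.1 :=
    D.contMDiff_bR.comp contMDiff_fst
  have hR : ContMDiff (𝓘(ℝ, EG).prod 𝓘(ℝ, EG)) 𝓘(ℝ, EG) ∞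
      fun w : G × G => (D.iB (D.bR w.1))⁻¹ * w.2 := (D.smooth_iB.comp h1).inv.mul contMDiff_snd
  have ha := D.contMDiff_aL.comp hR
  have hc := D.contMDiff_aL.continuous
  have hc' := D.smooth_iA.continuous
  have hc2 := D.contMDiff_bR.continuous
  have hc3 := D.smooth_iB.continuous
  refine isTestFunction_pullback hf₁ hf₂ (((D.contMDiff_jacA.comp ha).inv_of_pos
    fun _ => D.jacA_pos _).mul (((contMDiff_absDetAd.comp h1).sqrt_of_pos
      fun _ => absDetAd_pos _).inv_of_pos fun _ => Real.sqrt_pos.2 (absDetAd_pos _)))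
    (contMDiff_fst.mul (D.smooth_iA.comp ha)) hR
    (Ψ := fun q => (q.1 * (D.iA (D.aL q.2))⁻¹, D.iB (D.bR (q.1 * (D.iA (D.aL q.2))⁻¹)) * q.2))
    (by fun_prop) fun w => ?_
  simp

theorem isTestFunction_comulTensorOne {f₁ f₂ : G → ℂ} (hf₁ : IsTestFunction 𝓘(ℝ, EG) f₁)
    (hf₂ : IsTestFunction 𝓘(ℝ, EG) f₂) :
    IsTestFunction (𝓘(ℝ, EG).prod 𝓘(ℝ, EG)) (D.comulTensorOne f₁ f₂) := by
  have : IsTopologicalGroup G := topologicalGroup_of_lieGroup 𝓘(ℝ, EG) ∞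
  have h1 : ContMDiff (𝓘(ℝ, EG).prod 𝓘(ℝ, EG)) 𝓘(ℝ, EB) ∞ fun w : G × G => D.bL w.2 :=
    D.contMDiff_bL.comp contMDiff_snd
  have hP : ContMDiff (𝓘(ℝ, EG).prod 𝓘(ℝ, EG)) 𝓘(ℝ, EG) ∞
      fun w : G × G => D.iA (D.aL w.1) * w.2 :=
    (D.smooth_iA.comp (D.contMDiff_aL.comp contMDiff_fst)).mul contMDiff_snd
  have hc := D.contMDiff_aL.continuous
  have hc' := D.smooth_iA.continuous
  have hc2 := D.contMDiff_bL.continuous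
  have hc3 := D.smooth_iB.continuous
  refine isTestFunction_pullback hf₁ hf₂ (((contMDiff_absDetAd.comp h1).sqrt_of_pos
      fun _ => absDetAd_pos _).inv_of_pos fun _ => Real.sqrt_pos.2 (absDetAd_pos _))
    hP ((D.smooth_iB.comp (D.contMDiff_bL.comp hP)).inv.mul contMDiff_fst)
    (Ψ := fun q => (D.iB (D.bL q.1) * q.2, (D.iA (D.aL (D.iB (D.bL q.1) * q.2)))⁻¹ * q.1))
    (by fun_prop) fun w => ?_
  simp

theorem isTestFunction_tensorOneComul {f₁ f₂ : G → ℂ} (hf₁ : IsTestFunction 𝓘(ℝ, EG) f₁)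
    (hf₂ : IsTestFunction 𝓘(ℝ, EG) f₂) :
    IsTestFunction (𝓘(ℝ, EG).prod 𝓘(ℝ, EG)) (D.tensorOneComul f₁ f₂) := by
  have : IsTopologicalGroup G := topologicalGroup_of_lieGroup 𝓘(ℝ, EG) ∞
  have h1 : ContMDiff (𝓘(ℝ, EG).prod 𝓘(ℝ, EG)) 𝓘(ℝ, EB) ∞ fun w : G × G => D.bL w.2 :=
    D.contMDiff_bL.comp contMDiff_snd
  have hP : ContMDiff (𝓘(ℝ, EG).prod 𝓘(ℝ, EG)) 𝓘(ℝ, EG) ∞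
      fun w : G × G => w.1 * (D.iB (D.bL w.2))⁻¹ := contMDiff_fst.mul (D.smooth_iB.comp h1).inv
  have hc := D.contMDiff_aR.continuous
  have hc' := D.smooth_iA.continuous
  have hc2 := D.contMDiff_bL.continuous
  have hc3 := D.smooth_iB.continuous
  refine isTestFunction_pullback hf₁ hf₂ ((contMDiff_absDetAd.comp h1).sqrt_of_pos
      fun _ => absDetAd_pos _)
    hP ((D.smooth_iA.comp (D.contMDiff_aR.comp hP)).mul contMDiff_snd)
    (Ψ := fun q => (q.1 * D.iB (D.bL ((D.iA (D.aR q.1))⁻¹ * q.2)), (D.iA (D.aR q.1))⁻¹ * q.2))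
    (by fun_prop) fun w => ?_
  simp

/-! ### Integrability -/

theorem integrable_of_compact (hμ₀ : ∃ v, μ₀.toFun v ≠ 0) {H : B × B → ℂ} (hH : Continuous H)
    {K L : Set B} (hK : IsCompact K) (hL : IsCompact L) (h : ∀ b, H b ≠ 0 → b.1 ∈ K ∧ b.2 ∈ L)
    (D : DoubleLieGroup EG EA EB G A B) :
    Integrable H ((leftMeasure μ₀).prod (leftMeasure μ₀)) := by
  have := D.secondCountable_B
  have := D.t2Space_B
  have := isLocallyFiniteMeasure_leftMeasure (M := B) hμ₀
  refine hH.integrable_of_hasCompactSupport (HasCompactSupport.intro (hK.prod hL) fun b hb => ?_)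
  by_contra h0
  exact hb (h b h0)

/-- The projection `b_R` recovers `b` from the argument of `X`, so compact support of `X` alone
bounds the domain of integration. -/
theorem integrable_fibre (hμ₀ : ∃ v, μ₀.toFun v ≠ 0) {X F : G × G → ℂ}
    (hX : IsTestFunction (𝓘(ℝ, EG).prod 𝓘(ℝ, EG)) X) (hF : Continuous F) (z : G × G) :
    Integrable (fun b : B × B => X (D.iA (D.aL z.1) * D.iB b.1, D.iA (D.aL z.2) * D.iB b.2) *
        F ((D.iB (D.act (D.aL z.1) b.1))⁻¹ * z.1, (D.iB (D.act (D.aL z.2) b.2))⁻¹ * z.2))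
      ((leftMeasure μ₀).prod (leftMeasure μ₀)) := by
  have : IsTopologicalGroup G := topologicalGroup_of_lieGroup 𝓘(ℝ, EG) ∞
  have hR := D.contMDiff_bR.continuous
  have hB := D.smooth_iB.continuous
  have h1 := (D.smooth_act_left (D.aL z.1)).continuous
  have h2 := (D.smooth_act_left (D.aL z.2)).continuous
  have hXc := hX.1.continuous
  refine integrable_of_compact hμ₀ (by fun_prop)
    (hX.2.isCompact.image (hR.comp continuous_fst)) (hX.2.isCompact.image (hR.comp continuous_snd))
    (fun b hb => ?_) D
  have h0 := subset_tsupport X (left_ne_zero_of_mul hb)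
  exact ⟨⟨_, h0, D.bR_iA_mul_iB _ _⟩, ⟨_, h0, D.bR_iA_mul_iB _ _⟩⟩

theorem isElement_of_integral_eq (hμ₀ : ∃ v, μ₀.toFun v ≠ 0) {T : Sec₂ EB G → Sec₂ EB G}
    {X : G × G → ℂ} (hX : IsTestFunction (𝓘(ℝ, EG).prod 𝓘(ℝ, EG)) X)
    (h : ∀ F, IsTestFunction (𝓘(ℝ, EG).prod 𝓘(ℝ, EG)) F →
      D.mul₂ μ₀ (D.ofCoeff₂ μ₀ X) (D.ofCoeff₂ μ₀ F) = T (D.ofCoeff₂ μ₀ F)) :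
    D.IsElement μ₀ T (D.ofCoeff₂ μ₀ X) := by
  refine ⟨D.isBidensity₂_ofCoeff₂ hX, fun Ω hΩ => ?_⟩
  have h1 := h _ (D.isTestFunction_coeff₂ (μ₀ := μ₀) hΩ)
  rwa [D.ofCoeff₂_coeff₂ hμ₀ hΩ] at h1

theorem isElement_comulOneTensor (hμ₀ : ∃ v, μ₀.toFun v ≠ 0) {η₁ η₂ : Sec EB G}
    (hη₁ : IsBidensity EG η₁) (hη₂ : IsBidensity EG η₂) :
    D.IsElement μ₀ (fun Ω => D.comul μ₀ η₁ (D.oneTensor μ₀ η₂ Ω))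
      (D.ofCoeff₂ μ₀ (D.comulOneTensor (D.coeff μ₀ η₁) (D.coeff μ₀ η₂))) := by
  have := D.secondCountable_B
  have := isLocallyFiniteMeasure_leftMeasure (M := B) hμ₀
  have hX := D.isTestFunction_comulOneTensor (D.isTestFunction_coeff (μ₀ := μ₀) hη₁)
    (D.isTestFunction_coeff (μ₀ := μ₀) hη₂)
  refine D.isElement_of_integral_eq hμ₀ hX fun F hF => ?_
  rw [D.mul₂_eq hμ₀, D.oneTensor_eq hμ₀, D.comul_eq hμ₀]
  congr 1
  funext z
  rw [integral_prod _ (D.integrable_fibre hμ₀ hX hF.1.continuous z)]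
  set f₁ := D.coeff μ₀ η₁
  set f₂ := D.coeff μ₀ η₂
  set a₁ := D.aL z.1
  set a₂ := D.aL z.2 with ha₂
  symm
  -- The first variable of the coefficient has to be `b₁ = act a₂ b`. This substitution produces the
  -- factor `jacA (coact a₂ b)⁻¹` of `comulOneTensor`; the second variable is then `b₂ = b b'`, a
  -- left translation.
  rw [← D.integral_act hμ₀ a₂⁻¹]
  refine integral_congr_ae (Filter.Eventually.of_forall fun b₁ => ?_)
  beta_reduce
  obtain ⟨b, rfl⟩ : ∃ b, b₁ = D.act a₂ b := ⟨D.act a₂⁻¹ b₁, (D.act_act_inv _ _).symm⟩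
  have hco : D.coact a₂⁻¹ (D.act a₂ b) = (D.coact a₂ b)⁻¹ := by
    have := D.coact_mul_left a₂⁻¹ a₂ b
    rw [inv_mul_cancel, coact_one_left] at this
    exact eq_inv_of_mul_eq_one_left this.symm
  rw [act_inv_act, hco]
  have hL : D.aL ((D.iB (D.act a₂ b))⁻¹ * z.2) = D.coact a₂ b := D.aL_act_inv_mul b z.2
  rw [hL, ← mul_assoc, ← integral_const_mul,
    ← integral_leftMeasure_mul_left hμ₀ b (fun b₂ => D.comulOneTensor f₁ f₂ _ * _)]
  refine integral_congr_ae (Filter.Eventually.of_forall fun b' => ?_)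
  beta_reduce
  rw [comulOneTensor]
  simp only [bR_iA_mul_iB, iB_act_inv_mul, iB_act_mul_inv, aL_iA_mul_iB, inv_mul_cancel_left,
    jacA_inv]
  have h1 : D.iA a₁ * D.iB (D.act a₂ b) * D.iA (D.coact a₂ b) = D.iA (a₁ * a₂) * D.iB b := by
    rw [mul_assoc, act_mul_coact, map_mul, mul_assoc]
  rw [h1]
  push_cast
  ring

theorem isElement_comulTensorOne (hμ₀ : ∃ v, μ₀.toFun v ≠ 0) {η₁ η₂ : Sec EB G}
    (hη₁ : IsBidensity EG η₁) (hη₂ : IsBidensity EG η₂) :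
    D.IsElement μ₀ (fun Ω => D.comul μ₀ η₁ (D.tensorOne μ₀ η₂ Ω))
      (D.ofCoeff₂ μ₀ (D.comulTensorOne (D.coeff μ₀ η₁) (D.coeff μ₀ η₂))) := by
  have := D.secondCountable_B
  have := isLocallyFiniteMeasure_leftMeasure (M := B) hμ₀
  have hX := D.isTestFunction_comulTensorOne (D.isTestFunction_coeff (μ₀ := μ₀) hη₁)
    (D.isTestFunction_coeff (μ₀ := μ₀) hη₂)
  refine D.isElement_of_integral_eq hμ₀ hX fun F hF => ?_
  rw [D.mul₂_eq hμ₀, D.tensorOne_eq hμ₀, D.comul_eq hμ₀]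
  congr 1
  funext z
  rw [integral_prod_symm _ (D.integrable_fibre hμ₀ hX hF.1.continuous z)]
  set f₁ := D.coeff μ₀ η₁
  set f₂ := D.coeff μ₀ η₂
  set a₁ := D.aL z.1
  set a₂ := D.aL z.2
  symm
  refine integral_congr_ae (Filter.Eventually.of_forall fun b => ?_)
  beta_reduce
  have hL : D.aL ((D.iB (D.act a₁ (D.act a₂ b)))⁻¹ * z.1) = D.coact a₁ (D.act a₂ b) :=
    D.aL_act_inv_mul _ z.1
  -- Here `b` is already the second variable, and the first is `act a₂ b · b'`. Only a left
  -- translation is involved, so no Jacobian appears.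
  rw [hL, ← integral_const_mul, ← integral_leftMeasure_mul_left hμ₀ (D.act a₂ b)
    (fun b₁ => D.comulTensorOne f₁ f₂ _ * _)]
  refine integral_congr_ae (Filter.Eventually.of_forall fun b' => ?_)
  beta_reduce
  rw [comulTensorOne]
  have h1 : D.bL (D.iA a₂ * D.iB b) = D.act a₂ b := rfl
  have h2 : D.iA a₁ * (D.iA a₂ * D.iB b) = D.iA (a₁ * a₂) * D.iB b := by
    rw [map_mul, mul_assoc]
  have h3 : D.bL (D.iA (a₁ * a₂) * D.iB b) = D.act a₁ (D.act a₂ b) := D.act_mul_left _ _ _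
  simp only [aL_iA_mul_iB, h1, h2, h3, iB_act_inv_mul, iB_act_mul_inv, inv_mul_cancel_left]
  ring

theorem isElement_tensorOneComul (hμ₀ : ∃ v, μ₀.toFun v ≠ 0) {η₁ η₂ : Sec EB G}
    (hη₁ : IsBidensity EG η₁) (hη₂ : IsBidensity EG η₂) :
    D.IsElement μ₀ (fun Ω => D.tensorOne μ₀ η₁ (D.comul μ₀ η₂ Ω))
      (D.ofCoeff₂ μ₀ (D.tensorOneComul (D.coeff μ₀ η₁) (D.coeff μ₀ η₂))) := by
  have : IsTopologicalGroup G := topologicalGroup_of_lieGroup 𝓘(ℝ, EG) ∞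
  have : IsTopologicalGroup B := topologicalGroup_of_lieGroup 𝓘(ℝ, EB) ∞
  have : IsTopologicalGroup A := topologicalGroup_of_lieGroup 𝓘(ℝ, EA) ∞
  have := D.secondCountable_B
  have := isLocallyFiniteMeasure_leftMeasure (M := B) hμ₀
  have hf₁ := D.isTestFunction_coeff (μ₀ := μ₀) hη₁
  have hf₂ := D.isTestFunction_coeff (μ₀ := μ₀) hη₂
  have hX := D.isTestFunction_tensorOneComul hf₁ hf₂
  refine D.isElement_of_integral_eq hμ₀ hX fun F hF => ?_
  rw [D.mul₂_eq hμ₀, D.comul_eq hμ₀, D.tensorOne_eq hμ₀]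
  congr 1
  funext z
  rw [integral_prod_symm _ (D.integrable_fibre hμ₀ hX hF.1.continuous z)]
  set f₁ := D.coeff μ₀ η₁
  set f₂ := D.coeff μ₀ η₂
  set a₁ := D.aL z.1
  set a₂ := D.aL z.2
  let H : B × B → ℂ := fun b => f₁ (D.iA a₁ * D.iB b.1) *
    (f₂ (D.iA (D.coact a₁ b.1 * a₂) * D.iB b.2) *
      ((Real.sqrt (absDetAd EB (D.act a₂ b.2)))⁻¹ : ℝ) *
      F ((D.iB (D.act a₁ (b.1 * D.act a₂ b.2)))⁻¹ * z.1, (D.iB (D.act a₂ b.2))⁻¹ * z.2))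
  -- In this product the variable of `f₁` is integrated last, whereas the substitution that follows
  -- shifts it by an amount depending on the other variable. The order therefore has to be
  -- exchanged, which requires integrability.
  have hH : Integrable H ((leftMeasure μ₀).prod (leftMeasure μ₀)) := by
    have hR := D.contMDiff_bR.continuous
    have hB := D.smooth_iB.continuous
    have hA := D.smooth_iA.continuous
    have h1 := (D.smooth_act_left a₁).continuous
    have h2 := (D.smooth_act_left a₂).continuous
    have h3 : Continuous fun b => D.coact a₁ b :=
      (D.smooth_coact.comp (contMDiff_const.prodMk contMDiff_id)).continuous
    have hF' := hF.1.continuous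
    have hf₁' := hf₁.1.continuous
    have hf₂' := hf₂.1.continuous
    have h4 : Continuous fun b : B => ((Real.sqrt (absDetAd EB b))⁻¹ : ℝ) :=
      ((contMDiff_absDetAd (E := EB) (M := B)).continuous.sqrt).inv₀
        fun b => (Real.sqrt_pos.2 (absDetAd_pos b)).ne'
    have h5 : Continuous fun b : B × B =>
        (((Real.sqrt (absDetAd EB (D.act a₂ b.2)))⁻¹ : ℝ) : ℂ) :=
      Complex.continuous_ofReal.comp (h4.comp (h2.comp continuous_snd))
    refine integrable_of_compact hμ₀ (by fun_prop) (hf₁.2.isCompact.image hR)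
      (hf₂.2.isCompact.image hR) (fun b hb => ⟨⟨_, subset_tsupport _ (left_ne_zero_of_mul hb),
        D.bR_iA_mul_iB _ _⟩, ⟨_, subset_tsupport _ (left_ne_zero_of_mul (left_ne_zero_of_mul
          (right_ne_zero_of_mul hb))), D.bR_iA_mul_iB _ _⟩⟩) D
  have hL : ∀ b, D.aL ((D.iB (D.act a₁ b))⁻¹ * z.1) = D.coact a₁ b :=
    fun b => D.aL_act_inv_mul _ z.1
  symm
  calc _ = ∫ b : B, ∫ b' : B, H (b, b') ∂(leftMeasure μ₀) ∂(leftMeasure μ₀) := by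
        refine integral_congr_ae (Filter.Eventually.of_forall fun b => ?_)
        beta_reduce
        rw [hL, ← integral_const_mul]
        simp only [H, iB_act_mul_inv]
        rfl
    _ = ∫ b' : B, ∫ b : B, H (b, b') ∂(leftMeasure μ₀) ∂(leftMeasure μ₀) :=
        integral_integral_swap hH
    _ = _ := ?_
  refine integral_congr_ae (Filter.Eventually.of_forall fun b₂ => ?_)
  beta_reduce
  have h1 : D.bL (D.iA a₂ * D.iB b₂) = D.act a₂ b₂ := rfl
  -- The substitution `b₁ = b · act a₂ b₂` is a right translation and costs the modulus. Combined
  -- with the exponent `-1/2` from `t_δ`, it leaves the exponent `+1/2` seen in `tensorOneComul`.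
  have h2 := integral_leftMeasure_mul_right hμ₀ (D.act a₂ b₂)
    (fun b₁ => H (b₁ * (D.act a₂ b₂)⁻¹, b₂))
  simp only [mul_inv_cancel_right] at h2
  rw [h2, ← integral_const_mul]
  refine integral_congr_ae (Filter.Eventually.of_forall fun b₁ => ?_)
  have h3 : D.iA a₁ * D.iB b₁ * (D.iB (D.act a₂ b₂))⁻¹ =
      D.iA a₁ * D.iB (b₁ * (D.act a₂ b₂)⁻¹) := by
    rw [map_mul, map_inv, mul_assoc]
  have h4 : D.aR (D.iA a₁ * D.iB (b₁ * (D.act a₂ b₂)⁻¹)) =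
    D.coact a₁ (b₁ * (D.act a₂ b₂)⁻¹) := rfl
  have h5 : (absDetAd EB (D.act a₂ b₂) : ℂ) * ((Real.sqrt (absDetAd EB (D.act a₂ b₂)))⁻¹ : ℝ) =
      (Real.sqrt (absDetAd EB (D.act a₂ b₂)) : ℝ) := by
    rw [← Complex.ofReal_mul, ← div_eq_mul_inv, Real.div_sqrt]
  simp only [H, tensorOneComul, h1, h3, h4, inv_mul_cancel_right]
  rw [← h5, map_mul D.iA, mul_assoc (D.iA _) (D.iA a₂)]
  ring

end Elements

end DoubleLieGroup

namespace DoubleLieGroup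

/-! ### Uniqueness of elements and the invariance identities. -/

section Main

variable {EG EA EB : Type*}
  [NormedAddCommGroup EG] [NormedSpace ℝ EG] [FiniteDimensional ℝ EG]
  [NormedAddCommGroup EA] [NormedSpace ℝ EA] [FiniteDimensional ℝ EA]
  [NormedAddCommGroup EB] [NormedSpace ℝ EB] [FiniteDimensional ℝ EB]
  [MeasurableSpace EB] [BorelSpace EB]
  {G A B : Type*}
  [TopologicalSpace G] [ChartedSpace EG G] [Group G] [LieGroup 𝓘(ℝ, EG) ∞ G]
  [T2Space G] [SecondCountableTopology G]
  [TopologicalSpace A] [ChartedSpace EA A] [Group A] [LieGroup 𝓘(ℝ, EA) ∞ A]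
  [TopologicalSpace B] [ChartedSpace EB B] [Group B] [LieGroup 𝓘(ℝ, EB) ∞ B]
  [MeasurableSpace B] [BorelSpace B]
  (D : DoubleLieGroup EG EA EB G A B) {μ₀ : HalfDensity EB} {ν₀ : HalfDensity EA}

/-! ### Uniqueness -/

theorem sA_act_inv_mul (a : A) (b : B) :
    D.sA ((D.iB (D.act a b))⁻¹ * D.iA a) = D.iA a * D.iB b := by
  have h := D.sA_eq (D.iA a * D.iB b)
  rw [aL_iA_mul_iB] at h
  rw [← D.sA_sA (D.iA a * D.iB b), h]
  rfl

/-- The difference `e` of the coefficients annihilates every test section by left multiplication.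
Choosing the test coefficient `conj (e ∘ s)` and evaluating at units of the groupoid gives the
integral of `|e|²` over a fibre; `e` is continuous and the measure charges open sets. -/
theorem isElement_unique (hμ₀ : ∃ v, μ₀.toFun v ≠ 0) {T : Sec₂ EB G → Sec₂ EB G}
    {X X' : Sec₂ EB G} (hX : D.IsElement μ₀ T X) (hX' : D.IsElement μ₀ T X') : X = X' := by
  have := D.secondCountable_B
  have := isLocallyFiniteMeasure_leftMeasure (M := B) hμ₀
  have := isOpenPosMeasure_leftMeasure (M := B) hμ₀
  have : IsTopologicalGroup G := topologicalGroup_of_lieGroup 𝓘(ℝ, EG) ∞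
  have hx := D.isTestFunction_coeff₂ (μ₀ := μ₀) hX.1
  have hx' := D.isTestFunction_coeff₂ (μ₀ := μ₀) hX'.1
  rw [← D.ofCoeff₂_coeff₂ hμ₀ hX.1, ← D.ofCoeff₂_coeff₂ hμ₀ hX'.1]
  congr 1
  have hmul : ∀ Ω, IsBidensity₂ EG Ω → D.mul₂ μ₀ X Ω = D.mul₂ μ₀ X' Ω := fun Ω hΩ =>
    (hX.2 Ω hΩ).trans (hX'.2 Ω hΩ).symm
  rw [← D.ofCoeff₂_coeff₂ hμ₀ hX.1, ← D.ofCoeff₂_coeff₂ hμ₀ hX'.1] at hmul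
  set x := D.coeff₂ μ₀ X
  set x' := D.coeff₂ μ₀ X'
  have he : IsTestFunction (𝓘(ℝ, EG).prod 𝓘(ℝ, EG)) fun p => x p - x' p :=
    ⟨hx.1.sub hx'.1, hx.2.sub hx'.2⟩
  set e : G × G → ℂ := fun p => x p - x' p
  have hF : IsTestFunction (𝓘(ℝ, EG).prod 𝓘(ℝ, EG))
      fun p : G × G => (starRingEnd ℂ) (e (D.sA p.1, D.sA p.2)) := by
    have hs : ContMDiff (𝓘(ℝ, EG).prod 𝓘(ℝ, EG)) (𝓘(ℝ, EG).prod 𝓘(ℝ, EG)) ∞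
        fun p : G × G => (D.sA p.1, D.sA p.2) :=
      (D.contMDiff_sA.comp contMDiff_fst).prodMk (D.contMDiff_sA.comp contMDiff_snd)
    refine ⟨(he.1.comp hs).complex_conj, HasCompactSupport.intro
      (he.2.isCompact.image hs.continuous) fun p hp => ?_⟩
    by_contra h0
    refine hp ⟨(D.sA p.1, D.sA p.2), subset_tsupport _ fun h1 => h0 (by rw [h1, map_zero]), ?_⟩
    simp
  have hint := hmul _ (D.isBidensity₂_ofCoeff₂ (μ₀ := μ₀) hF)
  rw [D.mul₂_eq hμ₀, D.mul₂_eq hμ₀] at hint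
  have hint' := congrArg (D.coeff₂ μ₀) hint
  rw [D.coeff₂_ofCoeff₂ hμ₀, D.coeff₂_ofCoeff₂ hμ₀] at hint'
  have key : ∀ (a₁ a₂ : A) (b : B × B), e (D.iA a₁ * D.iB b.1, D.iA a₂ * D.iB b.2) = 0 := by
    -- At the unit `(a₁, a₂)` the two arguments in the convolution are exchanged by `s`, by
    -- `sA_act_inv_mul`. The integrand is therefore a function times its own conjugate.
    intro a₁ a₂
    have h1 := congrFun hint' (D.iA a₁, D.iA a₂)
    have i1 := D.integrable_fibre hμ₀ hx hF.1.continuous (D.iA a₁, D.iA a₂)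
    have i2 := D.integrable_fibre hμ₀ hx' hF.1.continuous (D.iA a₁, D.iA a₂)
    simp only [aL_iA, sA_act_inv_mul] at h1 i1 i2
    have h2 := integral_sub i1 i2
    rw [h1, sub_self] at h2
    let n : B × B → ℝ := fun b => Complex.normSq (e (D.iA a₁ * D.iB b.1, D.iA a₂ * D.iB b.2))
    have hn : ∀ b : B × B, x (D.iA a₁ * D.iB b.1, D.iA a₂ * D.iB b.2) *
          (starRingEnd ℂ) (e (D.iA a₁ * D.iB b.1, D.iA a₂ * D.iB b.2)) -
        x' (D.iA a₁ * D.iB b.1, D.iA a₂ * D.iB b.2) *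
          (starRingEnd ℂ) (e (D.iA a₁ * D.iB b.1, D.iA a₂ * D.iB b.2)) = (n b : ℂ) := fun b => by
      rw [← sub_mul]
      exact Complex.mul_conj _
    have hi : Integrable n ((leftMeasure μ₀).prod (leftMeasure μ₀)) := by
      have h3 := (i1.sub i2).re
      refine h3.congr (Filter.Eventually.of_forall fun b => ?_)
      simp only [Pi.sub_apply, hn]
      exact Complex.ofReal_re _
    simp only [hn] at h2
    replace h2 := Complex.ofReal_eq_zero.1 (integral_complex_ofReal.symm.trans h2)
    rw [integral_eq_zero_iff_of_nonneg (fun b => Complex.normSq_nonneg _) hi] at h2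
    have hB := D.smooth_iB.continuous
    have hc : Continuous n := by
      have := he.1.continuous
      exact Complex.continuous_normSq.comp (this.comp (by fun_prop))
    have h4 : n = 0 := (Continuous.ae_eq_iff_eq _ hc continuous_const).1 h2
    intro b
    exact Complex.normSq_eq_zero.1 (congrFun h4 b)
  funext p
  have h5 := key (D.aL p.1) (D.aL p.2) (D.bR p.1, D.bR p.2)
  simp only [aL_mul_bR] at h5
  exact sub_eq_zero.1 h5

/-! ### The Haar functional -/

section Haar

variable [MeasurableSpace EA] [BorelSpace EA] [MeasurableSpace A] [BorelSpace A]

/-- On `A` the left leg of `ω̃₀` carries `jacA^(1/2)` and the right leg of `ω₀` carries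
`jacA^(-1/2)`, so passing between the two reference sections costs `jacA⁻¹`. -/
theorem haar_eq (hμ₀ : ∃ v, μ₀.toFun v ≠ 0) (η : Sec EB G) : D.haar μ₀ ν₀ η =
    ∫ a : A, ((D.jacA a)⁻¹ : ℝ) * D.coeff μ₀ η (D.iA a) ∂(rightMeasure ν₀) := by
  rw [haar]
  refine integral_congr_ae (Filter.Eventually.of_forall fun a => ?_)
  have hc := Complex.ofReal_ne_zero.2 (HalfDensity.stdFrame_ne_zero hμ₀)
  have hs := Complex.ofReal_ne_zero.2 (Real.sqrt_pos.2 (D.jacA_pos a)).ne'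
  have h1 : ((D.jacA a : ℝ) : ℂ) = (Real.sqrt (D.jacA a) : ℂ) * (Real.sqrt (D.jacA a) : ℂ) := by
    rw [← Complex.ofReal_mul, Real.mul_self_sqrt (D.jacA_pos a).le]
  simp only [coeffTilde, coeff, lamTilde_eq, rhoTilde, omega₀_eq, aL_iA, aR_iA, Real.sqrt_inv]
  push_cast
  rw [h1]
  field_simp

theorem haarId_ofCoeff₂ (hμ₀ : ∃ v, μ₀.toFun v ≠ 0) (X : G × G → ℂ) :
    D.haarId μ₀ ν₀ (D.ofCoeff₂ μ₀ X) = D.ofCoeff μ₀ fun g =>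
      ∫ a : A, ((D.jacA a)⁻¹ : ℝ) * X (D.iA a, g) ∂(rightMeasure ν₀) := by
  funext g v w
  have h : (fun (g' : G) (v' w' : Frame EB) => D.ofCoeff₂ μ₀ X (g', g) v' w' v w) =
      D.ofCoeff μ₀ fun g' => X (g', g) * (D.omega₀ μ₀ g v w : ℂ) := by
    funext g' v' w'
    simp only [ofCoeff₂, ofCoeff]
    push_cast
    ring
  rw [haarId, h, D.haar_eq hμ₀, D.coeff_ofCoeff hμ₀]
  simp only [ofCoeff, ← mul_assoc]
  rw [integral_mul_const]

/-- On the first variable in `A` one has `b_R = e`, and the coefficient reduces to `jacA (a_L g)⁻¹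
f₁(a a_L(g)) f₂(g)`. The weight `jacA a⁻¹` of `h` completes it to a function of `a a_L(g)`, and
`ν_r` is right invariant. -/
theorem haarId_comulOneTensor (hμ₀ : ∃ v, μ₀.toFun v ≠ 0) (hν₀ : ∃ v, ν₀.toFun v ≠ 0)
    {η₁ η₂ : Sec EB G} (hη₂ : IsBidensity EG η₂) :
    D.haarId μ₀ ν₀ (D.ofCoeff₂ μ₀ (D.comulOneTensor (D.coeff μ₀ η₁) (D.coeff μ₀ η₂))) =
      D.haar μ₀ ν₀ η₁ • η₂ := by
  have := D.secondCountable_A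
  rw [D.haarId_ofCoeff₂ hμ₀]
  conv_rhs => rw [← D.ofCoeff_coeff hμ₀ hη₂]
  funext g v w
  change _ = D.haar μ₀ ν₀ η₁ * (D.coeff μ₀ η₂ g * (D.omega₀ μ₀ g v w : ℂ))
  rw [ofCoeff, ← mul_assoc]
  congr 1
  rw [D.haar_eq hμ₀, ← integral_mul_const, ← integral_rightMeasure_mul_right hν₀ (D.aL g)
    (fun a => _ * D.coeff μ₀ η₁ _ * _)]
  refine integral_congr_ae (Filter.Eventually.of_forall fun a => ?_)
  have h1 : absDetAd EB (1 : B) = 1 := fixedPointAction_conj.jac_one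
  simp only [comulOneTensor, bR_iA, map_one, inv_one, one_mul, h1, Real.sqrt_one, mul_one,
    jacA_mul, mul_inv, map_mul]
  push_cast
  ring

theorem cpow_half (q : ℝ) (hq : 0 < q) :
    (q : ℂ) ^ (Complex.I * (Complex.I / 2)) = ((Real.sqrt q)⁻¹ : ℝ) := by
  have h : Complex.I * (Complex.I / 2) = ((-(1 / 2) : ℝ) : ℂ) := by
    rw [← mul_div_assoc, Complex.I_mul_I]
    push_cast
    ring
  rw [h, ← Complex.ofReal_cpow hq.le, Real.rpow_neg hq.le, ← Real.sqrt_eq_rpow]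

/-- Group inversion acts on both legs with Jacobian `1`, so the weight comes only from
`|Q(g⁻¹)|^(-1/2)` and from the ratio of `ω₀` at `g⁻¹` and `g`. -/
theorem kappa_ofCoeff (f : G → ℂ) : D.kappa (D.ofCoeff μ₀ f) = D.ofCoeff μ₀ fun g =>
    ((D.jacA (D.aL g) * (Real.sqrt (absDetAd EB (D.bR g)) *
      (Real.sqrt (absDetAd EB (D.bL g)))⁻¹) : ℝ) : ℂ) * f g⁻¹ := by
  funext g v w
  have hm : ∀ u : Frame EB, μ₀.toFun (fun i => (tangentAt (fun b : B => b⁻¹) (1 : B) :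
      EB →L[ℝ] EB) (u i)) = μ₀.toFun u := fun u => by
    rw [μ₀.map_tangentAt, jac_inv, Real.sqrt_one, one_mul]
  rw [kappa, unitaryCoinverse, tau, leftToRight_inv, rightToLeft_inv, ofCoeff, ofCoeff, omega₀_eq,
    omega₀_eq, hm, hm, cpow_half _ (D.abs_Q_pos _), abs_Q_eq']
  simp only [aL_inv, aR_inv, bL_inv, bR_inv, jacA_inv, absDetAd_inv]
  have p1 := D.jacA_pos (D.aL g)
  have p2 := D.jacA_pos (D.aR g)
  have p3 := absDetAd_pos (E := EB) (D.bL g)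
  have p4 := absDetAd_pos (E := EB) (D.bR g)
  have key : (Real.sqrt ((absDetAd EB (D.bR g))⁻¹ * (D.jacA (D.aL g))⁻¹ /
      ((D.jacA (D.aR g))⁻¹ * (absDetAd EB (D.bL g))⁻¹)))⁻¹ * Real.sqrt (D.jacA (D.aR g))⁻¹⁻¹ =
      D.jacA (D.aL g) * (Real.sqrt (absDetAd EB (D.bR g)) *
        (Real.sqrt (absDetAd EB (D.bL g)))⁻¹) * Real.sqrt (D.jacA (D.aL g))⁻¹ := by
    have h1 : D.jacA (D.aL g) = Real.sqrt (D.jacA (D.aL g)) * Real.sqrt (D.jacA (D.aL g)) :=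
      (Real.mul_self_sqrt p1.le).symm
    have q1 := (Real.sqrt_pos.2 p1).ne'
    have q2 := (Real.sqrt_pos.2 p2).ne'
    have q3 := (Real.sqrt_pos.2 p3).ne'
    have q4 := (Real.sqrt_pos.2 p4).ne'
    rw [Real.sqrt_div (by positivity), Real.sqrt_mul (by positivity), Real.sqrt_mul (by positivity),
      inv_inv]
    simp only [Real.sqrt_inv]
    set s := Real.sqrt (D.jacA (D.aL g))
    rw [h1]
    field_simp
  have key' := congrArg (fun t : ℝ => (t : ℂ)) key
  simp only [Complex.ofReal_mul] at key' ⊢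
  linear_combination (f g⁻¹ * μ₀.toFun v * μ₀.toFun w) * key'

/-- After `κ` the right side is evaluated at `g⁻¹`, where `f₁` sees `a b_R(g)`. Replacing `a` by `a
a_L(g)` turns this into `a g`, the argument on the left, and the weights then agree. No property of
the coefficients is used, so the involution in the first factor plays no role. -/
theorem haarId_comulTensorOne (hμ₀ : ∃ v, μ₀.toFun v ≠ 0) (hν₀ : ∃ v, ν₀.toFun v ≠ 0)
    (f₁ f₂ : G → ℂ) : D.haarId μ₀ ν₀ (D.ofCoeff₂ μ₀ (D.comulTensorOne f₁ f₂)) =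
      D.kappa (D.haarId μ₀ ν₀ (D.ofCoeff₂ μ₀ (D.tensorOneComul f₁ f₂))) := by
  have := D.secondCountable_A
  rw [D.haarId_ofCoeff₂ hμ₀, D.haarId_ofCoeff₂ hμ₀, kappa_ofCoeff]
  congr 1
  funext g
  rw [← integral_rightMeasure_mul_right hν₀ (D.aL g) (fun a => _ * D.tensorOneComul f₁ f₂ _),
    ← integral_const_mul]
  refine integral_congr_ae (Filter.Eventually.of_forall fun a => ?_)
  have h1 : D.iA (a * D.aL g) * (D.iB (D.bR g)⁻¹)⁻¹ = D.iA a * g := by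
    rw [map_mul, map_inv, inv_inv, mul_assoc, aL_mul_bR]
  have h2 : D.iA (D.aR (D.iA a * g)) * g⁻¹ = (D.iB (D.bL (D.iA a * g)))⁻¹ * D.iA a := by
    rw [eq_inv_mul_iff_mul_eq, ← mul_assoc, bL_mul_aR, mul_inv_cancel_right]
  simp only [comulTensorOne, tensorOneComul, bL_inv, h1, h2, aL_iA, jacA_mul, absDetAd_inv,
    Real.sqrt_inv, mul_inv]
  have q1 := Complex.ofReal_ne_zero.2 (D.jacA_pos (D.aL g)).ne'
  have q2 := Complex.ofReal_ne_zero.2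
    (Real.sqrt_pos.2 (absDetAd_pos (E := EB) (D.bR g))).ne'
  push_cast
  field_simp

end Haar

end Main

end DoubleLieGroup

end InvarianceTheory

/-! ### Existence, uniqueness and the three identities assembled. -/

theorem proposition6p3
    {EG EA EB : Type*}
    [NormedAddCommGroup EG] [NormedSpace ℝ EG] [FiniteDimensional ℝ EG]
    [NormedAddCommGroup EA] [NormedSpace ℝ EA] [FiniteDimensional ℝ EA]
    [MeasurableSpace EA] [BorelSpace EA]
    [NormedAddCommGroup EB] [NormedSpace ℝ EB] [FiniteDimensional ℝ EB]
    [MeasurableSpace EB] [BorelSpace EB]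
    {G A B : Type*}
    [TopologicalSpace G] [ChartedSpace EG G] [Group G] [LieGroup 𝓘(ℝ, EG) ((⊤ : ℕ∞) : WithTop ℕ∞) G]
    [T2Space G] [SecondCountableTopology G]
    [TopologicalSpace A] [ChartedSpace EA A] [Group A] [LieGroup 𝓘(ℝ, EA) ((⊤ : ℕ∞) : WithTop ℕ∞) A]
    [MeasurableSpace A] [BorelSpace A]
    [TopologicalSpace B] [ChartedSpace EB B] [Group B] [LieGroup 𝓘(ℝ, EB) ((⊤ : ℕ∞) : WithTop ℕ∞) B]
    [MeasurableSpace B] [BorelSpace B]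
    (D : DoubleLieGroup EG EA EB G A B)
    (μ₀ : HalfDensity EB) (hμ₀ : ∃ v, μ₀.toFun v ≠ 0)
    (ν₀ : HalfDensity EA) (hν₀ : ∃ v, ν₀.toFun v ≠ 0) :
    -- right invariance of the functional
    (∀ ω₁ ω₂ : DoubleLieGroup.Sec EB G,
      DoubleLieGroup.IsBidensity EG ω₁ → DoubleLieGroup.IsBidensity EG ω₂ →
      (∃! X, D.IsElement μ₀ (fun Ω => D.comul μ₀ ω₁ (D.oneTensor μ₀ ω₂ Ω)) X) ∧
      ∀ X, D.IsElement μ₀ (fun Ω => D.comul μ₀ ω₁ (D.oneTensor μ₀ ω₂ Ω)) X →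
        D.haarId μ₀ ν₀ X = D.haar μ₀ ν₀ ω₁ • ω₂) ∧
    -- strong invariance
    (∀ ω₁ ω₂ : DoubleLieGroup.Sec EB G,
      DoubleLieGroup.IsBidensity EG ω₁ → DoubleLieGroup.IsBidensity EG ω₂ →
      (∃! X, D.IsElement μ₀ (fun Ω => D.comul μ₀ (D.star ω₁) (D.tensorOne μ₀ ω₂ Ω)) X) ∧
      (∃! Y, D.IsElement μ₀ (fun Ω => D.tensorOne μ₀ (D.star ω₁) (D.comul μ₀ ω₂ Ω)) Y) ∧
      ∀ X Y, D.IsElement μ₀ (fun Ω => D.comul μ₀ (D.star ω₁) (D.tensorOne μ₀ ω₂ Ω)) X →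
        D.IsElement μ₀ (fun Ω => D.tensorOne μ₀ (D.star ω₁) (D.comul μ₀ ω₂ Ω)) Y →
        D.haarId μ₀ ν₀ X = D.kappa (D.haarId μ₀ ν₀ Y)) ∧
    -- the comultiplication, the modular group and the scaling group
    (∀ (z : ℂ) (ω ω₁ ω₂ : DoubleLieGroup.Sec EB G),
      DoubleLieGroup.IsBidensity EG ω → DoubleLieGroup.IsBidensity EG ω₁ →
      DoubleLieGroup.IsBidensity EG ω₂ →
      D.comul μ₀ (D.sigma μ₀ ν₀ z ω) (DoubleLieGroup.tensor ω₁ ω₂) =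
        D.sigmaTau μ₀ ν₀ z (D.comul μ₀ ω
          (DoubleLieGroup.tensor (D.sigma μ₀ ν₀ (-z) ω₁) (D.tau (-z) ω₂)))) := by
  refine ⟨fun ω₁ ω₂ h₁ h₂ => ?_, fun ω₁ ω₂ h₁ h₂ => ?_, fun z ω ω₁ ω₂ _ _ _ =>
    D.comul_sigma hμ₀ hν₀ z ω ω₁ ω₂⟩
  · have hX := D.isElement_comulOneTensor hμ₀ h₁ h₂
    refine ⟨⟨_, hX, fun X' hX' => D.isElement_unique hμ₀ hX' hX⟩, fun X hX' => ?_⟩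
    rw [D.isElement_unique hμ₀ hX' hX]
    exact D.haarId_comulOneTensor hμ₀ hν₀ h₂
  · have hX := D.isElement_comulTensorOne hμ₀ (D.isBidensity_star h₁) h₂
    have hY := D.isElement_tensorOneComul hμ₀ (D.isBidensity_star h₁) h₂
    refine ⟨⟨_, hX, fun X' hX' => D.isElement_unique hμ₀ hX' hX⟩,
      ⟨_, hY, fun Y' hY' => D.isElement_unique hμ₀ hY' hY⟩, fun X Y hX' hY' => ?_⟩
    rw [D.isElement_unique hμ₀ hX' hX, D.isElement_unique hμ₀ hY' hY]
    exact D.haarId_comulTensorOne hμ₀ hν₀ _ _
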